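/- Let $k$ be a field and $H$ a Hopf $k$-algebra with comultiplication $\Delta(h)=h_{(1)}\otimes h_{(2)}$, counit $\epsilon$ and (not necessarily bijective) antipode $S$. Let $(L,\blacktriangleright,\rho)$, $\rho(x)=x_{[0]}\otimes x_{[1]}\in L\otimes H$, be a braided commutative left-right Yetter–Drinfeld $H$-module algebra, that is: $L$ is a left $H$-module algebra and a right $H$-comodule with $(h_{(1)}\blacktriangleright x_{[0]})\otimes h_{(2)}x_{[1]}=(h_{(2)}\blacktriangleright x)_{[0]}\otimes(h_{(2)}\blacktriangleright x)_{[1]}h_{(1)}$, $\rho(xz)=x_{[0]}z_{[0]}\otimes z_{[1]}x_{[1]}$, $\rho(1)=1\otimes 1$ and $x_{[0]}(x_{[1]}\blacktriangleright z)=zx$. Let $(R,\blacktriangleleft,\lambda)$, $\lambda(y)=y_{[-1]}\otimes y_{[0]}\in H\otimes R$, be a braided commutative right-left Yetter–Drinfeld $H$-module algebra, that is: $R$ is a right $H$-module algebra and a left $H$-comodule with $y_{[-1]}h_{(1)}\otimes(y_{[0]}\blacktriangleleft h_{(2)})=h_{(2)}(y\blacktriangleleft h_{(1)})_{[-1]}\otimes(y\blacktriangleleft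 h_{(1)})_{[0]}$, $\lambda(yw)=w_{[-1]}y_{[-1]}\otimes y_{[0]}w_{[0]}$, $\lambda(1)=1\otimes1$ and $(w\blacktriangleleft y_{[-1]})y_{[0]}=yw$. Say that $L$ and $R$ are compatible via an antiisomorphism of algebras $\phi\colon L\to R$ if $\phi(f\blacktriangleright x)=\phi(x)\blacktriangleleft S f$ and $\lambda(\phi(x))=S(x_{[1]})\otimes\phi(x_{[0]})$ for all $f\in H$, $x\in L$; and compatible via an antiisomorphism of algebras $\theta\colon R\to L$ if $\theta(y\blacktriangleleft f)=Sf\blacktriangleright\theta(y)$ and $\rho(\theta(y))=\theta(y_{[0]})\otimes S(y_{[-1]})$ for all $f\in H$, $y\in R$. Let $L\sharp H$ and $H\sharp R$ be the smash product algebras, with products $(x\sharp f)(z\sharp g)=x(f_{(1)}\blacktriangleright z)\sharp f_{(2)}g$ and $(f\sharp y)(g\sharp w)=fg_{(1)}\sharp(y\blacktriangleleft g_{(2)})w$. Elements $x$, $f$, $y$ are identified with $x\sharp1$, $1\sharp f$ (or $f\sharp 1$), $1\sharp y$, and $\rho(x)$, $\lambda(y)$ are regarded as elements of $L\sharp H$,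 $H\sharp R$. Consider the following structure maps of symmetric Hopf algebroids (in the sense of Böhm and Szlachányi, with left base $L$ and right base $R$). On $L\sharp H$: $\alpha_L(x)=x$, $\beta_L=\rho$, $\Delta_L(x\sharp f)=x\sharp f_{(1)}\otimes_L 1\sharp f_{(2)}$, $\epsilon_L(x\sharp f)=\epsilon(f)x$, $\Delta_R(x\sharp f)=x\sharp f_{(1)}\otimes_R 1\sharp f_{(2)}$, $\tau(x\sharp f)=S(f)S^2(x_{[1]})\cdot x_{[0]}$, together with - ($\phi$) $\alpha_R(y)=S(y_{[-1]})\cdot\phi^{-1}(y_{[0]})$, $\beta_R(y)=\phi^{-1}(y)$, $\epsilon_R(x\sharp f)=\phi(x)\blacktriangleleft f$; or - ($\theta$) $\alpha_R(y)=\rho(\theta(y))$, $\beta_R(y)=y_{[-1]}\blacktriangleright\theta(y_{[0]})$, $\epsilon_R(x\sharp f)=\theta^{-1}(x_{[0]})\blacktriangleleft S(x_{[1]})f$. On $H\sharp R$: $\alpha'_R(y)=y$, $\beta'_R=\lambda$, $\Delta'_R(f\sharp y)=f_{(1)}\sharp1\otimes_R f_{(2)}\sharp y$, $\epsilon'_R(f\sharp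 y)=\epsilon(f)y$, $\Delta'_L(f\sharp y)=f_{(1)}\sharp1\otimes_L f_{(2)}\sharp y$, $\tau'(f\sharp y)=y_{[0]}\cdot S^2(y_{[-1]})S(f)$, together with - ($\phi$) $\alpha'_L(x)=\lambda(\phi(x))$, $\beta'_L(x)=\phi(x_{[0]})\blacktriangleleft x_{[1]}$, $\epsilon'_L(f\sharp y)=fS(y_{[-1]})\blacktriangleright\phi^{-1}(y_{[0]})$; or - ($\theta$) $\alpha'_L(x)=\theta^{-1}(x_{[0]})\cdot S(x_{[1]})$, $\beta'_L(x)=\theta^{-1}(x)$, $\epsilon'_L(f\sharp y)=f\blacktriangleright\theta(y)$. **Theorem.** 1. If $L$ and $R$ are compatible via an antiisomorphism $\phi\colon L\to R$, then $\theta(y)=S(y_{[-1]})\blacktriangleright\phi^{-1}(y_{[0]})$ defines an antiisomorphism $\theta\colon R\to L$, and $L$ and $R$ are compatible via $\theta$. 2. If $L$ and $R$ are compatible via an antiisomorphism $\theta\colon R\to L$, then $\phi(x)=\theta^{-1}(x_{[0]})\blacktriangleleft S(x_{[1]})$ defines an antiisomorphism $\phi\colon L\to R$, and $L$ and $R$ are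 compatible via $\phi$. 3. In either case, with $\phi$ and $\theta$ related as in 1 or 2, the structure maps ($\phi$) and ($\theta$) on $L\sharp H$ are equal and form a symmetric Hopf algebroid, the structure maps ($\phi$) and ($\theta$) on $H\sharp R$ are equal and form a symmetric Hopf algebroid, the map $\Psi(x\sharp f)=\lambda(\phi(x))\cdot f$ is an algebra isomorphism $L\sharp H\to H\sharp R$ with inverse $f\sharp y\mapsto f\cdot\rho(\theta(y))$ which carries the structure maps on $L\sharp H$ to those on $H\sharp R$, and $\theta=\epsilon_L\circ\alpha_R$, $\phi=\epsilon_R\circ\alpha_L$. -/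

import Mathlib

open scoped TensorProduct

noncomputable section

namespace ScalarExt

open TensorProduct Coalgebra Bialgebra

/-! ### Tensor products over noncommutative base algebras

A right action `r` and a left action `l` of an algebra `A` on a vector space `K` are recorded as
linear maps `A → End K`. Only the balancing relations are needed, so the action laws are not part
of the following definitions. -/

section BalancedTensor

variable {k A B K : Type*} [Field k] [Ring A] [Algebra k A] [Ring B] [Algebra k B]
  [Ring K] [Algebra k K]

/-- The subspace of `K ⊗ K` spanned by all `u.a ⊗ v - u ⊗ a.v`. -/
def balancing (r l : A →ₗ[k] Module.End k K) : Submodule k (K ⊗[k] K) :=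
  Submodule.span k {t | ∃ (a : A) (u v : K), t = r a u ⊗ₜ[k] v - u ⊗ₜ[k] l a v}

/-- The tensor product `K ⊗_A K`. -/
abbrev BalancedTensor (r l : A →ₗ[k] Module.End k K) : Type _ := (K ⊗[k] K) ⧸ balancing r l

/-- The subspace of `K ⊗ K ⊗ K` spanned by all `u.a ⊗ v ⊗ w - u ⊗ a.v ⊗ w` for `a ∈ A` and all
`u ⊗ v.b ⊗ w - u ⊗ v ⊗ b.w` for `b ∈ B`. -/
def balancing₃ (r₁ l₁ : A →ₗ[k] Module.End k K) (r₂ l₂ : B →ₗ[k] Module.End k K) :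
    Submodule k (K ⊗[k] (K ⊗[k] K)) :=
  Submodule.span k
    ({t | ∃ (a : A) (u v w : K),
        t = r₁ a u ⊗ₜ[k] (v ⊗ₜ[k] w) - u ⊗ₜ[k] (l₁ a v ⊗ₜ[k] w)} ∪
      {t | ∃ (b : B) (u v w : K),
        t = u ⊗ₜ[k] (r₂ b v ⊗ₜ[k] w) - u ⊗ₜ[k] (v ⊗ₜ[k] l₂ b w)})

/-- The triple tensor product `K ⊗_A K ⊗_B K`. -/
abbrev BalancedTensor₃ (r₁ l₁ : A →ₗ[k] Module.End k K) (r₂ l₂ : B →ₗ[k] Module.End k K) :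
    Type _ := (K ⊗[k] (K ⊗[k] K)) ⧸ balancing₃ r₁ l₁ r₂ l₂

/-- The canonical map `(K ⊗_A K) ⊗ K → K ⊗_A K ⊗_B K`, in curried form. -/
def joinLeft (r₁ l₁ : A →ₗ[k] Module.End k K) (r₂ l₂ : B →ₗ[k] Module.End k K) :
    BalancedTensor r₁ l₁ →ₗ[k] K →ₗ[k] BalancedTensor₃ r₁ l₁ r₂ l₂ :=
  Submodule.liftQ (balancing r₁ l₁)
    (TensorProduct.curry ((balancing₃ r₁ l₁ r₂ l₂).mkQ ∘ₗ
      (TensorProduct.assoc k K K K).toLinearMap)) (by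
    refine Submodule.span_le.2 ?_
    rintro t ⟨a, u, v, rfl⟩
    refine LinearMap.mem_ker.2 (LinearMap.ext fun w => ?_)
    rw [TensorProduct.curry_apply, TensorProduct.sub_tmul, map_sub, LinearMap.zero_apply,
      ← map_sub]
    exact (Submodule.Quotient.mk_eq_zero _).2
      (Submodule.subset_span (Or.inl ⟨a, u, v, w, by simp⟩)))

/-- The canonical map `K ⊗ (K ⊗_B K) → K ⊗_A K ⊗_B K`, in curried form and with the arguments
interchanged. -/
def joinRight (r₁ l₁ : A →ₗ[k] Module.End k K) (r₂ l₂ : B →ₗ[k] Module.End k K) :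
    BalancedTensor r₂ l₂ →ₗ[k] K →ₗ[k] BalancedTensor₃ r₁ l₁ r₂ l₂ :=
  Submodule.liftQ (balancing r₂ l₂)
    (TensorProduct.curry (balancing₃ r₁ l₁ r₂ l₂).mkQ).flip (by
    refine Submodule.span_le.2 ?_
    rintro t ⟨b, v, w, rfl⟩
    refine LinearMap.mem_ker.2 (LinearMap.ext fun u => ?_)
    rw [LinearMap.flip_apply, TensorProduct.curry_apply, TensorProduct.tmul_sub,
      LinearMap.zero_apply]
    exact (Submodule.Quotient.mk_eq_zero _).2
      (Submodule.subset_span (Or.inr ⟨b, u, v, w, rfl⟩)))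

/-- The identity `(Δ₁ ⊗_B id) ∘ Δ₂ = (id ⊗_A Δ₂) ∘ Δ₁` of maps `K → K ⊗_A K ⊗_B K`, where
`Δ₁ : K → K ⊗_A K` and `Δ₂ : K → K ⊗_B K`. It is required for all representatives
`t, s ∈ K ⊗ K` of `Δ₂ x` and `Δ₁ x`; so both sides have to be independent of the
representatives. -/
def Coassociative {r₁ l₁ : A →ₗ[k] Module.End k K} {r₂ l₂ : B →ₗ[k] Module.End k K}
    (Δ₁ : K →ₗ[k] BalancedTensor r₁ l₁) (Δ₂ : K →ₗ[k] BalancedTensor r₂ l₂) : Prop :=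
  ∀ (x : K) (t s : K ⊗[k] K),
    (balancing r₂ l₂).mkQ t = Δ₂ x → (balancing r₁ l₁).mkQ s = Δ₁ x →
      TensorProduct.lift (joinLeft r₁ l₁ r₂ l₂ ∘ₗ Δ₁) t =
        TensorProduct.lift (joinRight r₁ l₁ r₂ l₂ ∘ₗ Δ₂).flip s

end BalancedTensor

/-! ### Bialgebroids and symmetric Hopf algebroids

As above, a condition on `Δ x`, an element of a quotient of `K ⊗ K`, is imposed on all its
representatives in `K ⊗ K`. Products in `K ⊗ K` are those of the tensor product algebra. -/

section Bialgebroid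

variable {k A K : Type*} [Field k] [Ring A] [Algebra k A] [Ring K] [Algebra k K]

/-- The action of `A` on `K` by `a, u ↦ j(a) u`. -/
def mulLeftAction (j : A →ₗ[k] K) : A →ₗ[k] Module.End k K := LinearMap.mul k K ∘ₗ j

/-- The action of `A` on `K` by `a, u ↦ u j(a)`. -/
def mulRightAction (j : A →ₗ[k] K) : A →ₗ[k] Module.End k K := (LinearMap.mul k K).flip ∘ₗ j

/-- The relations of `K ⊗_A K` for the bimodule structure `a.u.b = α(a) β(b) u`:
`β(a) u ⊗ v = u ⊗ α(a) v`. -/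
abbrev leftBalancing (α β : A →ₗ[k] K) : Submodule k (K ⊗[k] K) :=
  balancing (mulLeftAction β) (mulLeftAction α)

/-- The relations of `K ⊗_A K` for the bimodule structure `b.u.a = u α(a) β(b)`:
`u α(a) ⊗ v = u ⊗ v β(a)`. -/
abbrev rightBalancing (α β : A →ₗ[k] K) : Submodule k (K ⊗[k] K) :=
  balancing (mulRightAction α) (mulRightAction β)

variable (k A K) in
/-- The structure maps of a left bialgebroid with base `A` and total algebra `K`, without laws. -/
@[ext]
structure LeftBialgebroidData where
  source : A →ₗ[k] K
  target : A →ₗ[k] K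
  comul : K →ₗ[k] BalancedTensor (mulLeftAction target) (mulLeftAction source)
  counit : K →ₗ[k] A

variable (k A K) in
/-- The structure maps of a right bialgebroid with base `A` and total algebra `K`, without laws. -/
@[ext]
structure RightBialgebroidData where
  source : A →ₗ[k] K
  target : A →ₗ[k] K
  comul : K →ₗ[k] BalancedTensor (mulRightAction source) (mulRightAction target)
  counit : K →ₗ[k] A

/-- The structure maps form a left bialgebroid. -/
structure LeftBialgebroidData.IsLeftBialgebroid (D : LeftBialgebroidData k A K) : Prop where
  source_one : D.source 1 = 1
  source_mul : ∀ a b, D.source (a * b) = D.source a * D.source b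
  target_one : D.target 1 = 1
  target_mul : ∀ a b, D.target (a * b) = D.target b * D.target a
  source_target_comm : ∀ a b, D.source a * D.target b = D.target b * D.source a
  /-- `Δ(a.x.b) = a.Δ(x).b` -/
  comul_bimodule : ∀ (a b : A) (x : K) (t : K ⊗[k] K),
    (leftBalancing D.source D.target).mkQ t = D.comul x →
      D.comul (D.source a * D.target b * x) =
        (leftBalancing D.source D.target).mkQ ((D.source a ⊗ₜ[k] D.target b) * t)
  /-- `ε(a.x.b) = a ε(x) b` -/
  counit_bimodule : ∀ (a b : A) (x : K),
    D.counit (D.source a * D.target b * x) = a * D.counit x * b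
  coassoc : Coassociative D.comul D.comul
  /-- `ε(x₁).x₂ = x` -/
  counit_left : ∀ (x : K) (t : K ⊗[k] K),
    (leftBalancing D.source D.target).mkQ t = D.comul x →
      TensorProduct.lift (LinearMap.mul k K ∘ₗ D.source ∘ₗ D.counit) t = x
  /-- `x₁.ε(x₂) = x` -/
  counit_right : ∀ (x : K) (t : K ⊗[k] K),
    (leftBalancing D.source D.target).mkQ t = D.comul x →
      TensorProduct.lift (LinearMap.mul k K ∘ₗ D.target ∘ₗ D.counit).flip t = x
  /-- The map `x ⊗ (g ⊗ h) ↦ Δ(x) (g ⊗ h)` factors through `K ⊗ (K ⊗_A K)`. -/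
  comul_factor : ∀ (x : K) (t u : K ⊗[k] K),
    (leftBalancing D.source D.target).mkQ t = D.comul x →
      u ∈ leftBalancing D.source D.target → t * u ∈ leftBalancing D.source D.target
  /-- The resulting map `K ⊗ (K ⊗_A K) → K ⊗_A K` is unital. -/
  comul_one : ∀ t u : K ⊗[k] K, (leftBalancing D.source D.target).mkQ t = D.comul 1 →
    (leftBalancing D.source D.target).mkQ (t * u) = (leftBalancing D.source D.target).mkQ u
  /-- The resulting map `K ⊗ (K ⊗_A K) → K ⊗_A K` is a left action. -/
  comul_mul : ∀ (x y : K) (s t p u : K ⊗[k] K),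
    (leftBalancing D.source D.target).mkQ s = D.comul x →
    (leftBalancing D.source D.target).mkQ t = D.comul y →
    (leftBalancing D.source D.target).mkQ p = D.comul (x * y) →
      (leftBalancing D.source D.target).mkQ (p * u) =
        (leftBalancing D.source D.target).mkQ (s * (t * u))
  /-- `x ⊗ a ↦ ε(x α(a))` is unital. -/
  counit_source : ∀ a : A, D.counit (1 * D.source a) = a
  /-- `x ⊗ a ↦ ε(x α(a))` is a left action. -/
  counit_mul_source : ∀ (x y : K) (a : A),
    D.counit (x * y * D.source a) = D.counit (x * D.source (D.counit (y * D.source a)))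

/-- The structure maps form a right bialgebroid. -/
structure RightBialgebroidData.IsRightBialgebroid (D : RightBialgebroidData k A K) : Prop where
  source_one : D.source 1 = 1
  source_mul : ∀ a b, D.source (a * b) = D.source a * D.source b
  target_one : D.target 1 = 1
  target_mul : ∀ a b, D.target (a * b) = D.target b * D.target a
  source_target_comm : ∀ a b, D.source a * D.target b = D.target b * D.source a
  /-- `Δ(b.x.a) = b.Δ(x).a` -/
  comul_bimodule : ∀ (a b : A) (x : K) (t : K ⊗[k] K),
    (rightBalancing D.source D.target).mkQ t = D.comul x →
      D.comul (x * D.source a * D.target b) =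
        (rightBalancing D.source D.target).mkQ (t * (D.target b ⊗ₜ[k] D.source a))
  /-- `ε(b.x.a) = b ε(x) a` -/
  counit_bimodule : ∀ (a b : A) (x : K),
    D.counit (x * D.source a * D.target b) = b * D.counit x * a
  coassoc : Coassociative D.comul D.comul
  /-- `ε(x₁).x₂ = x` -/
  counit_left : ∀ (x : K) (t : K ⊗[k] K),
    (rightBalancing D.source D.target).mkQ t = D.comul x →
      TensorProduct.lift ((LinearMap.mul k K).flip ∘ₗ D.target ∘ₗ D.counit) t = x
  /-- `x₁.ε(x₂) = x` -/
  counit_right : ∀ (x : K) (t : K ⊗[k] K),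
    (rightBalancing D.source D.target).mkQ t = D.comul x →
      TensorProduct.lift ((LinearMap.mul k K).compl₂ (D.source ∘ₗ D.counit)) t = x
  /-- The map `(g ⊗ h) ⊗ x ↦ (g ⊗ h) Δ(x)` factors through `(K ⊗_A K) ⊗ K`. -/
  comul_factor : ∀ (x : K) (t u : K ⊗[k] K),
    (rightBalancing D.source D.target).mkQ t = D.comul x →
      u ∈ rightBalancing D.source D.target → u * t ∈ rightBalancing D.source D.target
  /-- The resulting map `(K ⊗_A K) ⊗ K → K ⊗_A K` is unital. -/
  comul_one : ∀ t u : K ⊗[k] K, (rightBalancing D.source D.target).mkQ t = D.comul 1 →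
    (rightBalancing D.source D.target).mkQ (u * t) = (rightBalancing D.source D.target).mkQ u
  /-- The resulting map `(K ⊗_A K) ⊗ K → K ⊗_A K` is a right action. -/
  comul_mul : ∀ (x y : K) (s t p u : K ⊗[k] K),
    (rightBalancing D.source D.target).mkQ s = D.comul x →
    (rightBalancing D.source D.target).mkQ t = D.comul y →
    (rightBalancing D.source D.target).mkQ p = D.comul (x * y) →
      (rightBalancing D.source D.target).mkQ (u * p) =
        (rightBalancing D.source D.target).mkQ (u * s * t)
  /-- `a ⊗ x ↦ ε(α(a) x)` is unital. -/
  counit_source : ∀ a : A, D.counit (D.source a * 1) = a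
  /-- `a ⊗ x ↦ ε(α(a) x)` is a right action. -/
  counit_source_mul : ∀ (x y : K) (a : A),
    D.counit (D.source a * (x * y)) = D.counit (D.source (D.counit (D.source a * x)) * y)

end Bialgebroid

section HopfAlgebroid

variable {k L R K K' : Type*} [Field k] [Ring L] [Algebra k L] [Ring R] [Algebra k R]
  [Ring K] [Algebra k K] [Ring K'] [Algebra k K']

variable (k L R K) in
/-- The structure maps of a symmetric Hopf algebroid with left base `L`, right base `R` and total
algebra `K`, without laws. -/
@[ext]
structure SymmetricHopfAlgebroidData where
  left : LeftBialgebroidData k L K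
  right : RightBialgebroidData k R K
  antipode : K →ₗ[k] K

/-- The structure maps form a symmetric Hopf algebroid. The base `R` of the right bialgebroid is
not required to be literally the opposite algebra of `L`. -/
structure SymmetricHopfAlgebroidData.IsSymmetricHopfAlgebroid
    (D : SymmetricHopfAlgebroidData k L R K) : Prop where
  isLeftBialgebroid : D.left.IsLeftBialgebroid
  isRightBialgebroid : D.right.IsRightBialgebroid
  antipode_one : D.antipode 1 = 1
  antipode_mul : ∀ x y : K, D.antipode (x * y) = D.antipode y * D.antipode x
  sourceL_counitL_targetR : ∀ y, D.left.source (D.left.counit (D.right.target y)) = D.right.target y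
  targetL_counitL_sourceR : ∀ y, D.left.target (D.left.counit (D.right.source y)) = D.right.source y
  sourceR_counitR_targetL : ∀ x, D.right.source (D.right.counit (D.left.target x)) = D.left.target x
  targetR_counitR_sourceL : ∀ x, D.right.target (D.right.counit (D.left.source x)) = D.left.source x
  /-- `(Δ_R ⊗_L id) ∘ Δ_L = (id ⊗_R Δ_L) ∘ Δ_R` -/
  coassoc_RL : Coassociative D.right.comul D.left.comul
  /-- `(Δ_L ⊗_R id) ∘ Δ_R = (id ⊗_L Δ_R) ∘ Δ_L` -/
  coassoc_LR : Coassociative D.left.comul D.right.comul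
  antipode_targetL : ∀ x, D.antipode (D.left.target x) = D.left.source x
  antipode_targetR : ∀ y, D.antipode (D.right.target y) = D.right.source y
  /-- `μ ∘ (τ ⊗ id) ∘ Δ_L = α_R ∘ ε_R` -/
  antipode_left : ∀ (x : K) (t : K ⊗[k] K),
    (leftBalancing D.left.source D.left.target).mkQ t = D.left.comul x →
      LinearMap.mul' k K (D.antipode.rTensor K t) = D.right.source (D.right.counit x)
  /-- `μ ∘ (id ⊗ τ) ∘ Δ_R = α_L ∘ ε_L` -/
  antipode_right : ∀ (x : K) (t : K ⊗[k] K),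
    (rightBalancing D.right.source D.right.target).mkQ t = D.right.comul x →
      LinearMap.mul' k K (D.antipode.lTensor K t) = D.left.source (D.left.counit x)

/-- The algebra isomorphism `Ψ` carries the structure maps `D` on `K` to the structure maps `D'`
on `K'` (over the same bases). -/
structure SymmetricHopfAlgebroidData.Intertwines (D : SymmetricHopfAlgebroidData k L R K)
    (D' : SymmetricHopfAlgebroidData k L R K') (Ψ : K ≃ₐ[k] K') : Prop where
  sourceL : ∀ x, Ψ (D.left.source x) = D'.left.source x
  targetL : ∀ x, Ψ (D.left.target x) = D'.left.target x
  counitL : ∀ z, D'.left.counit (Ψ z) = D.left.counit z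
  comulL : ∀ (z : K) (t : K ⊗[k] K),
    (leftBalancing D.left.source D.left.target).mkQ t = D.left.comul z →
      D'.left.comul (Ψ z) = (leftBalancing D'.left.source D'.left.target).mkQ
        (TensorProduct.map Ψ.toLinearMap Ψ.toLinearMap t)
  sourceR : ∀ y, Ψ (D.right.source y) = D'.right.source y
  targetR : ∀ y, Ψ (D.right.target y) = D'.right.target y
  counitR : ∀ z, D'.right.counit (Ψ z) = D.right.counit z
  comulR : ∀ (z : K) (t : K ⊗[k] K),
    (rightBalancing D.right.source D.right.target).mkQ t = D.right.comul z →
      D'.right.comul (Ψ z) = (rightBalancing D'.right.source D'.right.target).mkQ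
        (TensorProduct.map Ψ.toLinearMap Ψ.toLinearMap t)
  antipode : ∀ z, Ψ (D.antipode z) = D'.antipode (Ψ z)

end HopfAlgebroid

/-! ### Module algebras, comodules, Yetter-Drinfeld module algebras -/

/-- A left module algebra over the bialgebra `H`; `act h a` is `h ▸ a`. The field `act_mul` says
`h ▸ (a b) = (h₁ ▸ a) (h₂ ▸ b)`. -/
structure LeftModuleAlgebra (k H L : Type*) [Field k] [Ring H] [Bialgebra k H]
    [Ring L] [Algebra k L] where
  act : H →ₗ[k] L →ₗ[k] L
  one_act : ∀ a : L, act 1 a = a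
  mul_act : ∀ (h g : H) (a : L), act (h * g) a = act h (act g a)
  act_mul : ∀ (h : H) (a b : L),
    act h (a * b) = LinearMap.mul' k L (TensorProduct.map (act.flip a) (act.flip b) (comul h))
  act_one : ∀ h : H, act h 1 = counit (R := k) h • (1 : L)

/-- A right module algebra over the bialgebra `H`; `act a h` is `a ◂ h`. The field `mul_act` says
`(a b) ◂ h = (a ◂ h₁) (b ◂ h₂)`. -/
structure RightModuleAlgebra (k H R : Type*) [Field k] [Ring H] [Bialgebra k H]
    [Ring R] [Algebra k R] where
  act : R →ₗ[k] H →ₗ[k] R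
  act_one : ∀ a : R, act a 1 = a
  act_mul : ∀ (a : R) (h g : H), act a (h * g) = act (act a h) g
  mul_act : ∀ (a b : R) (h : H),
    act (a * b) h = LinearMap.mul' k R (TensorProduct.map (act a) (act b) (comul h))
  one_act : ∀ h : H, act 1 h = counit (R := k) h • (1 : R)

/-- A left-right Yetter-Drinfeld module algebra `(L, ▸, ρ)` over `H`, with
`coact a = ρ(a) = a₀ ⊗ a₁ ∈ L ⊗ H`. -/
structure LeftRightYDModuleAlgebra (k H L : Type*) [Field k] [Ring H] [Bialgebra k H]
    [Ring L] [Algebra k L] extends LeftModuleAlgebra k H L where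
  coact : L →ₗ[k] L ⊗[k] H
  /-- `ρ(a₀) ⊗ a₁ = a₀ ⊗ Δ(a₁)` -/
  coassoc : ∀ a : L,
    TensorProduct.assoc k L H H (coact.rTensor H (coact a)) = comul.lTensor L (coact a)
  /-- `ε(a₁) a₀ = a` -/
  coact_counit : ∀ a : L, TensorProduct.rid k L (counit.lTensor L (coact a)) = a
  /-- `(h₁ ▸ a₀) ⊗ h₂ a₁ = (h₂ ▸ a)₀ ⊗ (h₂ ▸ a)₁ h₁` -/
  yetterDrinfeld : ∀ (h : H) (a : L),
    TensorProduct.map₂ act (LinearMap.mul k H) (comul h) (coact a) =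
      TensorProduct.lift
        ((LinearMap.lTensorHom L ∘ₗ (LinearMap.mul k H).flip).compl₂ (coact ∘ₗ act.flip a))
        (comul h)
  /-- `(a b)₀ ⊗ (a b)₁ = a₀ b₀ ⊗ b₁ a₁` -/
  coact_mul : ∀ a b : L,
    coact (a * b) = TensorProduct.map₂ (LinearMap.mul k L) (LinearMap.mul k H).flip
      (coact a) (coact b)
  coact_one : coact 1 = 1 ⊗ₜ 1

/-- Braided commutativity: `x₀ (x₁ ▸ a) = a x`. -/
def LeftRightYDModuleAlgebra.IsBraidedCommutative {k H L : Type*} [Field k] [Ring H]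
    [Bialgebra k H] [Ring L] [Algebra k L] (A : LeftRightYDModuleAlgebra k H L) : Prop :=
  ∀ a x : L, TensorProduct.lift ((LinearMap.mul k L).compl₂ (A.act.flip a)) (A.coact x) = a * x

/-- A right-left Yetter-Drinfeld module algebra `(R, ◂, lam)` over `H`, with
`coact a = lam(a) = a₋₁ ⊗ a₀ ∈ H ⊗ R`. -/
structure RightLeftYDModuleAlgebra (k H R : Type*) [Field k] [Ring H] [Bialgebra k H]
    [Ring R] [Algebra k R] extends RightModuleAlgebra k H R where
  coact : R →ₗ[k] H ⊗[k] R
  /-- `Δ(a₋₁) ⊗ a₀ = a₋₁ ⊗ lam(a₀)` -/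
  coassoc : ∀ a : R,
    TensorProduct.assoc k H H R (comul.rTensor R (coact a)) = coact.lTensor H (coact a)
  /-- `ε(a₋₁) a₀ = a` -/
  coact_counit : ∀ a : R, TensorProduct.lid k R (counit.rTensor R (coact a)) = a
  /-- `a₋₁ h₁ ⊗ (a₀ ◂ h₂) = h₂ (a ◂ h₁)₋₁ ⊗ (a ◂ h₁)₀` -/
  yetterDrinfeld : ∀ (h : H) (a : R),
    TensorProduct.map₂ (LinearMap.mul k H) act (coact a) (comul h) =
      TensorProduct.lift
        ((LinearMap.rTensorHom R ∘ₗ LinearMap.mul k H).compl₂ (coact ∘ₗ act a)).flip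
        (comul h)
  /-- `(a b)₋₁ ⊗ (a b)₀ = b₋₁ a₋₁ ⊗ a₀ b₀` -/
  coact_mul : ∀ a b : R,
    coact (a * b) = TensorProduct.map₂ (LinearMap.mul k H).flip (LinearMap.mul k R)
      (coact a) (coact b)
  coact_one : coact 1 = 1 ⊗ₜ 1

/-- Braided commutativity: `(a ◂ y₋₁) y₀ = y a`. -/
def RightLeftYDModuleAlgebra.IsBraidedCommutative {k H R : Type*} [Field k] [Ring H]
    [Bialgebra k H] [Ring R] [Algebra k R] (B : RightLeftYDModuleAlgebra k H R) : Prop :=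
  ∀ a y : R, TensorProduct.lift ((LinearMap.mul k R) ∘ₗ B.act a) (B.coact y) = y * a

/-! ### The smash product algebra `L ♯ H` -/

section LeftSmash

variable {k H L : Type*} [Field k] [Ring H] [Bialgebra k H] [Ring L] [Algebra k L]

/-- The vector space `L ⊗ H` underlying the smash product `L ♯ H`. -/
@[nolint unusedArguments]
def LeftSmash (_A : LeftModuleAlgebra k H L) : Type _ := L ⊗[k] H

namespace LeftSmash

variable (A : LeftModuleAlgebra k H L)

instance : AddCommGroup (LeftSmash A) := inferInstanceAs (AddCommGroup (L ⊗[k] H))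
instance : Module k (LeftSmash A) := inferInstanceAs (Module k (L ⊗[k] H))

/-- The identification of `L ⊗ H` with `L ♯ H`. -/
def equiv : L ⊗[k] H ≃ₗ[k] LeftSmash A := LinearEquiv.refl k _

/-- The bilinear map `a, h ↦ a ♯ h`. -/
def mk : L →ₗ[k] H →ₗ[k] LeftSmash A :=
  (TensorProduct.mk k L H).compr₂ (equiv A).toLinearMap

/-- The product `(a ♯ h) (b ♯ g) = a (h₁ ▸ b) ♯ h₂ g` as a bilinear map. -/
def mulMap : LeftSmash A →ₗ[k] LeftSmash A →ₗ[k] LeftSmash A :=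
  (((TensorProduct.homTensorHomMap (RingHom.id k) L H L H) ∘ₗ
    (TensorProduct.map
      (LinearMap.mul' k (Module.End k L) ∘ₗ TensorProduct.map (LinearMap.mul k L) A.act)
      (LinearMap.mul k H)) ∘ₗ
    (TensorProduct.assoc k L H H).symm.toLinearMap ∘ₗ
    (comul (R := k) (A := H)).lTensor L).compl₁₂
      (equiv A).symm.toLinearMap (equiv A).symm.toLinearMap).compr₂ (equiv A).toLinearMap

instance : Mul (LeftSmash A) := ⟨fun z w => mulMap A z w⟩
instance : One (LeftSmash A) := ⟨mk A 1 1⟩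

variable {A}

theorem mul_def (z w : LeftSmash A) : z * w = mulMap A z w := rfl

theorem one_def : (1 : LeftSmash A) = mk A 1 1 := rfl

theorem mk_mul_mk (a b : L) (h g : H) :
    mk A a h * mk A b g = equiv A (TensorProduct.map
      (LinearMap.mulLeft k a ∘ₗ A.act.flip b) (LinearMap.mulRight k g) (comul (R := k) h)) := by
  change mulMap A _ _ = _
  simp only [mulMap, mk, LinearMap.compr₂_apply, LinearMap.compl₁₂_apply, LinearMap.comp_apply,
    TensorProduct.mk_apply, LinearEquiv.coe_coe, LinearEquiv.symm_apply_apply,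
    LinearMap.lTensor_tmul]
  congr 1
  induction comul (R := k) h using TensorProduct.induction_on with
  | zero => simp
  | tmul x y => rfl
  | add x y hx hy => simp only [TensorProduct.tmul_add, map_add, LinearMap.add_apply, hx, hy]

theorem induction_on {p : LeftSmash A → Prop} (z : LeftSmash A) (zero : p 0)
    (mk : ∀ a h, p (mk A a h)) (add : ∀ x y, p x → p y → p (x + y)) : p z :=
  TensorProduct.induction_on (motive := p) z zero mk add

theorem mk_mul_mk_repr (a b : L) (h g : H) {ι : Type*} (r : Repr k h ι) :
    mk A a h * mk A b g =
      ∑ i ∈ r.index, mk A (a * A.act (r.left i) b) (r.right i * g) := by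
  rw [mk_mul_mk, ← r.eq]
  simp [map_sum, mk]

theorem mk_mul_right (a c : L) (h g f : H) {ι : Type*} (r : Repr k g ι) :
    mk A a (h * g) * mk A c f =
      ∑ i ∈ r.index, mk A a h * mk A (A.act (r.left i) c) (r.right i * f) := by
  simp only [mk_mul_mk]
  rw [Bialgebra.comul_mul, ← r.eq, Finset.mul_sum, map_sum, map_sum]
  refine Finset.sum_congr rfl fun i _ => ?_
  congr 1
  induction comul (R := k) h using TensorProduct.induction_on with
  | zero => simp
  | tmul x y => simp [A.mul_act, mul_assoc]
  | add x y hx hy => simp only [add_mul, map_add, hx, hy]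

theorem mk_mul_mk_mul (a b c : L) (h f : H) {ι : Type*} (r : Repr k h ι) :
    ∑ i ∈ r.index, mk A (a * A.act (r.left i) b) (r.right i) * mk A c f =
      mk A a h * mk A (b * c) f := by
  let U : H ⊗[k] H →ₗ[k] L :=
    LinearMap.mul' k L ∘ₗ TensorProduct.map (A.act.flip b) (A.act.flip c)
  have hU : A.act.flip (b * c) = U ∘ₗ comul := LinearMap.ext fun x => A.act_mul x b c
  have h1 : mk A a h * mk A (b * c) f = equiv A (TensorProduct.map (LinearMap.mulLeft k a ∘ₗ U)
      (LinearMap.mulRight k f) ((comul (R := k)).rTensor H (comul (R := k) h))) := by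
    rw [mk_mul_mk, hU, LinearMap.rTensor, ← LinearMap.comp_apply (TensorProduct.map _ _)
      (TensorProduct.map _ _), ← TensorProduct.map_comp]
    rfl
  rw [h1, ← Coalgebra.coassoc_symm_apply, ← r.eq]
  simp only [map_sum, LinearMap.lTensor_tmul]
  refine Finset.sum_congr rfl fun i _ => ?_
  rw [mk_mul_mk]
  congr 1
  induction comul (R := k) (r.right i) using TensorProduct.induction_on with
  | zero => simp
  | tmul x y => simp [U]
  | add x y hx hy => simp only [TensorProduct.tmul_add, map_add, hx, hy]

theorem mul_assoc_mk (a b c : L) (h g f : H) :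
    mk A a h * mk A b g * mk A c f = mk A a h * (mk A b g * mk A c f) := by
  have e1 : ∀ (s : Finset (H × H)) (F : H × H → LeftSmash A) (w : LeftSmash A),
      (∑ i ∈ s, F i) * w = ∑ i ∈ s, F i * w := fun s F w => by
    simp [mul_def, map_sum, LinearMap.sum_apply]
  have e2 : ∀ (s : Finset (H × H)) (F : H × H → LeftSmash A) (w : LeftSmash A),
      w * (∑ i ∈ s, F i) = ∑ i ∈ s, w * F i := fun s F w => by
    simp [mul_def, map_sum]
  rw [mk_mul_mk_repr a b h g (ℛ k h), mk_mul_mk_repr b c g f (ℛ k g), e1, e2]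
  simp only [mk_mul_right _ _ _ _ _ (ℛ k g)]
  rw [Finset.sum_comm]
  exact Finset.sum_congr rfl fun i _ => mk_mul_mk_mul _ _ _ _ _ _

instance : Ring (LeftSmash A) where
  __ := (inferInstance : AddCommGroup (LeftSmash A))
  left_distrib x y z := by simp [mul_def]
  right_distrib x y z := by simp [mul_def]
  zero_mul x := by simp [mul_def]
  mul_zero x := by simp [mul_def]
  mul_assoc x y z := by
    have hl : ∀ u v w : LeftSmash A, (u + v) * w = u * w + v * w := fun u v w => by simp [mul_def]
    have hr : ∀ u v w : LeftSmash A, u * (v + w) = u * v + u * w := fun u v w => by simp [mul_def]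
    have hl0 : ∀ w : LeftSmash A, 0 * w = 0 := fun w => by simp [mul_def]
    have hr0 : ∀ w : LeftSmash A, w * 0 = 0 := fun w => by simp [mul_def]
    induction x using LeftSmash.induction_on with
    | zero => simp only [hl0]
    | add u v hu hv => simp only [hl, hu, hv]
    | mk a h =>
      induction y using LeftSmash.induction_on with
      | zero => simp only [hl0, hr0]
      | add u v hu hv => simp only [hl, hr, hu, hv]
      | mk b g =>
        induction z using LeftSmash.induction_on with
        | zero => simp only [hr0]
        | add u v hu hv => simp only [hr, hu, hv]
        | mk c f => exact mul_assoc_mk a b c h g f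
  one_mul x := by
    rw [mul_def]
    induction x using LeftSmash.induction_on with
    | zero => simp
    | add u v hu hv => rw [map_add, hu, hv]
    | mk a h =>
      rw [← mul_def, one_def, mk_mul_mk, Bialgebra.comul_one, Algebra.TensorProduct.one_def]
      simp [A.one_act, mk]
  mul_one x := by
    rw [mul_def]
    induction x using LeftSmash.induction_on with
    | zero => simp
    | add u v hu hv => rw [map_add, LinearMap.add_apply, hu, hv]
    | mk a h =>
      rw [← mul_def, one_def, mk_mul_mk_repr a 1 h 1 (ℛ k h)]
      simp only [A.act_one, mul_smul_comm, mul_one, map_smul, LinearMap.smul_apply]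
      simp only [← map_smul]
      rw [← map_sum, Coalgebra.sum_counit_smul]

instance : Algebra k (LeftSmash A) :=
  Algebra.ofModule (fun r x y => by simp [mul_def]) (fun r x y => by simp [mul_def])

end LeftSmash

end LeftSmash
/-! ### The smash product algebra `H ♯ R` -/

section RightSmash

variable {k H R : Type*} [Field k] [Ring H] [Bialgebra k H] [Ring R] [Algebra k R]

/-- The vector space `H ⊗ R` underlying the smash product `H ♯ R`. -/
@[nolint unusedArguments]
def RightSmash (_B : RightModuleAlgebra k H R) : Type _ := H ⊗[k] R

namespace RightSmash

variable (B : RightModuleAlgebra k H R)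

instance : AddCommGroup (RightSmash B) := inferInstanceAs (AddCommGroup (H ⊗[k] R))
instance : Module k (RightSmash B) := inferInstanceAs (Module k (H ⊗[k] R))

/-- The identification of `H ⊗ R` with `H ♯ R`. -/
def equiv : H ⊗[k] R ≃ₗ[k] RightSmash B := LinearEquiv.refl k _

/-- The bilinear map `h, a ↦ h ♯ a`. -/
def mk : H →ₗ[k] R →ₗ[k] RightSmash B :=
  (TensorProduct.mk k H R).compr₂ (equiv B).toLinearMap

/-- The product `(h ♯ a) (g ♯ b) = h g₁ ♯ (a ◂ g₂) b` as a bilinear map. -/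
def mulMap : RightSmash B →ₗ[k] RightSmash B →ₗ[k] RightSmash B :=
  (((TensorProduct.homTensorHomMap (RingHom.id k) H R H R) ∘ₗ
    (TensorProduct.map (LinearMap.mul k H).flip
      (LinearMap.mul' k (Module.End k R) ∘ₗ
        TensorProduct.map (LinearMap.mul k R).flip B.act.flip ∘ₗ
        (TensorProduct.comm k H R).toLinearMap)) ∘ₗ
    (TensorProduct.assoc k H H R).toLinearMap ∘ₗ
    (comul (R := k) (A := H)).rTensor R).compl₁₂
      (equiv B).symm.toLinearMap (equiv B).symm.toLinearMap).flip.compr₂ (equiv B).toLinearMap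

instance : Mul (RightSmash B) := ⟨fun z w => mulMap B z w⟩
instance : One (RightSmash B) := ⟨mk B 1 1⟩

variable {B}

theorem mul_def (z w : RightSmash B) : z * w = mulMap B z w := rfl

theorem one_def : (1 : RightSmash B) = mk B 1 1 := rfl

theorem mk_mul_mk (h g : H) (a b : R) :
    mk B h a * mk B g b = equiv B (TensorProduct.map
      (LinearMap.mulLeft k h) (LinearMap.mulRight k b ∘ₗ B.act a) (comul (R := k) g)) := by
  change mulMap B _ _ = _
  simp only [mulMap, mk, LinearMap.compr₂_apply, LinearMap.compl₁₂_apply, LinearMap.comp_apply,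
    LinearMap.flip_apply, TensorProduct.mk_apply, LinearEquiv.coe_coe,
    LinearEquiv.symm_apply_apply, LinearMap.rTensor_tmul]
  congr 1
  induction comul (R := k) g using TensorProduct.induction_on with
  | zero => simp
  | tmul x y => rfl
  | add x y hx hy => simp only [TensorProduct.add_tmul, map_add, LinearMap.add_apply, hx, hy]

theorem induction_on {p : RightSmash B → Prop} (z : RightSmash B) (zero : p 0)
    (mk : ∀ h a, p (mk B h a)) (add : ∀ x y, p x → p y → p (x + y)) : p z :=
  TensorProduct.induction_on (motive := p) z zero mk add

theorem mk_mul_mk_repr (h g : H) (a b : R) {ι : Type*} (r : Repr k g ι) :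
    mk B h a * mk B g b =
      ∑ i ∈ r.index, mk B (h * r.left i) (B.act a (r.right i) * b) := by
  rw [mk_mul_mk, ← r.eq]
  simp [map_sum, mk]

theorem mk_mul_left (a c : R) (h g f : H) {ι : Type*} (r : Repr k g ι) :
    mk B h a * mk B (g * f) c =
      ∑ i ∈ r.index, mk B (h * r.left i) (B.act a (r.right i)) * mk B f c := by
  simp only [mk_mul_mk]
  rw [Bialgebra.comul_mul, ← r.eq, Finset.sum_mul, map_sum, map_sum]
  refine Finset.sum_congr rfl fun i _ => ?_
  congr 1
  induction comul (R := k) f using TensorProduct.induction_on with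
  | zero => simp
  | tmul x y => simp [B.act_mul]
  | add x y hx hy => simp only [mul_add, map_add, hx, hy]

theorem mk_mul_mk_mul (a b c : R) (h f : H) {ι : Type*} (r : Repr k f ι) :
    ∑ i ∈ r.index, mk B h a * mk B (r.left i) (B.act b (r.right i) * c) =
      mk B h (a * b) * mk B f c := by
  let U : H ⊗[k] H →ₗ[k] R :=
    LinearMap.mul' k R ∘ₗ TensorProduct.map (B.act a) (B.act b)
  have hU : B.act (a * b) = U ∘ₗ comul := LinearMap.ext fun x => B.mul_act a b x
  have h1 : mk B h (a * b) * mk B f c = equiv B (TensorProduct.map (LinearMap.mulLeft k h)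
      (LinearMap.mulRight k c ∘ₗ U) ((comul (R := k)).lTensor H (comul (R := k) f))) := by
    rw [mk_mul_mk, hU, LinearMap.lTensor, ← LinearMap.comp_apply (TensorProduct.map _ _)
      (TensorProduct.map _ _), ← TensorProduct.map_comp]
    rfl
  rw [h1, ← Coalgebra.coassoc_apply, ← r.eq]
  simp only [map_sum, LinearMap.rTensor_tmul]
  refine Finset.sum_congr rfl fun i _ => ?_
  rw [mk_mul_mk]
  congr 1
  induction comul (R := k) (r.left i) using TensorProduct.induction_on with
  | zero => simp
  | tmul x y => simp [U, mul_assoc]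
  | add x y hx hy => simp only [TensorProduct.add_tmul, map_add, hx, hy]

theorem mul_assoc_mk (a b c : R) (h g f : H) :
    mk B h a * mk B g b * mk B f c = mk B h a * (mk B g b * mk B f c) := by
  have e1 : ∀ (s : Finset (H × H)) (F : H × H → RightSmash B) (w : RightSmash B),
      (∑ i ∈ s, F i) * w = ∑ i ∈ s, F i * w := fun s F w => by
    simp [mul_def, map_sum, LinearMap.sum_apply]
  have e2 : ∀ (s : Finset (H × H)) (F : H × H → RightSmash B) (w : RightSmash B),
      w * (∑ i ∈ s, F i) = ∑ i ∈ s, w * F i := fun s F w => by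
    simp [mul_def, map_sum]
  rw [mk_mul_mk_repr h g a b (ℛ k g), mk_mul_mk_repr g f b c (ℛ k f), e1, e2]
  simp only [mk_mul_left _ _ _ _ _ (ℛ k g)]
  rw [Finset.sum_comm]
  exact Finset.sum_congr rfl fun i _ => (mk_mul_mk_mul _ _ _ _ _ _).symm

instance : Ring (RightSmash B) where
  __ := (inferInstance : AddCommGroup (RightSmash B))
  left_distrib x y z := by simp [mul_def]
  right_distrib x y z := by simp [mul_def]
  zero_mul x := by simp [mul_def]
  mul_zero x := by simp [mul_def]
  mul_assoc x y z := by
    have hl : ∀ u v w : RightSmash B, (u + v) * w = u * w + v * w :=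
      fun u v w => by simp [mul_def]
    have hr : ∀ u v w : RightSmash B, u * (v + w) = u * v + u * w :=
      fun u v w => by simp [mul_def]
    have hl0 : ∀ w : RightSmash B, 0 * w = 0 := fun w => by simp [mul_def]
    have hr0 : ∀ w : RightSmash B, w * 0 = 0 := fun w => by simp [mul_def]
    induction x using RightSmash.induction_on with
    | zero => simp only [hl0]
    | add u v hu hv => simp only [hl, hu, hv]
    | mk h a =>
      induction y using RightSmash.induction_on with
      | zero => simp only [hl0, hr0]
      | add u v hu hv => simp only [hl, hr, hu, hv]
      | mk g b =>
        induction z using RightSmash.induction_on with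
        | zero => simp only [hr0]
        | add u v hu hv => simp only [hr, hu, hv]
        | mk f c => exact mul_assoc_mk a b c h g f
  one_mul x := by
    rw [mul_def]
    induction x using RightSmash.induction_on with
    | zero => simp
    | add u v hu hv => rw [map_add, hu, hv]
    | mk h a =>
      rw [← mul_def, one_def, mk_mul_mk_repr 1 h 1 a (ℛ k h)]
      simp only [B.one_act, smul_mul_assoc, one_mul, map_smul]
      have h1 := congrArg (TensorProduct.rid k H) (Coalgebra.sum_tmul_counit_eq (ℛ k h))
      simp only [map_sum, TensorProduct.rid_tmul, one_smul] at h1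
      conv_rhs => rw [← h1]
      simp only [map_sum, map_smul, LinearMap.sum_apply, LinearMap.smul_apply]
  mul_one x := by
    rw [mul_def]
    induction x using RightSmash.induction_on with
    | zero => simp
    | add u v hu hv => rw [map_add, LinearMap.add_apply, hu, hv]
    | mk h a =>
      rw [← mul_def, one_def, mk_mul_mk, Bialgebra.comul_one, Algebra.TensorProduct.one_def]
      simp [B.act_one, mk]

instance : Algebra k (RightSmash B) :=
  Algebra.ofModule (fun r x y => by simp [mul_def]) (fun r x y => by simp [mul_def])

end RightSmash

end RightSmash

/-! ### Compatible pairs -/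

/-- Antiisomorphisms of algebras `L → R`. -/
abbrev AntiIso (k L R : Type*) [Field k] [Ring L] [Algebra k L] [Ring R] [Algebra k R] : Type _ :=
  L ≃ₐ[k] Rᵐᵒᵖ

section AntiIso

variable {k L R : Type*} [Field k] [Ring L] [Algebra k L] [Ring R] [Algebra k R]

/-- An antiisomorphism as a linear map. -/
def AntiIso.map (φ : AntiIso k L R) : L →ₗ[k] R :=
  (MulOpposite.opLinearEquiv k).symm.toLinearMap ∘ₗ φ.toLinearMap

/-- The inverse of an antiisomorphism as a linear map. -/
def AntiIso.invMap (φ : AntiIso k L R) : R →ₗ[k] L :=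
  φ.symm.toLinearMap ∘ₗ (MulOpposite.opLinearEquiv k).toLinearMap

end AntiIso

section Compatible

variable {k H L R : Type*} [Field k] [Ring H] [HopfAlgebra k H] [Ring L] [Algebra k L]
  [Ring R] [Algebra k R]
  (A : LeftRightYDModuleAlgebra k H L) (B : RightLeftYDModuleAlgebra k H R)

/-- Compatibility via an antiisomorphism `φ : L → R`:
`φ(f ▸ x) = φ(x) ◂ S f` and `φ(x)₋₁ ⊗ φ(x)₀ = S(x₁) ⊗ φ(x₀)`. -/
structure CompatiblePhi (φ : AntiIso k L R) : Prop where
  act : ∀ (f : H) (x : L), φ.map (A.act f x) = B.act (φ.map x) (HopfAlgebra.antipode k f)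
  coact : ∀ x : L, B.coact (φ.map x) =
    TensorProduct.map (HopfAlgebra.antipode k) φ.map (TensorProduct.comm k L H (A.coact x))

/-- Compatibility via an antiisomorphism `θ : R → L`:
`θ(y ◂ f) = S f ▸ θ(y)` and `θ(y)₀ ⊗ θ(y)₁ = θ(y₀) ⊗ S(y₋₁)`. -/
structure CompatibleTheta (θ : AntiIso k R L) : Prop where
  act : ∀ (y : R) (f : H), θ.map (B.act y f) = A.act (HopfAlgebra.antipode k f) (θ.map y)
  coact : ∀ y : R, A.coact (θ.map y) =
    TensorProduct.map θ.map (HopfAlgebra.antipode k) (TensorProduct.comm k H R (B.coact y))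

/-- The map `y ↦ S(y₋₁) ▸ φ⁻¹(y₀)`. -/
def thetaOfPhi (φ : AntiIso k L R) : R →ₗ[k] L :=
  TensorProduct.lift (A.act.compl₁₂ (HopfAlgebra.antipode k) φ.invMap) ∘ₗ B.coact

/-- The map `x ↦ θ⁻¹(x₀) ◂ S(x₁)`. -/
def phiOfTheta (θ : AntiIso k R L) : L →ₗ[k] R :=
  TensorProduct.lift (B.act.compl₁₂ θ.invMap (HopfAlgebra.antipode k)) ∘ₗ A.coact

/-! ### The scalar extension structures on `L ♯ H` -/

/-- The map `x ↦ x ♯ 1`. -/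
def LeftSmash.inL : L →ₗ[k] LeftSmash A.toLeftModuleAlgebra := (LeftSmash.mk _).flip 1

/-- The map `f ↦ 1 ♯ f`. -/
def LeftSmash.inH : H →ₗ[k] LeftSmash A.toLeftModuleAlgebra := LeftSmash.mk _ 1

/-- The map `ρ : L → L ♯ H`. -/
def LeftSmash.rho : L →ₗ[k] LeftSmash A.toLeftModuleAlgebra :=
  (LeftSmash.equiv _).toLinearMap ∘ₗ A.coact

/-- The map `x ♯ f ↦ (x ♯ f₁) ⊗ (1 ♯ f₂)` with values in the tensor product over `k`. -/
def LeftSmash.comulLift : LeftSmash A.toLeftModuleAlgebra →ₗ[k]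
    LeftSmash A.toLeftModuleAlgebra ⊗[k] LeftSmash A.toLeftModuleAlgebra :=
  TensorProduct.map (LeftSmash.equiv _).toLinearMap (LeftSmash.inH A) ∘ₗ
    (TensorProduct.assoc k L H H).symm.toLinearMap ∘ₗ (comul (R := k) (A := H)).lTensor L ∘ₗ
    (LeftSmash.equiv _).symm.toLinearMap

/-- The counit `x ♯ f ↦ ε(f) x`. -/
def LeftSmash.counit : LeftSmash A.toLeftModuleAlgebra →ₗ[k] L :=
  (TensorProduct.rid k L).toLinearMap ∘ₗ (Coalgebra.counit (R := k) (A := H)).lTensor L ∘ₗ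
    (LeftSmash.equiv _).symm.toLinearMap

/-- The map `x ↦ S²(x₁) · x₀`, with values in `L ♯ H`. -/
def LeftSmash.antipodeL : L →ₗ[k] LeftSmash A.toLeftModuleAlgebra :=
  TensorProduct.lift ((LinearMap.mul k (LeftSmash A.toLeftModuleAlgebra)).flip.compl₁₂
    (LeftSmash.inL A)
    (LeftSmash.inH A ∘ₗ HopfAlgebra.antipode k ∘ₗ HopfAlgebra.antipode k)) ∘ₗ A.coact

/-- The antipode `τ(x ♯ f) = S f S²(x₁) · x₀`. -/
def LeftSmash.antipode : LeftSmash A.toLeftModuleAlgebra →ₗ[k] LeftSmash A.toLeftModuleAlgebra :=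
  TensorProduct.lift ((LinearMap.mul k (LeftSmash A.toLeftModuleAlgebra)).flip.compl₁₂
    (LeftSmash.antipodeL A) (LeftSmash.inH A ∘ₗ HopfAlgebra.antipode k)) ∘ₗ
    (LeftSmash.equiv _).symm.toLinearMap

/-- The structure maps on `L ♯ H`, with the source, the target and the counit of the right
bialgebroid as parameters: `α_L(x) = x ♯ 1`, `β_L = ρ`, `Δ_L(x ♯ f) = x ♯ f₁ ⊗_L 1 ♯ f₂`,
`ε_L(x ♯ f) = ε(f) x`, `Δ_R(x ♯ f) = x ♯ f₁ ⊗_R 1 ♯ f₂`, `τ(x ♯ f) = S f S²(x₁) · x₀`. -/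
def leftSmashData (αR βR : R →ₗ[k] LeftSmash A.toLeftModuleAlgebra)
    (εR : LeftSmash A.toLeftModuleAlgebra →ₗ[k] R) :
    SymmetricHopfAlgebroidData k L R (LeftSmash A.toLeftModuleAlgebra) where
  left :=
    { source := LeftSmash.inL A
      target := LeftSmash.rho A
      comul := (leftBalancing (LeftSmash.inL A) (LeftSmash.rho A)).mkQ ∘ₗ LeftSmash.comulLift A
      counit := LeftSmash.counit A }
  right :=
    { source := αR
      target := βR
      comul := (rightBalancing αR βR).mkQ ∘ₗ LeftSmash.comulLift A
      counit := εR }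
  antipode := LeftSmash.antipode A

/-- The structure maps on `L ♯ H` defined by `φ : L → R`:
`α_R(y) = S(y₋₁) · φ⁻¹(y₀)`, `β_R(y) = φ⁻¹(y) ♯ 1`, `ε_R(x ♯ f) = φ(x) ◂ f`. -/
def phiLeftData (φ : AntiIso k L R) :
    SymmetricHopfAlgebroidData k L R (LeftSmash A.toLeftModuleAlgebra) :=
  leftSmashData A
    (TensorProduct.lift ((LinearMap.mul k (LeftSmash A.toLeftModuleAlgebra)).compl₁₂
      (LeftSmash.inH A ∘ₗ HopfAlgebra.antipode k) (LeftSmash.inL A ∘ₗ φ.invMap)) ∘ₗ B.coact)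
    (LeftSmash.inL A ∘ₗ φ.invMap)
    (TensorProduct.lift (B.act ∘ₗ φ.map) ∘ₗ (LeftSmash.equiv _).symm.toLinearMap)

/-- The structure maps on `L ♯ H` defined by `θ : R → L`:
`α_R(y) = ρ(θ(y))`, `β_R(y) = y₋₁ ▸ θ(y₀)`, `ε_R(x ♯ f) = θ⁻¹(x₀) ◂ S(x₁) f`. -/
def thetaLeftData (θ : AntiIso k R L) :
    SymmetricHopfAlgebroidData k L R (LeftSmash A.toLeftModuleAlgebra) :=
  leftSmashData A
    (LeftSmash.rho A ∘ₗ θ.map)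
    (LeftSmash.inL A ∘ₗ TensorProduct.lift (A.act.compl₂ θ.map) ∘ₗ B.coact)
    (TensorProduct.lift B.act ∘ₗ
      TensorProduct.map θ.invMap
        (LinearMap.mul' k H ∘ₗ (HopfAlgebra.antipode k).rTensor H) ∘ₗ
      (TensorProduct.assoc k L H H).toLinearMap ∘ₗ A.coact.rTensor H ∘ₗ
      (LeftSmash.equiv _).symm.toLinearMap)

/-! ### The scalar extension structures on `H ♯ R` -/

/-- The map `y ↦ 1 ♯ y`. -/
def RightSmash.inR : R →ₗ[k] RightSmash B.toRightModuleAlgebra := RightSmash.mk _ 1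

/-- The map `f ↦ f ♯ 1`. -/
def RightSmash.inH : H →ₗ[k] RightSmash B.toRightModuleAlgebra := (RightSmash.mk _).flip 1

/-- The map `lam : R → H ♯ R`. -/
def RightSmash.lam : R →ₗ[k] RightSmash B.toRightModuleAlgebra :=
  (RightSmash.equiv _).toLinearMap ∘ₗ B.coact

/-- The map `f ♯ y ↦ (f₁ ♯ 1) ⊗ (f₂ ♯ y)` with values in the tensor product over `k`. -/
def RightSmash.comulLift : RightSmash B.toRightModuleAlgebra →ₗ[k]
    RightSmash B.toRightModuleAlgebra ⊗[k] RightSmash B.toRightModuleAlgebra :=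
  TensorProduct.map (RightSmash.inH B) (RightSmash.equiv _).toLinearMap ∘ₗ
    (TensorProduct.assoc k H H R).toLinearMap ∘ₗ (comul (R := k) (A := H)).rTensor R ∘ₗ
    (RightSmash.equiv _).symm.toLinearMap

/-- The counit `f ♯ y ↦ ε(f) y`. -/
def RightSmash.counit : RightSmash B.toRightModuleAlgebra →ₗ[k] R :=
  (TensorProduct.lid k R).toLinearMap ∘ₗ (Coalgebra.counit (R := k) (A := H)).rTensor R ∘ₗ
    (RightSmash.equiv _).symm.toLinearMap

/-- The map `y ↦ y₀ · S²(y₋₁)`, with values in `H ♯ R`. -/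
def RightSmash.antipodeR : R →ₗ[k] RightSmash B.toRightModuleAlgebra :=
  TensorProduct.lift ((LinearMap.mul k (RightSmash B.toRightModuleAlgebra)).flip.compl₁₂
    (RightSmash.inH B ∘ₗ HopfAlgebra.antipode k ∘ₗ HopfAlgebra.antipode k)
    (RightSmash.inR B)) ∘ₗ B.coact

/-- The antipode `τ'(f ♯ y) = y₀ · S²(y₋₁) S f`. -/
def RightSmash.antipode :
    RightSmash B.toRightModuleAlgebra →ₗ[k] RightSmash B.toRightModuleAlgebra :=
  TensorProduct.lift ((LinearMap.mul k (RightSmash B.toRightModuleAlgebra)).flip.compl₁₂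
    (RightSmash.inH B ∘ₗ HopfAlgebra.antipode k) (RightSmash.antipodeR B)) ∘ₗ
    (RightSmash.equiv _).symm.toLinearMap

/-- The structure maps on `H ♯ R`, with the source, the target and the counit of the left
bialgebroid as parameters: `α_R(y) = 1 ♯ y`, `β_R = lam`, `Δ_R(f ♯ y) = f₁ ♯ 1 ⊗_R f₂ ♯ y`,
`ε_R(f ♯ y) = ε(f) y`, `Δ_L(f ♯ y) = f₁ ♯ 1 ⊗_L f₂ ♯ y`, `τ'(f ♯ y) = y₀ · S²(y₋₁) S f`. -/
def rightSmashData (αL βL : L →ₗ[k] RightSmash B.toRightModuleAlgebra)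
    (εL : RightSmash B.toRightModuleAlgebra →ₗ[k] L) :
    SymmetricHopfAlgebroidData k L R (RightSmash B.toRightModuleAlgebra) where
  left :=
    { source := αL
      target := βL
      comul := (leftBalancing αL βL).mkQ ∘ₗ RightSmash.comulLift B
      counit := εL }
  right :=
    { source := RightSmash.inR B
      target := RightSmash.lam B
      comul := (rightBalancing (RightSmash.inR B) (RightSmash.lam B)).mkQ ∘ₗ
        RightSmash.comulLift B
      counit := RightSmash.counit B }
  antipode := RightSmash.antipode B

/-- The structure maps on `H ♯ R` defined by `φ : L → R`:
`α_L(x) = lam(φ(x))`, `β_L(x) = φ(x₀) ◂ x₁`, `ε_L(f ♯ y) = f S(y₋₁) ▸ φ⁻¹(y₀)`. -/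
def phiRightData (φ : AntiIso k L R) :
    SymmetricHopfAlgebroidData k L R (RightSmash B.toRightModuleAlgebra) :=
  rightSmashData B
    (RightSmash.lam B ∘ₗ φ.map)
    (RightSmash.inR B ∘ₗ TensorProduct.lift (B.act ∘ₗ φ.map) ∘ₗ A.coact)
    (TensorProduct.lift A.act ∘ₗ
      TensorProduct.map (LinearMap.mul' k H ∘ₗ (HopfAlgebra.antipode k).lTensor H) φ.invMap ∘ₗ
      (TensorProduct.assoc k H H R).symm.toLinearMap ∘ₗ B.coact.lTensor H ∘ₗ
      (RightSmash.equiv _).symm.toLinearMap)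

/-- The structure maps on `H ♯ R` defined by `θ : R → L`:
`α_L(x) = θ⁻¹(x₀) · S(x₁)`, `β_L(x) = 1 ♯ θ⁻¹(x)`, `ε_L(f ♯ y) = f ▸ θ(y)`. -/
def thetaRightData (θ : AntiIso k R L) :
    SymmetricHopfAlgebroidData k L R (RightSmash B.toRightModuleAlgebra) :=
  rightSmashData B
    (TensorProduct.lift ((LinearMap.mul k (RightSmash B.toRightModuleAlgebra)).compl₁₂
      (RightSmash.inR B ∘ₗ θ.invMap) (RightSmash.inH B ∘ₗ HopfAlgebra.antipode k)) ∘ₗ A.coact)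
    (RightSmash.inR B ∘ₗ θ.invMap)
    (TensorProduct.lift (A.act.compl₂ θ.map) ∘ₗ (RightSmash.equiv _).symm.toLinearMap)

/-- The map `Ψ(x ♯ f) = lam(φ(x)) · f`. -/
def psi (φ : AntiIso k L R) :
    LeftSmash A.toLeftModuleAlgebra →ₗ[k] RightSmash B.toRightModuleAlgebra :=
  TensorProduct.lift ((LinearMap.mul k (RightSmash B.toRightModuleAlgebra)).compl₁₂
    (RightSmash.lam B ∘ₗ φ.map) (RightSmash.inH B)) ∘ₗ (LeftSmash.equiv _).symm.toLinearMap

/-- The map `f ♯ y ↦ f · ρ(θ(y))`. -/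
def psiBar (θ : AntiIso k R L) :
    RightSmash B.toRightModuleAlgebra →ₗ[k] LeftSmash A.toLeftModuleAlgebra :=
  TensorProduct.lift ((LinearMap.mul k (LeftSmash A.toLeftModuleAlgebra)).compl₁₂
    (LeftSmash.inH A) (LeftSmash.rho A ∘ₗ θ.map)) ∘ₗ (RightSmash.equiv _).symm.toLinearMap

end Compatible

end ScalarExt
end

open ScalarExt

open scoped TensorProduct

noncomputable section

namespace ScalarExt

open TensorProduct Coalgebra Bialgebra

/-! ### Sweedler calculus -/

section Sweedler

set_option linter.unusedSectionVars false

variable {k M N P Q X : Type*} [Field k] [AddCommGroup M] [Module k M] [AddCommGroup N]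
  [Module k N] [AddCommGroup P] [Module k P] [AddCommGroup Q] [Module k Q]
  [AddCommGroup X] [Module k X]

/-! Everything rests on computations inside the two smash products. In `L ♯ H`, braided
commutativity says that `ρ(x)` commutes with all of `L`, so that `ρ` is antimultiplicative, and the
Yetter–Drinfeld condition is the exchange rule `h ρ(x) = ρ(h₂ ▸ x) h₁`. Since `ε_L ∘ ρ = id`,
identities in `L` can be checked after applying `ρ`.

For part 1 the decisive identity is `ρ(θ(y)) = S(y₋₁) · φ⁻¹(y₀)` (`rho_thetaOfPhi`). It yields the
coaction of `θ(y)` and the antimultiplicativity of `θ`; the compatibility with the actions comes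
from the Yetter–Drinfeld condition of `R`, and the inverse of `θ` is `x ↦ φ(x₀) ◂ x₁`. Cancellations
that involve `S²` take place under an outer `S`, so `S⁻¹` never appears. Part 2 is the mirror image
in `H ♯ R`, based on `lam(φ(x)) = θ⁻¹(x₀) · S(x₁)`. The formulas for the inverses show that the two
constructions undo each other, so either hypothesis of part 3 leads to the same symmetric notion,
`CompatiblePair`.

For part 3, both comultiplications of `L ♯ H` are induced by one map `D(x ♯ f) = (x ♯ f₁) ⊗ (1 ♯
f₂)` into the tensor product over `k`, and `D` is a coassociative algebra map. What remains of the
bialgebroid axioms and of mixed coassociativity is that multiplication by `D(u)` preserves the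
balancing relations (the Takeuchi condition), and that `D(β_L)` and `D(α_R)` are `1 ⊗ β_L` and `1 ⊗
α_R` modulo the respective relations. The counits are `u ▸ 1` and `1 ◂ u` for actions of `L ♯ H` on
`L` and on `R`, and the antipode is `τ(x ♯ f) = S f · ρ(θ(φ(x)))`.

None of this is repeated for `H ♯ R`. The elements `h ρ(θ(y))` span `L ♯ H` and `Ψ` sends them to `h
♯ y`; most of the structure maps are compared on them, and the axioms are then transported along
`Ψ`. -/

variable (k) in
/-- Linearity as a predicate on functions. -/
@[fun_prop]
structure Lin (f : M → N) : Prop where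
  map_add : ∀ x y, f (x + y) = f x + f y
  map_smul : ∀ (c : k) x, f (c • x) = c • f x

namespace Lin

/-- The linear map given by a linear function. -/
def toLinearMap {f : M → N} (hf : Lin k f) : M →ₗ[k] N where
  toFun := f
  map_add' := hf.map_add
  map_smul' := hf.map_smul

@[fun_prop]
theorem id' : Lin k (fun x : M => x) := ⟨fun _ _ => rfl, fun _ _ => rfl⟩

@[fun_prop]
theorem comp {f : N → P} {g : M → N} (hf : Lin k f) (hg : Lin k g) : Lin k (fun x => f (g x)) :=
  ⟨fun x y => (congrArg f (hg.map_add x y)).trans (hf.map_add _ _),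
    fun c x => (congrArg f (hg.map_smul c x)).trans (hf.map_smul _ _)⟩

@[fun_prop]
theorem linearMap (F : N →ₗ[k] P) {g : M → N} (hg : Lin k g) : Lin k (fun x => F (g x)) :=
  ⟨fun x y => by rw [hg.map_add, _root_.map_add], fun c x => by rw [hg.map_smul, _root_.map_smul]⟩

@[fun_prop]
theorem linearEquiv (F : N ≃ₗ[k] P) {g : M → N} (hg : Lin k g) : Lin k (fun x => F (g x)) :=
  linearMap F.toLinearMap hg

@[fun_prop]
theorem apply {g : M → N →ₗ[k] P} (hg : Lin k g) (y : N) : Lin k (fun x => g x y) :=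
  ⟨fun x z => by rw [hg.map_add, LinearMap.add_apply],
    fun c x => by rw [hg.map_smul, LinearMap.smul_apply]⟩

@[fun_prop]
theorem smul_const {f : M → k} (hf : Lin k f) (n : N) : Lin k (fun x => f x • n) :=
  ⟨fun x y => by rw [hf.map_add, add_smul],
    fun c x => by rw [hf.map_smul, smul_assoc]⟩

@[fun_prop]
theorem const_smul (c : k) {f : M → N} (hf : Lin k f) : Lin k (fun x => c • f x) :=
  ⟨fun x y => by rw [hf.map_add, smul_add],
    fun c x => by rw [hf.map_smul, smul_comm]⟩

@[fun_prop]
theorem tmul_left {f : M → N} (hf : Lin k f) (p : P) : Lin k (fun x => f x ⊗ₜ[k] p) :=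
  ⟨fun x y => by rw [hf.map_add, add_tmul], fun c x => by rw [hf.map_smul, smul_tmul']⟩

@[fun_prop]
theorem tmul_right {f : M → N} (hf : Lin k f) (p : P) : Lin k (fun x => p ⊗ₜ[k] f x) :=
  ⟨fun x y => by rw [hf.map_add, tmul_add], fun c x => by rw [hf.map_smul, tmul_smul]⟩

section Mul

variable {K : Type*} [Ring K] [Algebra k K]

@[fun_prop]
theorem mul_const {f : M → K} (hf : Lin k f) (b : K) : Lin k (fun x => f x * b) :=
  ⟨fun x y => by rw [hf.map_add, add_mul], fun c x => by rw [hf.map_smul, smul_mul_assoc]⟩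

@[fun_prop]
theorem const_mul {f : M → K} (hf : Lin k f) (b : K) : Lin k (fun x => b * f x) :=
  ⟨fun x y => by rw [hf.map_add, mul_add], fun c x => by rw [hf.map_smul, mul_smul_comm]⟩

end Mul

theorem map_sum {f : M → N} (hf : Lin k f) {ι : Type*} (s : Finset ι) (g : ι → M) :
    f (∑ i ∈ s, g i) = ∑ i ∈ s, f (g i) :=
  _root_.map_sum hf.toLinearMap g s

end Lin

/-- The sum `∑ f(mᵢ, nᵢ)` for a presentation `t = ∑ mᵢ ⊗ nᵢ`. -/
def sweedler (t : M ⊗[k] N) (f : M → N → P) : P :=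
  ∑ p ∈ (TensorProduct.exists_finset t).choose, f p.1 p.2

theorem sweedler_tmul (t : M ⊗[k] N) : sweedler t (fun m n => m ⊗ₜ[k] n) = t :=
  (TensorProduct.exists_finset t).choose_spec.symm

/-- A Sweedler sum is an honest finite sum, so linear maps pass through it whether or not `f` is
bilinear. -/
theorem map_sweedler (t : M ⊗[k] N) (f : M → N → P) {g : P → Q} (hg : Lin k g) :
    g (sweedler t f) = sweedler t fun m n => g (f m n) :=
  hg.map_sum _ _

theorem linearMap_sweedler (g : P →ₗ[k] Q) (t : M ⊗[k] N) (f : M → N → P) :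
    g (sweedler t f) = sweedler t fun m n => g (f m n) :=
  map_sweedler t f (by fun_prop)

theorem linearEquiv_sweedler (g : P ≃ₗ[k] Q) (t : M ⊗[k] N) (f : M → N → P) :
    g (sweedler t f) = sweedler t fun m n => g (f m n) :=
  map_sweedler t f (by fun_prop)

theorem apply_sweedler (t : M ⊗[k] N) (f : M → N → P →ₗ[k] Q) (p : P) :
    (sweedler t f) p = sweedler t fun m n => f m n p :=
  map_sweedler t f (g := fun z => z p) (by fun_prop)

theorem sweedler_tmul_left (t : M ⊗[k] N) (f : M → N → P) (q : Q) :
    (sweedler t f) ⊗ₜ[k] q = sweedler t fun m n => f m n ⊗ₜ[k] q :=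
  map_sweedler t f (g := fun z => z ⊗ₜ[k] q) (by fun_prop)

theorem sweedler_tmul_right (t : M ⊗[k] N) (f : M → N → P) (q : Q) :
    q ⊗ₜ[k] (sweedler t f) = sweedler t fun m n => q ⊗ₜ[k] f m n :=
  map_sweedler t f (g := fun z => q ⊗ₜ[k] z) (by fun_prop)

theorem sweedler_mul {K : Type*} [Ring K] [Algebra k K] (t : M ⊗[k] N) (f : M → N → K) (q : K) :
    (sweedler t f) * q = sweedler t fun m n => f m n * q :=
  map_sweedler t f (g := fun z => z * q) (by fun_prop)

theorem mul_sweedler {K : Type*} [Ring K] [Algebra k K] (t : M ⊗[k] N) (f : M → N → K) (q : K) :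
    q * (sweedler t f) = sweedler t fun m n => q * f m n :=
  map_sweedler t f (g := fun z => q * z) (by fun_prop)

theorem sweedler_comm {M' N' : Type*} [AddCommGroup M'] [Module k M'] [AddCommGroup N']
    [Module k N'] (t : M ⊗[k] N) (s : M' ⊗[k] N') (f : M → N → M' → N' → P) :
    sweedler t (fun a b => sweedler s (fun c d => f a b c d)) =
      sweedler s (fun c d => sweedler t (fun a b => f a b c d)) :=
  Finset.sum_comm

/-- The linear map on a tensor product given by a bilinear function. -/
def bilinLift (f : M → N → P) (h₁ : ∀ n, Lin k (fun m => f m n)) (h₂ : ∀ m, Lin k (f m)) :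
    M ⊗[k] N →ₗ[k] P :=
  TensorProduct.lift (LinearMap.mk₂ k f (fun a b c => (h₁ c).map_add a b)
    (fun c a b => (h₁ b).map_smul c a) (fun a b c => (h₂ a).map_add b c)
    (fun c a b => (h₂ a).map_smul c b))

theorem sweedler_eq_bilinLift (t : M ⊗[k] N) (f : M → N → P) (h₁ : ∀ n, Lin k (fun m => f m n))
    (h₂ : ∀ m, Lin k (f m)) : sweedler t f = bilinLift f h₁ h₂ t := by
  conv_rhs => rw [← sweedler_tmul t]
  rw [linearMap_sweedler]
  simp [bilinLift]

/-- The presentation chosen for `m ⊗ n` need not be the one-term presentation; bilinearity makes the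
sum independent of the choice. -/
theorem tmul_sweedler (m : M) (n : N) (f : M → N → P) (h₁ : ∀ n, Lin k (fun m => f m n))
    (h₂ : ∀ m, Lin k (fun n => f m n)) : sweedler (m ⊗ₜ[k] n) f = f m n := by
  rw [sweedler_eq_bilinLift _ f h₁ h₂]
  simp [bilinLift]

@[fun_prop]
theorem Lin.sweedler_fun (t : M ⊗[k] N) {f : X → M → N → P} (hf : ∀ m n, Lin k (fun x => f x m n)) :
    Lin k (fun x => sweedler t (f x)) :=
  ⟨fun x y => by simp only [sweedler, (hf _ _).map_add, Finset.sum_add_distrib],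
    fun c x => by simp only [sweedler, (hf _ _).map_smul, Finset.smul_sum]⟩

-- Bilinearity of `f` is needed because the presentations chosen for different tensors are
-- unrelated. With this rule `fun_prop` handles nested Sweedler sums.
@[fun_prop]
theorem Lin.sweedler {t : X → M ⊗[k] N} {f : M → N → P} (ht : Lin k t)
    (h₁ : ∀ n, Lin k (fun m => f m n)) (h₂ : ∀ m, Lin k (fun n => f m n)) :
    Lin k (fun x => sweedler (t x) f) := by
  simp only [sweedler_eq_bilinLift _ f h₁ h₂]
  fun_prop

theorem lift_eq_sweedler (F : M →ₗ[k] N →ₗ[k] P) (t : M ⊗[k] N) :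
    TensorProduct.lift F t = sweedler t fun m n => F m n := by
  conv_lhs => rw [← sweedler_tmul t, linearMap_sweedler]
  simp

theorem sweedler_sweedler {M' N' : Type*} [AddCommGroup M'] [Module k M'] [AddCommGroup N']
    [Module k N'] (t : M ⊗[k] N) (g : M → N → M' ⊗[k] N') (f : M' → N' → P)
    (h₁ : ∀ n, Lin k (fun m => f m n)) (h₂ : ∀ m, Lin k (fun n => f m n)) :
    sweedler (sweedler t g) f = sweedler t fun m n => sweedler (g m n) f :=
  map_sweedler t g (g := fun z => sweedler z f) (by fun_prop)

end Sweedler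

/-! ### Sweedler rules in a Hopf algebra -/

section HopfSweedler

variable {k H M N P : Type*} [Field k] [Ring H] [HopfAlgebra k H]
  [AddCommGroup M] [Module k M] [AddCommGroup N] [Module k N] [AddCommGroup P] [Module k P]

local notation "Δ" => comul (R := k)
local notation "ε" => counit (R := k)
local notation "S" => HopfAlgebra.antipode k

theorem sweedler_comul_coassoc (h : H) (F : H → H → H → M) (h₁ : ∀ b c, Lin k (fun a => F a b c))
    (h₂ : ∀ a c, Lin k (fun b => F a b c)) (h₃ : ∀ a b, Lin k (fun c => F a b c)) :
    sweedler (Δ h) (fun a b => sweedler (Δ a) fun c d => F c d b) =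
      sweedler (Δ h) (fun a b => sweedler (Δ b) fun c d => F a c d) := by
  have expand : ∀ a b, sweedler (Δ a) (fun c d => F c d b) =
      sweedler (TensorProduct.assoc k H H H (Δ a ⊗ₜ[k] b)) fun a s =>
        sweedler s fun c d => F a c d := by
    intro a b
    conv_rhs => rw [← sweedler_tmul (Δ a)]
    simp (disch := fun_prop) only [sweedler_tmul_left, linearEquiv_sweedler,
      TensorProduct.assoc_tmul, sweedler_sweedler, tmul_sweedler]
  have key := congrArg (fun t => sweedler t fun a s => sweedler s fun c d => F a c d)
    (Coalgebra.coassoc_apply (R := k) h)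
  simp only [LinearMap.rTensor, LinearMap.lTensor] at key
  rw [← sweedler_tmul (Δ h)] at key
  simpa (disch := fun_prop) only [linearMap_sweedler, linearEquiv_sweedler, TensorProduct.map_tmul,
    LinearMap.id_apply, sweedler_sweedler, tmul_sweedler, expand] using key

theorem sweedler_counit_left (h : H) (F : H → M) (hF : Lin k F) :
    sweedler (Δ h) (fun a b => ε a • F b) = F h := by
  have key := congrArg (fun t => sweedler t fun (c : k) b => c • F b)
    (Coalgebra.rTensor_counit_comul (R := k) h)
  rw [← sweedler_tmul (Δ h)] at key
  simpa (disch := fun_prop) only [linearMap_sweedler, LinearMap.rTensor_tmul, sweedler_sweedler,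
    tmul_sweedler, one_smul] using key

theorem sweedler_counit_right (h : H) (F : H → M) (hF : Lin k F) :
    sweedler (Δ h) (fun a b => ε b • F a) = F h := by
  have key := congrArg (fun t => sweedler t fun b (c : k) => c • F b)
    (Coalgebra.lTensor_counit_comul (R := k) h)
  rw [← sweedler_tmul (Δ h)] at key
  simpa (disch := fun_prop) only [linearMap_sweedler, LinearMap.lTensor_tmul, sweedler_sweedler,
    tmul_sweedler, one_smul] using key

theorem sweedler_comul_mul (h g : H) (F : H → H → M) (h₁ : ∀ b, Lin k (fun a => F a b))
    (h₂ : ∀ a, Lin k (fun b => F a b)) :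
    sweedler (Δ (h * g)) F =
      sweedler (Δ h) fun a b => sweedler (Δ g) fun c d => F (a * c) (b * d) := by
  conv_lhs => rw [Bialgebra.comul_mul, ← sweedler_tmul (Δ h), ← sweedler_tmul (Δ g)]
  simp (disch := fun_prop) only [sweedler_mul, mul_sweedler,
    Algebra.TensorProduct.tmul_mul_tmul, sweedler_sweedler, tmul_sweedler]
  exact sweedler_comm _ _ _

theorem sweedler_comul_one (F : H → H → M) (h₁ : ∀ b, Lin k (fun a => F a b))
    (h₂ : ∀ a, Lin k (fun b => F a b)) : sweedler (Δ (1 : H)) F = F 1 1 := by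
  rw [Bialgebra.comul_one, Algebra.TensorProduct.one_def, tmul_sweedler _ _ _ h₁ h₂]

theorem sweedler_antipode_mul (h : H) (F : H → M) (hF : Lin k F) :
    sweedler (Δ h) (fun a b => F (S a * b)) = ε h • F 1 := by
  have key := congrArg F (HopfAlgebra.mul_antipode_rTensor_comul_apply (R := k) h)
  rw [← sweedler_tmul (Δ h), Algebra.algebraMap_eq_smul_one, hF.map_smul] at key
  simpa only [linearMap_sweedler, LinearMap.rTensor_tmul, LinearMap.mul'_apply,
    map_sweedler _ _ hF] using key

theorem sweedler_mul_antipode (h : H) (F : H → M) (hF : Lin k F) :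
    sweedler (Δ h) (fun a b => F (a * S b)) = ε h • F 1 := by
  have key := congrArg F (HopfAlgebra.mul_antipode_lTensor_comul_apply (R := k) h)
  rw [← sweedler_tmul (Δ h), Algebra.algebraMap_eq_smul_one, hF.map_smul] at key
  simpa only [linearMap_sweedler, LinearMap.lTensor_tmul, LinearMap.mul'_apply,
    map_sweedler _ _ hF] using key

/-- Coassociativity brings the two cancelling factors into one coproduct; the counit absorbs the
resulting scalar. The three variants below serve the other positions of `S`. -/
theorem sweedler_antipode_mul_left (h : H) (F : H → H → M) (h₁ : ∀ b, Lin k (fun a => F a b))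
    (h₂ : ∀ a, Lin k (fun b => F a b)) :
    sweedler (Δ h) (fun a b => sweedler (Δ b) fun c d => F (S a * c) d) = F 1 h := by
  rw [← sweedler_comul_coassoc h (fun a c d => F (S a * c) d)
    (by fun_prop) (by fun_prop) (by fun_prop)]
  have cancel : ∀ z d, sweedler (Δ z) (fun a c => F (S a * c) d) = ε z • F 1 d := fun z d =>
    sweedler_antipode_mul z (fun u => F u d) (by fun_prop)
  simp (disch := fun_prop) only [cancel, sweedler_counit_left]

theorem sweedler_mul_antipode_left (h : H) (F : H → H → M) (h₁ : ∀ b, Lin k (fun a => F a b))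
    (h₂ : ∀ a, Lin k (fun b => F a b)) :
    sweedler (Δ h) (fun a b => sweedler (Δ b) fun c d => F (a * S c) d) = F 1 h := by
  rw [← sweedler_comul_coassoc h (fun a c d => F (a * S c) d)
    (by fun_prop) (by fun_prop) (by fun_prop)]
  have cancel : ∀ z d, sweedler (Δ z) (fun a c => F (a * S c) d) = ε z • F 1 d := fun z d =>
    sweedler_mul_antipode z (fun u => F u d) (by fun_prop)
  simp (disch := fun_prop) only [cancel, sweedler_counit_left]

theorem sweedler_antipode_mul_right (h : H) (F : H → H → M) (h₁ : ∀ b, Lin k (fun a => F a b))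
    (h₂ : ∀ a, Lin k (fun b => F a b)) :
    sweedler (Δ h) (fun a b => sweedler (Δ b) fun c d => F a (S c * d)) = F h 1 := by
  have cancel : ∀ z a, sweedler (Δ z) (fun c d => F a (S c * d)) = ε z • F a 1 := fun z a =>
    sweedler_antipode_mul z (fun u => F a u) (by fun_prop)
  simp only [cancel]
  rw [sweedler_counit_right h (fun a => F a 1) (by fun_prop)]

theorem sweedler_mul_antipode_right (h : H) (F : H → H → M) (h₁ : ∀ b, Lin k (fun a => F a b))
    (h₂ : ∀ a, Lin k (fun b => F a b)) :
    sweedler (Δ h) (fun a b => sweedler (Δ b) fun c d => F a (c * S d)) = F h 1 := by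
  have cancel : ∀ z a, sweedler (Δ z) (fun c d => F a (c * S d)) = ε z • F a 1 := fun z a =>
    sweedler_mul_antipode z (fun u => F a u) (by fun_prop)
  simp only [cancel]
  rw [sweedler_counit_right h (fun a => F a 1) (by fun_prop)]

/-- Uniqueness of inverses in the convolution algebra of linear maps `H → H ⊗ H`: the right-hand
side is a left inverse of `Δ`, and `Δ ∘ S` is a right inverse. -/
theorem comul_antipode (h : H) : Δ (S h) = sweedler (Δ h) fun a b => S b ⊗ₜ[k] S a := by
  have conv : ∀ f g : H →ₗ[k] H ⊗[k] H, ∀ x : H,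
      (WithConv.toConv f * WithConv.toConv g).ofConv x = sweedler (Δ x) fun a b => f a * g b := by
    intro f g x
    rw [LinearMap.convMul_def]
    conv_lhs => simp only [WithConv.ofConv_toConv, LinearMap.comp_apply]
    conv_lhs => rw [← sweedler_tmul (Δ x)]
    simp only [linearMap_sweedler, TensorProduct.map_tmul, LinearMap.mul'_apply]
  let G : H →ₗ[k] H ⊗[k] H :=
    Lin.toLinearMap (f := fun h : H => sweedler (Δ h) fun a b => S b ⊗ₜ[k] S a) (by fun_prop)
  have hG : WithConv.toConv G * WithConv.toConv (comul (R := k) (A := H)) = 1 := by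
    refine WithConv.ext (LinearMap.ext fun x => ?_)
    rw [conv]
    -- The product is `S(x₂) x₃ ⊗ S(x₁) x₄`: the inner pair cancels first, then the outer one.
    calc sweedler (Δ x) (fun a b => (sweedler (Δ a) fun c d => S d ⊗ₜ[k] S c) * Δ b)
        = sweedler (Δ x) (fun a b => (sweedler (Δ a) fun c d => S d ⊗ₜ[k] S c) *
            sweedler (Δ b) fun e f => e ⊗ₜ[k] f) := by simp only [sweedler_tmul]
      _ = sweedler (Δ x) fun a b => sweedler (Δ b) fun c d => sweedler (Δ d) fun e f =>
            (S c * e) ⊗ₜ[k] (S a * f) := by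
          simp only [sweedler_mul]
          simp (disch := fun_prop) only [sweedler_comul_coassoc]
          simp only [mul_sweedler, Algebra.TensorProduct.tmul_mul_tmul]
      _ = sweedler (Δ x) fun a b => 1 ⊗ₜ[k] (S a * b) := by
          congr! 3 with a b
          exact sweedler_antipode_mul_left b (fun u v => u ⊗ₜ[k] (S a * v))
            (by fun_prop) (by fun_prop)
      _ = _ := by
          rw [sweedler_antipode_mul x (fun z => (1 : H) ⊗ₜ[k] z) (by fun_prop)]
          simp [LinearMap.convOne_def, Algebra.algebraMap_eq_smul_one,
            Algebra.TensorProduct.one_def]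
  have := left_inv_eq_right_inv hG LinearMap.comul_right_inv
  exact (LinearMap.congr_fun (WithConv.toConv_injective this) h).symm

theorem sweedler_comul_antipode (h : H) (F : H → H → M) (h₁ : ∀ b, Lin k (fun a => F a b))
    (h₂ : ∀ a, Lin k (fun b => F a b)) :
    sweedler (Δ (S h)) F = sweedler (Δ h) fun a b => F (S b) (S a) := by
  rw [comul_antipode]
  simp (disch := fun_prop) only [sweedler_sweedler, tmul_sweedler]

end HopfSweedler

/-! ### The Yetter–Drinfeld algebra `L` and exchange rules in `L ♯ H` -/

section LeftRight

variable {k H L M : Type*} [Field k] [Ring H] [HopfAlgebra k H] [Ring L] [Algebra k L]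
  [AddCommGroup M] [Module k M]

local notation "Δ" => comul (R := k)
local notation "ε" => counit (R := k)
local notation "S" => HopfAlgebra.antipode k

theorem map₂_eq_sweedler {M' N M₁ N₁ M₂ N₂ : Type*} [AddCommGroup M'] [Module k M'] [AddCommGroup N]
    [Module k N] [AddCommGroup M₁] [Module k M₁] [AddCommGroup N₁] [Module k N₁]
    [AddCommGroup M₂] [Module k M₂] [AddCommGroup N₂] [Module k N₂]
    (f : M' →ₗ[k] M₁ →ₗ[k] M₂) (g : N →ₗ[k] N₁ →ₗ[k] N₂) (t : M' ⊗[k] N) (s : M₁ ⊗[k] N₁) :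
    TensorProduct.map₂ f g t s =
      sweedler t fun m n => sweedler s fun m₁ n₁ => f m m₁ ⊗ₜ[k] g n n₁ := by
  conv_lhs => rw [← sweedler_tmul t, ← sweedler_tmul s]
  simp only [linearMap_sweedler, apply_sweedler, TensorProduct.map₂_apply_tmul,
    TensorProduct.map_tmul]
  exact sweedler_comm _ _ _

namespace LeftRightYDModuleAlgebra

variable (A : LeftRightYDModuleAlgebra k H L)

theorem sweedler_coact_coassoc (x : L) (F : L → H → H → M) (h₁ : ∀ b c, Lin k (fun a => F a b c))
    (h₂ : ∀ a c, Lin k (fun b => F a b c)) (h₃ : ∀ a b, Lin k (fun c => F a b c)) :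
    sweedler (A.coact x) (fun a h => sweedler (A.coact a) fun c d => F c d h) =
      sweedler (A.coact x) (fun a h => sweedler (Δ h) fun c d => F a c d) := by
  have expand : ∀ a b, sweedler (A.coact a) (fun c d => F c d b) =
      sweedler (TensorProduct.assoc k L H H (A.coact a ⊗ₜ[k] b)) fun a s =>
        sweedler s fun c d => F a c d := by
    intro a b
    conv_rhs => rw [← sweedler_tmul (A.coact a)]
    simp (disch := fun_prop) only [sweedler_tmul_left, linearEquiv_sweedler,
      TensorProduct.assoc_tmul, sweedler_sweedler, tmul_sweedler]
  have key := congrArg (fun t => sweedler t fun a s => sweedler s fun c d => F a c d)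
    (A.coassoc x)
  simp only [LinearMap.rTensor, LinearMap.lTensor] at key
  rw [← sweedler_tmul (A.coact x)] at key
  simpa (disch := fun_prop) only [linearMap_sweedler, linearEquiv_sweedler, TensorProduct.map_tmul,
    LinearMap.id_apply, sweedler_sweedler, tmul_sweedler, expand] using key

theorem sweedler_coact_counit (x : L) (F : L → M) (hF : Lin k F) :
    sweedler (A.coact x) (fun a h => ε h • F a) = F x := by
  have key := congrArg F (A.coact_counit x)
  rw [← sweedler_tmul (A.coact x)] at key
  simpa only [linearMap_sweedler, linearEquiv_sweedler, LinearMap.lTensor_tmul,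
    TensorProduct.rid_tmul, map_sweedler _ _ hF, hF.map_smul] using key

theorem sweedler_coact_mul (x z : L) (F : L → H → M) (h₁ : ∀ b, Lin k (fun a => F a b))
    (h₂ : ∀ a, Lin k (fun b => F a b)) :
    sweedler (A.coact (x * z)) F =
      sweedler (A.coact x) fun a h => sweedler (A.coact z) fun b g => F (a * b) (g * h) := by
  rw [A.coact_mul, map₂_eq_sweedler]
  simp (disch := fun_prop) only [sweedler_sweedler, tmul_sweedler, LinearMap.mul_apply',
    LinearMap.flip_apply]

theorem sweedler_yetterDrinfeld (h : H) (x : L) (F : L → H → M) (h₁ : ∀ b, Lin k (fun a => F a b))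
    (h₂ : ∀ a, Lin k (fun b => F a b)) :
    sweedler (Δ h) (fun a b => sweedler (A.coact x) fun c d => F (A.act a c) (b * d)) =
      sweedler (Δ h) fun a b => sweedler (A.coact (A.act b x)) fun c d => F c (d * a) := by
  have key := congrArg (fun t => sweedler t F) (A.yetterDrinfeld h x)
  have hr : ∀ a b, (LinearMap.lTensorHom L ∘ₗ (LinearMap.mul k H).flip).compl₂
      (A.coact ∘ₗ A.act.flip x) a b = sweedler (A.coact (A.act b x)) fun c d =>
        c ⊗ₜ[k] (d * a) := by
    intro a b
    simp only [LinearMap.compl₂_apply, LinearMap.comp_apply, LinearMap.flip_apply]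
    conv_lhs => rw [← sweedler_tmul (A.coact _)]
    simp [linearMap_sweedler]
  simpa (disch := fun_prop) only [map₂_eq_sweedler, lift_eq_sweedler, hr, sweedler_sweedler,
    tmul_sweedler, LinearMap.mul_apply'] using key

theorem act_mul_sweedler (h : H) (x z : L) :
    A.act h (x * z) = sweedler (Δ h) fun a b => A.act a x * A.act b z := by
  rw [A.act_mul]
  conv_lhs => rw [← sweedler_tmul (Δ h)]
  simp [linearMap_sweedler]

theorem IsBraidedCommutative.sweedler {A : LeftRightYDModuleAlgebra k H L}
    (hA : A.IsBraidedCommutative) (x z : L) :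
    sweedler (A.coact x) (fun a h => a * A.act h z) = z * x := by
  rw [← hA z x, lift_eq_sweedler]
  simp

end LeftRightYDModuleAlgebra

namespace LeftSmash

variable (A : LeftRightYDModuleAlgebra k H L)

/-- Turns calculations in `L ♯ H` into manipulations of words in `L` and `H`, subject to
`inH_mul_inL`. -/
theorem mk_eq (x : L) (h : H) : mk A.toLeftModuleAlgebra x h = inL A x * inH A h := by
  rw [inL, inH, LinearMap.flip_apply, mk_mul_mk, Bialgebra.comul_one,
    Algebra.TensorProduct.one_def]
  simp [A.one_act, mk]

theorem inL_one : inL A 1 = 1 := rfl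

theorem inH_one : inH A 1 = 1 := rfl

theorem inL_mul (x z : L) : inL A (x * z) = inL A x * inL A z := by
  simp only [inL, LinearMap.flip_apply]
  rw [mk_mul_mk, Bialgebra.comul_one, Algebra.TensorProduct.one_def]
  simp [A.one_act, mk]

theorem inH_mul_inL (h : H) (x : L) :
    inH A h * inL A x = sweedler (Δ h) fun a b => inL A (A.act a x) * inH A b := by
  simp only [← mk_eq]
  rw [inL, inH, LinearMap.flip_apply, mk_mul_mk]
  conv_lhs => rw [← sweedler_tmul (Δ h)]
  simp [linearMap_sweedler, linearEquiv_sweedler, mk]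

theorem inH_mul (h g : H) : inH A (h * g) = inH A h * inH A g := by
  simp only [inH]
  rw [mk_mul_mk]
  conv_rhs => rw [← sweedler_tmul (Δ h)]
  simp only [linearMap_sweedler, linearEquiv_sweedler, TensorProduct.map_tmul,
    LinearMap.comp_apply, LinearMap.flip_apply, A.act_one, LinearMap.mulLeft_apply,
    LinearMap.mulRight_apply, one_mul, map_smul]
  exact (sweedler_counit_left h (fun b => mk A.toLeftModuleAlgebra 1 (b * g)) (by fun_prop)).symm

theorem rho_eq (x : L) : rho A x = sweedler (A.coact x) fun a h => inL A a * inH A h := by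
  rw [rho, LinearMap.comp_apply, ← sweedler_tmul (A.coact x), linearMap_sweedler]
  simp only [sweedler_tmul, ← mk_eq]
  rfl

theorem induction_on' {p : LeftSmash A.toLeftModuleAlgebra → Prop}
    (z : LeftSmash A.toLeftModuleAlgebra) (mul : ∀ x h, p (inL A x * inH A h))
    (add : ∀ x y, p x → p y → p (x + y)) : p z := by
  refine LeftSmash.induction_on z ?_ (fun a h => ?_) add
  · simpa using mul 0 0
  · rw [mk_eq]; exact mul a h

theorem equiv_symm_mul (x : L) (h : H) : (equiv _).symm (inL A x * inH A h) = x ⊗ₜ[k] h := by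
  rw [← mk_eq]; rfl

variable {A}

/-- One has `x₀ x₁ z = x₀ (x₁ ▸ z) x₂`, and braided commutativity replaces `x₀ (x₁ ▸ z)` by `z x₀`.
-/
theorem rho_mul_inL (hA : A.IsBraidedCommutative) (x z : L) :
    rho A x * inL A z = inL A z * rho A x := by
  simp only [rho_eq, sweedler_mul, mul_sweedler, mul_assoc, inH_mul_inL]
  rw [← A.sweedler_coact_coassoc x (fun a c d => inL A a * (inL A (A.act c z) * inH A d))
    (by fun_prop) (by fun_prop) (by fun_prop)]
  simp only [← mul_assoc, ← inL_mul]
  congr! 3 with a h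
  rw [← hA.sweedler, linearMap_sweedler, sweedler_mul]

/-- Moving `ρ(z)` past `x₀ ∈ L` gives `ρ(z) x₀ x₁ = x₀ z₀ z₁ x₁`, which is the order of factors in
`coact_mul`. -/
theorem rho_mul (hA : A.IsBraidedCommutative) (x z : L) : rho A (x * z) = rho A z * rho A x := by
  conv_rhs => rw [rho_eq A x]
  simp only [mul_sweedler, ← mul_assoc, rho_mul_inL hA]
  rw [rho_eq, A.sweedler_coact_mul x z _ (by fun_prop) (by fun_prop)]
  simp only [rho_eq, mul_sweedler, sweedler_mul, inL_mul, inH_mul, mul_assoc]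

variable (A)

theorem rho_one : rho A 1 = 1 := by
  rw [rho_eq, A.coact_one, tmul_sweedler _ _ _ (by fun_prop) (by fun_prop), inL_one, inH_one,
    one_mul]

/-- The Yetter–Drinfeld condition, read in `L ♯ H` through `h x₀ x₁ = (h₁ ▸ x₀) h₂ x₁`. -/
theorem inH_mul_rho (h : H) (x : L) :
    inH A h * rho A x = sweedler (Δ h) fun a b => rho A (A.act b x) * inH A a := by
  simp only [rho_eq, mul_sweedler, sweedler_mul, mul_assoc, ← inH_mul]
  rw [← A.sweedler_yetterDrinfeld h x (fun c d => inL A c * inH A d) (by fun_prop) (by fun_prop)]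
  simp only [← mul_assoc, inH_mul_inL, sweedler_mul]
  rw [sweedler_comm]
  simp only [mul_assoc, ← inH_mul]

/-- The exchange rule gives `S(h₁) ρ(x) h₂ = ρ(S(h₁) ▸ x) S(h₂) h₃`, and the last two factors
cancel. -/
theorem rho_antipode_act (h : H) (x : L) :
    rho A (A.act (S h) x) =
      sweedler (Δ h) fun a b => inH A (S a) * rho A x * inH A b := by
  have : ∀ a, inH A (S a) * rho A x =
      sweedler (Δ a) fun c d => rho A (A.act (S c) x) * inH A (S d) := fun a => by
    rw [inH_mul_rho, sweedler_comul_antipode _ _ (by fun_prop) (by fun_prop)]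
  simp only [this, sweedler_mul]
  rw [sweedler_comul_coassoc h (fun a b c => rho A (A.act (S a) x) * inH A (S b) * inH A c)
    (by fun_prop) (by fun_prop) (by fun_prop)]
  simp only [mul_assoc, ← inH_mul]
  rw [sweedler_antipode_mul_right h (fun a b => rho A (A.act (S a) x) * inH A b)
    (by fun_prop) (by fun_prop), inH_one, mul_one]

/-- This solves `inH_mul_rho` for `ρ(x) h` without `S⁻¹`, because `h₁ ρ(S(h₂) ▸ x) = ρ(h₂ S(h₃) ▸ x)
h₁`. -/
theorem rho_mul_inH (h : H) (x : L) :
    rho A x * inH A h = sweedler (Δ h) fun a b => inH A a * rho A (A.act (S b) x) := by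
  simp only [inH_mul_rho, ← A.mul_act]
  rw [sweedler_comul_coassoc h (fun a b c => rho A (A.act (b * S c) x) * inH A a)
    (by fun_prop) (by fun_prop) (by fun_prop)]
  rw [sweedler_mul_antipode_right h (fun a b => rho A (A.act b x) * inH A a)
    (by fun_prop) (by fun_prop), A.one_act]

end LeftSmash

end LeftRight

/-! ### The Yetter–Drinfeld algebra `R` and exchange rules in `H ♯ R` -/

section RightLeft

variable {k H R M : Type*} [Field k] [Ring H] [HopfAlgebra k H] [Ring R] [Algebra k R]
  [AddCommGroup M] [Module k M]

local notation "Δ" => comul (R := k)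
local notation "ε" => counit (R := k)
local notation "S" => HopfAlgebra.antipode k

namespace RightLeftYDModuleAlgebra

variable (B : RightLeftYDModuleAlgebra k H R)

theorem sweedler_coact_coassoc (y : R) (F : H → H → R → M) (h₁ : ∀ b c, Lin k (fun a => F a b c))
    (h₂ : ∀ a c, Lin k (fun b => F a b c)) (h₃ : ∀ a b, Lin k (fun c => F a b c)) :
    sweedler (B.coact y) (fun h a => sweedler (B.coact a) fun g b => F h g b) =
      sweedler (B.coact y) (fun h a => sweedler (Δ h) fun c d => F c d a) := by
  have expand : ∀ h a, sweedler (Δ h) (fun c d => F c d a) =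
      sweedler (TensorProduct.assoc k H H R (Δ h ⊗ₜ[k] a)) fun a s =>
        sweedler s fun c d => F a c d := by
    intro h a
    conv_rhs => rw [← sweedler_tmul (Δ h)]
    simp (disch := fun_prop) only [sweedler_tmul_left, linearEquiv_sweedler,
      TensorProduct.assoc_tmul, sweedler_sweedler, tmul_sweedler]
  have key := congrArg (fun t => sweedler t fun a s => sweedler s fun c d => F a c d)
    (B.coassoc y)
  simp only [LinearMap.rTensor, LinearMap.lTensor] at key
  rw [← sweedler_tmul (B.coact y)] at key
  simpa (disch := fun_prop) only [linearMap_sweedler, linearEquiv_sweedler, TensorProduct.map_tmul,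
    LinearMap.id_apply, sweedler_sweedler, tmul_sweedler, expand] using key.symm

theorem sweedler_coact_counit (y : R) (F : R → M) (hF : Lin k F) :
    sweedler (B.coact y) (fun h a => ε h • F a) = F y := by
  have key := congrArg F (B.coact_counit y)
  rw [← sweedler_tmul (B.coact y)] at key
  simpa only [linearMap_sweedler, linearEquiv_sweedler, LinearMap.rTensor_tmul,
    TensorProduct.lid_tmul, map_sweedler _ _ hF, hF.map_smul] using key

theorem sweedler_coact_mul (y w : R) (F : H → R → M) (h₁ : ∀ b, Lin k (fun a => F a b))
    (h₂ : ∀ a, Lin k (fun b => F a b)) :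
    sweedler (B.coact (y * w)) F =
      sweedler (B.coact y) fun h a => sweedler (B.coact w) fun g b => F (g * h) (a * b) := by
  rw [B.coact_mul, map₂_eq_sweedler]
  simp (disch := fun_prop) only [sweedler_sweedler, tmul_sweedler, LinearMap.mul_apply',
    LinearMap.flip_apply]

theorem sweedler_yetterDrinfeld (h : H) (y : R) (F : H → R → M) (h₁ : ∀ b, Lin k (fun a => F a b))
    (h₂ : ∀ a, Lin k (fun b => F a b)) :
    sweedler (B.coact y) (fun g b => sweedler (Δ h) fun c d => F (g * c) (B.act b d)) =
      sweedler (Δ h) fun c d => sweedler (B.coact (B.act y c)) fun g b => F (d * g) b := by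
  have key := congrArg (fun t => sweedler t F) (B.yetterDrinfeld h y)
  have hr : ∀ c d, ((LinearMap.rTensorHom R ∘ₗ LinearMap.mul k H).compl₂
      (B.coact ∘ₗ B.act y)).flip c d = sweedler (B.coact (B.act y c)) fun g b =>
        (d * g) ⊗ₜ[k] b := by
    intro c d
    simp only [LinearMap.compl₂_apply, LinearMap.comp_apply, LinearMap.flip_apply]
    conv_lhs => rw [← sweedler_tmul (B.coact _)]
    simp [linearMap_sweedler]
  simpa (disch := fun_prop) only [map₂_eq_sweedler, lift_eq_sweedler, hr, sweedler_sweedler,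
    tmul_sweedler, LinearMap.mul_apply'] using key

theorem mul_act_sweedler (h : H) (y w : R) :
    B.act (y * w) h = sweedler (Δ h) fun a b => B.act y a * B.act w b := by
  rw [B.mul_act]
  conv_lhs => rw [← sweedler_tmul (Δ h)]
  simp [linearMap_sweedler]

theorem IsBraidedCommutative.sweedler {B : RightLeftYDModuleAlgebra k H R}
    (hB : B.IsBraidedCommutative) (y w : R) :
    sweedler (B.coact y) (fun h b => B.act w h * b) = y * w := by
  rw [← hB w y, lift_eq_sweedler]
  simp

end RightLeftYDModuleAlgebra

namespace RightSmash

variable (B : RightLeftYDModuleAlgebra k H R)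

theorem mk_eq (h : H) (y : R) : mk B.toRightModuleAlgebra h y = inH B h * inR B y := by
  rw [inR, inH, LinearMap.flip_apply, mk_mul_mk, Bialgebra.comul_one,
    Algebra.TensorProduct.one_def]
  simp [B.act_one, mk]

theorem inR_one : inR B 1 = 1 := rfl

theorem inH_one : inH B 1 = 1 := rfl

theorem inR_mul (y w : R) : inR B (y * w) = inR B y * inR B w := by
  simp only [inR]
  rw [mk_mul_mk, Bialgebra.comul_one, Algebra.TensorProduct.one_def]
  simp [B.act_one, mk]

theorem inR_mul_inH (h : H) (y : R) :
    inR B y * inH B h = sweedler (Δ h) fun a b => inH B a * inR B (B.act y b) := by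
  simp only [← mk_eq]
  rw [inR, inH, LinearMap.flip_apply, mk_mul_mk]
  conv_lhs => rw [← sweedler_tmul (Δ h)]
  simp [linearMap_sweedler, linearEquiv_sweedler, mk]

theorem inH_mul (h g : H) : inH B (h * g) = inH B h * inH B g := by
  simp only [inH, LinearMap.flip_apply]
  rw [mk_mul_mk]
  conv_rhs => rw [← sweedler_tmul (Δ g)]
  simp only [linearMap_sweedler, linearEquiv_sweedler, TensorProduct.map_tmul,
    LinearMap.comp_apply, B.one_act, LinearMap.mulLeft_apply,
    LinearMap.mulRight_apply, mul_one, tmul_smul, map_smul]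
  exact (sweedler_counit_right g (fun b => mk B.toRightModuleAlgebra (h * b) 1)
    (by fun_prop)).symm

theorem lam_eq (y : R) : lam B y = sweedler (B.coact y) fun h a => inH B h * inR B a := by
  rw [lam, LinearMap.comp_apply, ← sweedler_tmul (B.coact y), linearMap_sweedler]
  simp only [sweedler_tmul, ← mk_eq]
  rfl

theorem induction_on' {p : RightSmash B.toRightModuleAlgebra → Prop}
    (z : RightSmash B.toRightModuleAlgebra) (mul : ∀ h y, p (inH B h * inR B y))
    (add : ∀ x y, p x → p y → p (x + y)) : p z := by
  refine RightSmash.induction_on z ?_ (fun a h => ?_) add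
  · simpa using mul 0 0
  · rw [mk_eq]; exact mul a h

theorem equiv_symm_mul (h : H) (y : R) : (equiv _).symm (inH B h * inR B y) = h ⊗ₜ[k] y := by
  rw [← mk_eq]; rfl

variable {B}

/-- One has `w y₋₁ y₀ = y₋₂ (w ◂ y₋₁) y₀`, and braided commutativity replaces `(w ◂ y₋₁) y₀` by `y₀
w`. -/
theorem inR_mul_lam (hB : B.IsBraidedCommutative) (y w : R) :
    inR B w * lam B y = lam B y * inR B w := by
  simp only [lam_eq, sweedler_mul, mul_sweedler, ← mul_assoc, inR_mul_inH]
  rw [← B.sweedler_coact_coassoc y (fun c d a => inH B c * inR B (B.act w d) * inR B a)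
    (by fun_prop) (by fun_prop) (by fun_prop)]
  simp only [mul_assoc, ← inR_mul]
  congr! 3 with h a
  rw [← hB.sweedler, linearMap_sweedler, mul_sweedler]

theorem lam_mul (hB : B.IsBraidedCommutative) (y w : R) : lam B (y * w) = lam B w * lam B y := by
  conv_rhs => rw [lam_eq B w]
  simp only [sweedler_mul, mul_assoc, inR_mul_lam hB]
  rw [lam_eq, B.sweedler_coact_mul y w _ (by fun_prop) (by fun_prop), sweedler_comm]
  simp only [lam_eq, mul_sweedler, sweedler_mul, inR_mul, inH_mul, mul_assoc]

variable (B)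

theorem lam_one : lam B 1 = 1 := by
  rw [lam_eq, B.coact_one, tmul_sweedler _ _ _ (by fun_prop) (by fun_prop), inR_one, inH_one,
    one_mul]

theorem lam_mul_inH (h : H) (y : R) :
    lam B y * inH B h = sweedler (Δ h) fun a b => inH B b * lam B (B.act y a) := by
  simp only [lam_eq, mul_sweedler, sweedler_mul, ← mul_assoc, ← inH_mul]
  rw [← B.sweedler_yetterDrinfeld h y (fun c d => inH B c * inR B d) (by fun_prop) (by fun_prop)]
  simp only [mul_assoc, inR_mul_inH, mul_sweedler]
  simp only [← mul_assoc, ← inH_mul]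

/-- The exchange rule gives `h₁ lam(y) S(h₂) = h₁ S(h₂) lam(y ◂ S(h₃))`, and the first two factors
cancel. -/
theorem lam_act_antipode (h : H) (y : R) :
    lam B (B.act y (S h)) =
      sweedler (Δ h) fun a b => inH B a * lam B y * inH B (S b) := by
  have : ∀ a, lam B y * inH B (S a) =
      sweedler (Δ a) fun c d => inH B (S c) * lam B (B.act y (S d)) := fun a => by
    rw [lam_mul_inH, sweedler_comul_antipode _ _ (by fun_prop) (by fun_prop)]
  simp only [mul_assoc, this, mul_sweedler]
  simp only [← mul_assoc, ← inH_mul]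
  rw [sweedler_mul_antipode_left h (fun a b => inH B a * lam B (B.act y (S b)))
    (by fun_prop) (by fun_prop), inH_one, one_mul]

/-- The right-hand side is `h₃ lam(y ◂ S(h₁) h₂)`. In this form the rule mirrors the product of `L ♯
H`, which makes `Ψ` multiplicative. -/
theorem inH_mul_lam (h : H) (y : R) :
    inH B h * lam B y = sweedler (Δ h) fun a b => lam B (B.act y (S a)) * inH B b := by
  simp only [lam_mul_inH, ← B.act_mul]
  rw [sweedler_antipode_mul_left h (fun a b => inH B b * lam B (B.act y a))
    (by fun_prop) (by fun_prop), B.act_one]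

end RightSmash

end RightLeft

/-! ### Antiisomorphisms as linear maps -/

namespace AntiIso

variable {k L R : Type*} [Field k] [Ring L] [Algebra k L] [Ring R] [Algebra k R]

@[simp]
theorem invMap_map (φ : AntiIso k L R) (x : L) : φ.invMap (φ.map x) = x := by
  simp [map, invMap]

@[simp]
theorem map_invMap (φ : AntiIso k L R) (y : R) : φ.map (φ.invMap y) = y := by
  simp [map, invMap]

theorem map_mul (φ : AntiIso k L R) (x z : L) : φ.map (x * z) = φ.map z * φ.map x := by
  simp [map]

theorem map_one (φ : AntiIso k L R) : φ.map 1 = 1 := by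
  simp [map]

theorem invMap_mul (φ : AntiIso k L R) (y w : R) :
    φ.invMap (y * w) = φ.invMap w * φ.invMap y := by
  simp [invMap]

theorem invMap_one (φ : AntiIso k L R) : φ.invMap 1 = 1 := by
  simp [invMap]

theorem map_injective : Function.Injective (map : AntiIso k L R → L →ₗ[k] R) := by
  intro φ ψ h
  refine AlgEquiv.ext fun x => MulOpposite.unop_injective ?_
  exact LinearMap.congr_fun h x

/-- An antiisomorphism from mutually inverse linear maps. -/
def ofLinearMaps (f : L →ₗ[k] R) (g : R →ₗ[k] L) (hfg : ∀ y, f (g y) = y) (hgf : ∀ x, g (f x) = x)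
    (h1 : f 1 = 1) (hmul : ∀ x z, f (x * z) = f z * f x) : AntiIso k L R :=
  AlgEquiv.ofLinearEquiv
    ((LinearEquiv.ofLinearMap f g (LinearMap.ext hfg) (LinearMap.ext hgf) : L ≃ₗ[k] R).trans
      (MulOpposite.opLinearEquiv k : R ≃ₗ[k] Rᵐᵒᵖ))
    (congrArg MulOpposite.op h1) fun x z => congrArg MulOpposite.op (hmul x z)

end AntiIso

/-! ### Compatible `L` and `R`: tools for comparing `φ` and `θ` -/

section Compatible

variable {k H L R M : Type*} [Field k] [Ring H] [HopfAlgebra k H] [Ring L] [Algebra k L]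
  [Ring R] [Algebra k R] [AddCommGroup M] [Module k M]

local notation "Δ" => comul (R := k)
local notation "ε" => counit (R := k)
local notation "S" => HopfAlgebra.antipode k

namespace LeftSmash

variable (A : LeftRightYDModuleAlgebra k H L)

theorem counit_inL_mul_inH (x : L) (h : H) :
    LeftSmash.counit A (inL A x * inH A h) = ε h • x := by
  simp [LeftSmash.counit, equiv_symm_mul]

theorem counit_rho (x : L) : LeftSmash.counit A (rho A x) = x := by
  simp only [rho_eq, linearMap_sweedler, counit_inL_mul_inH]
  exact A.sweedler_coact_counit x (fun z => z) (by fun_prop)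

/-- The counit is a left inverse of `ρ`. Antimultiplicativity of `θ` is checked in `L ♯ H` by means
of this. -/
theorem rho_injective : Function.Injective (rho A) :=
  Function.LeftInverse.injective (counit_rho A)

end LeftSmash

namespace RightSmash

variable (B : RightLeftYDModuleAlgebra k H R)

theorem counit_inH_mul_inR (h : H) (y : R) :
    RightSmash.counit B (inH B h * inR B y) = ε h • y := by
  simp [RightSmash.counit, equiv_symm_mul]

theorem counit_lam (y : R) : RightSmash.counit B (lam B y) = y := by
  simp only [lam_eq, linearMap_sweedler, counit_inH_mul_inR]
  exact B.sweedler_coact_counit y (fun z => z) (by fun_prop)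

theorem lam_injective : Function.Injective (lam B) :=
  Function.LeftInverse.injective (counit_lam B)

end RightSmash

variable {A : LeftRightYDModuleAlgebra k H L} {B : RightLeftYDModuleAlgebra k H R}

variable (A B) in
theorem thetaOfPhi_apply (φ : AntiIso k L R) (y : R) : thetaOfPhi A B φ y =
    sweedler (B.coact y) fun h a => A.act (S h) (φ.invMap a) := by
  rw [thetaOfPhi, LinearMap.comp_apply, lift_eq_sweedler]
  rfl

variable (A B) in
theorem phiOfTheta_apply (θ : AntiIso k R L) (x : L) : phiOfTheta A B θ x =
    sweedler (A.coact x) fun a h => B.act (θ.invMap a) (S h) := by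
  rw [phiOfTheta, LinearMap.comp_apply, lift_eq_sweedler]
  rfl

theorem antipode_mul_eq (f g : H) : S (f * g) = S g * S f :=
  HopfAlgebra.antipode_mul_antidistrib f g

-- Commuting past `z ∈ L` gives `S(h) z = (S(h₂) ▸ z) S(h₁)`, and coassociativity collects the terms
-- `S(h₂) ▸ φ⁻¹(a)` into `thetaOfPhi`. The outcome has `L` to the left of `H`, so it can be read as
-- an element of `L ⊗ H`.
variable (A B) in
open LeftSmash in
theorem sweedler_antipode_inL (φ : AntiIso k L R) (y : R) :
    sweedler (B.coact y) (fun h a => inH A (S h) * inL A (φ.invMap a)) =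
      sweedler (B.coact y) fun h a => inL A (thetaOfPhi A B φ a) * inH A (S h) := by
  have : ∀ h a, inH A (S h) * inL A (φ.invMap a) = sweedler (Δ h) fun c d =>
      inL A (A.act (S d) (φ.invMap a)) * inH A (S c) := fun h a => by
    rw [inH_mul_inL, sweedler_comul_antipode _ _ (by fun_prop) (by fun_prop)]
  simp only [this, thetaOfPhi_apply, linearMap_sweedler, sweedler_mul]
  rw [B.sweedler_coact_coassoc y
    (fun c d a => inL A (A.act (S d) (φ.invMap a)) * inH A (S c))
    (by fun_prop) (by fun_prop) (by fun_prop)]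

variable (A B) in
open RightSmash in
theorem sweedler_inR_antipode (θ : AntiIso k R L) (x : L) :
    sweedler (A.coact x) (fun a h => inR B (θ.invMap a) * inH B (S h)) =
      sweedler (A.coact x) fun a h => inH B (S h) * inR B (phiOfTheta A B θ a) := by
  have : ∀ h a, inR B (θ.invMap a) * inH B (S h) = sweedler (Δ h) fun c d =>
      inH B (S d) * inR B (B.act (θ.invMap a) (S c)) := fun h a => by
    rw [inR_mul_inH, sweedler_comul_antipode _ _ (by fun_prop) (by fun_prop)]
  simp only [this, phiOfTheta_apply, linearMap_sweedler, mul_sweedler]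
  rw [A.sweedler_coact_coassoc x
    (fun a c d => inH B (S d) * inR B (B.act (θ.invMap a) (S c)))
    (by fun_prop) (by fun_prop) (by fun_prop)]

/-! ### From `φ` to `θ` -/

namespace CompatiblePhi

set_option linter.unusedSectionVars false

variable {φ : AntiIso k L R} (hφ : CompatiblePhi A B φ)
include hφ

theorem sweedler_coact (x : L) (F : H → R → M) (h₁ : ∀ b, Lin k (fun a => F a b))
    (h₂ : ∀ a, Lin k (fun b => F a b)) :
    sweedler (B.coact (φ.map x)) F = sweedler (A.coact x) fun a h => F (S h) (φ.map a) := by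
  rw [hφ.coact x]
  conv_lhs => rw [← sweedler_tmul (A.coact x)]
  simp (disch := fun_prop) only [linearMap_sweedler, linearEquiv_sweedler, TensorProduct.comm_tmul,
    TensorProduct.map_tmul, sweedler_sweedler, tmul_sweedler]

theorem invMap_act (y : R) (f : H) :
    φ.invMap (B.act y (S f)) = A.act f (φ.invMap y) := by
  conv_lhs => rw [← φ.map_invMap y, ← hφ.act, φ.invMap_map]

-- The identity on which the theorem turns. For `y = φ(x)` the left side is `ρ(S²(x₁) ▸ x₀)`, which
-- by `rho_antipode_act` equals `S²(x₃) x₀ x₁ S(x₂)`. The pair `x₁ S(x₂)` cancels and leaves `S²(x₁)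
-- x₀`, which is the right side.
open LeftSmash in
theorem rho_thetaOfPhi (y : R) : rho A (thetaOfPhi A B φ y) =
    sweedler (B.coact y) fun h a => inH A (S h) * inL A (φ.invMap a) := by
  rw [thetaOfPhi_apply, linearMap_sweedler]
  -- Compatibility describes the coaction of `R` on values of `φ`, so `y` is written as one.
  obtain ⟨x, rfl⟩ : ∃ x, y = φ.map x := ⟨φ.invMap y, (φ.map_invMap y).symm⟩
  rw [hφ.sweedler_coact x _ (by fun_prop) (by fun_prop),
    hφ.sweedler_coact x _ (by fun_prop) (by fun_prop)]
  simp only [φ.invMap_map, rho_antipode_act]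
  have e1 : ∀ a h, sweedler (Δ (S h)) (fun c d => inH A (S c) * rho A a * inH A d) =
      sweedler (A.coact a) fun e f => sweedler (Δ h) fun c d =>
        inH A (S (S d)) * inL A e * inH A (f * S c) := fun a h => by
    rw [sweedler_comul_antipode _ _ (by fun_prop) (by fun_prop), sweedler_comm]
    simp only [rho_eq, mul_sweedler, sweedler_mul, inH_mul, mul_assoc]
  simp only [e1]
  rw [A.sweedler_coact_coassoc x (fun e f h => sweedler (Δ h) fun c d =>
        inH A (S (S d)) * inL A e * inH A (f * S c))
    (by fun_prop) (by fun_prop) (by fun_prop)]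
  congr! 3 with a h
  rw [sweedler_mul_antipode_left h (fun u d => inH A (S (S d)) * inL A a * inH A u)
    (by fun_prop) (by fun_prop), inH_one, mul_one]

-- Under the identification of `L ♯ H` with `L ⊗ H`, `ρ` is the coaction itself; so this is the
-- preceding identity with `L` moved to the left of `H`.
open LeftSmash in
theorem coact_thetaOfPhi (y : R) : A.coact (thetaOfPhi A B φ y) =
    sweedler (B.coact y) fun h a => thetaOfPhi A B φ a ⊗ₜ[k] S h := by
  have := congrArg (equiv A.toLeftModuleAlgebra).symm (hφ.rho_thetaOfPhi y)
  rw [sweedler_antipode_inL, linearEquiv_sweedler] at this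
  simp only [equiv_symm_mul] at this
  exact this

-- After applying `ρ`, the left side is `S(y₋₁) S(w₋₁) φ⁻¹(w₀) φ⁻¹(y₀)`. Its middle is `ρ(θ(w))`,
-- which commutes with `φ⁻¹(y₀) ∈ L`.
open LeftSmash in
theorem thetaOfPhi_mul (hA : A.IsBraidedCommutative) (y w : R) :
    thetaOfPhi A B φ (y * w) = thetaOfPhi A B φ w * thetaOfPhi A B φ y := by
  apply rho_injective A
  rw [rho_mul hA, hφ.rho_thetaOfPhi, hφ.rho_thetaOfPhi y,
    B.sweedler_coact_mul y w _ (by fun_prop) (by fun_prop), sweedler_mul]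
  congr! 3 with h a
  rw [mul_assoc, ← rho_mul_inL hA, hφ.rho_thetaOfPhi w, sweedler_mul, mul_sweedler]
  simp only [antipode_mul_eq, inH_mul, φ.invMap_mul, inL_mul, mul_assoc]

theorem thetaOfPhi_one : thetaOfPhi A B φ 1 = 1 := by
  rw [thetaOfPhi_apply, B.coact_one, tmul_sweedler _ _ _ (by fun_prop) (by fun_prop),
    φ.invMap_one, HopfAlgebra.antipode_one, A.one_act]

/-- Inserting `f₂ S(f₃)` creates `y₋₁ f₁ ⊗ (y₀ ◂ f₂)`, to which the Yetter–Drinfeld condition of `R`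
applies. The compatibility of `φ` turns `◂ S(f₃)` into `f₃ ▸` outside `φ⁻¹`, and this factor cancels
against the `S(f₂)` that the Yetter–Drinfeld condition produces. -/
theorem thetaOfPhi_act (y : R) (f : H) :
    thetaOfPhi A B φ (B.act y f) = A.act (S f) (thetaOfPhi A B φ y) := by
  simp only [thetaOfPhi_apply, linearMap_sweedler]
  symm
  calc sweedler (B.coact y) (fun h a => A.act (S f) (A.act (S h) (φ.invMap a)))
      = sweedler (B.coact y) fun h a => sweedler (Δ f) fun b c => sweedler (Δ c) fun d e =>
          A.act (S (h * b)) (φ.invMap (B.act a (d * S e))) := by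
        congr! 3 with h a
        rw [sweedler_mul_antipode_right f (fun u v => A.act (S (h * u)) (φ.invMap (B.act a v)))
          (by fun_prop) (by fun_prop), B.act_one, antipode_mul_eq, A.mul_act]
    _ = sweedler (Δ f) fun b e => sweedler (B.coact y) fun h a => sweedler (Δ b) fun c d =>
          A.act (S (h * c)) (A.act e (φ.invMap (B.act a d))) := by
        rw [sweedler_comm (Δ f)]
        congr! 3 with h a
        simp only [B.act_mul, hφ.invMap_act]
        rw [sweedler_comul_coassoc f (fun c d e =>
          A.act (S (h * c)) (A.act e (φ.invMap (B.act a d))))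
          (by fun_prop) (by fun_prop) (by fun_prop)]
    _ = sweedler (Δ f) fun b e => sweedler (Δ b) fun c d => sweedler (B.coact (B.act y c))
          fun g a => A.act (S (d * g)) (A.act e (φ.invMap a)) := by
        congr! 3 with b e
        rw [B.sweedler_yetterDrinfeld b y (fun u v => A.act (S u) (A.act e (φ.invMap v)))
          (by fun_prop) (by fun_prop)]
    _ = sweedler (Δ f) fun b c => sweedler (Δ c) fun d e => sweedler (B.coact (B.act y b))
          fun g a => A.act (S g) (A.act (S d * e) (φ.invMap a)) := by
        rw [sweedler_comul_coassoc f (fun c d e => sweedler (B.coact (B.act y c))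
          fun g a => A.act (S (d * g)) (A.act e (φ.invMap a)))
          (by fun_prop) (by fun_prop) (by fun_prop)]
        simp only [antipode_mul_eq, A.mul_act]
    _ = _ := by
        rw [sweedler_antipode_mul_right f (fun b u => sweedler (B.coact (B.act y b))
          fun g a => A.act (S g) (A.act u (φ.invMap a))) (by fun_prop) (by fun_prop)]
        simp only [A.one_act]

theorem thetaOfPhi_map (x : L) :
    thetaOfPhi A B φ (φ.map x) = sweedler (A.coact x) fun a h => A.act (S (S h)) a := by
  rw [thetaOfPhi_apply, hφ.sweedler_coact x _ (by fun_prop) (by fun_prop)]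
  simp only [φ.invMap_map]

/-- One has `θ(φ(x₀) ◂ x₁) = S(x₂) S²(x₁) ▸ x₀ = S(S(x₁) x₂) ▸ x₀`: the cancellation happens under
an outer `S`, so `S` need not be invertible. -/
theorem thetaOfPhi_sweedler (x : L) :
    thetaOfPhi A B φ (sweedler (A.coact x) fun a h => B.act (φ.map a) h) = x := by
  simp only [linearMap_sweedler, hφ.thetaOfPhi_act, hφ.thetaOfPhi_map]
  rw [A.sweedler_coact_coassoc x (fun b g h => A.act (S h) (A.act (S (S g)) b))
    (by fun_prop) (by fun_prop) (by fun_prop)]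
  simp only [← A.mul_act, ← antipode_mul_eq]
  have cancel : ∀ h a, sweedler (Δ h) (fun c d => A.act (S (S c * d)) a) =
      ε h • A.act (S 1) a := fun h a =>
    sweedler_antipode_mul h (fun u => A.act (S u) a) (by fun_prop)
  simp only [cancel, HopfAlgebra.antipode_one, A.one_act]
  exact A.sweedler_coact_counit x (fun z => z) (by fun_prop)

/-- By the coaction formula the sum is `y₀ ◂ S²(y₋₁) S(y₋₂) = y₀ ◂ S(y₋₂ S(y₋₁))`, which collapses
to `y`. -/
theorem sweedler_thetaOfPhi (y : R) :
    sweedler (A.coact (thetaOfPhi A B φ y)) (fun a h => B.act (φ.map a) h) = y := by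
  rw [hφ.coact_thetaOfPhi]
  simp (disch := fun_prop) only [sweedler_sweedler, tmul_sweedler]
  simp only [thetaOfPhi_apply, linearMap_sweedler, apply_sweedler, hφ.act, φ.map_invMap,
    ← B.act_mul, ← antipode_mul_eq]
  rw [B.sweedler_coact_coassoc y (fun g h b => B.act b (S (g * S h)))
    (by fun_prop) (by fun_prop) (by fun_prop)]
  have cancel : ∀ h b, sweedler (Δ h) (fun c d => B.act b (S (c * S d))) =
      ε h • B.act b (S 1) := fun h b =>
    sweedler_mul_antipode h (fun u => B.act b (S u)) (by fun_prop)
  simp only [cancel, HopfAlgebra.antipode_one, B.act_one]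
  exact B.sweedler_coact_counit y (fun z => z) (by fun_prop)

theorem exists_theta (hA : A.IsBraidedCommutative) :
    ∃ θ : AntiIso k R L, θ.map = thetaOfPhi A B φ ∧ CompatibleTheta A B θ := by
  -- The two-sided inverse of `thetaOfPhi`, by `thetaOfPhi_sweedler` and `sweedler_thetaOfPhi`.
  let η : L →ₗ[k] R := Lin.toLinearMap
    (f := fun x => sweedler (A.coact x) fun a h => B.act (φ.map a) h) (by fun_prop)
  obtain ⟨θ, hθ⟩ : ∃ θ : AntiIso k R L, θ.map = thetaOfPhi A B φ :=
    ⟨AntiIso.ofLinearMaps (thetaOfPhi A B φ) η hφ.thetaOfPhi_sweedler hφ.sweedler_thetaOfPhi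
      hφ.thetaOfPhi_one (hφ.thetaOfPhi_mul hA), rfl⟩
  refine ⟨θ, hθ, ⟨fun y f => ?_, fun y => ?_⟩⟩
  · rw [hθ, hφ.thetaOfPhi_act y f]
  · rw [hθ, hφ.coact_thetaOfPhi]
    conv_rhs => rw [← sweedler_tmul (B.coact y)]
    simp only [linearMap_sweedler, linearEquiv_sweedler, TensorProduct.comm_tmul,
      TensorProduct.map_tmul]

end CompatiblePhi

/-! ### From `θ` to `φ`, by the mirror-image argument in `H ♯ R` -/

namespace CompatibleTheta

set_option linter.unusedSectionVars false

variable {θ : AntiIso k R L} (hθ : CompatibleTheta A B θ)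
include hθ

theorem sweedler_coact (y : R) (F : L → H → M) (h₁ : ∀ b, Lin k (fun a => F a b))
    (h₂ : ∀ a, Lin k (fun b => F a b)) :
    sweedler (A.coact (θ.map y)) F = sweedler (B.coact y) fun h a => F (θ.map a) (S h) := by
  rw [hθ.coact y]
  conv_lhs => rw [← sweedler_tmul (B.coact y)]
  simp (disch := fun_prop) only [linearMap_sweedler, linearEquiv_sweedler, TensorProduct.comm_tmul,
    TensorProduct.map_tmul, sweedler_sweedler, tmul_sweedler]

theorem invMap_act (x : L) (f : H) :
    θ.invMap (A.act (S f) x) = B.act (θ.invMap x) f := by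
  conv_lhs => rw [← θ.map_invMap x, ← hθ.act, θ.invMap_map]

-- The counterpart of `rho_thetaOfPhi`. For `x = θ(y)` the left side is `S(y₋₂) y₋₁ y₀ S²(y₋₃)`, and
-- the first two factors cancel.
open RightSmash in
theorem lam_phiOfTheta (x : L) : lam B (phiOfTheta A B θ x) =
    sweedler (A.coact x) fun a h => inR B (θ.invMap a) * inH B (S h) := by
  rw [phiOfTheta_apply, linearMap_sweedler]
  obtain ⟨y, rfl⟩ : ∃ y, x = θ.map y := ⟨θ.invMap x, (θ.map_invMap x).symm⟩
  rw [hθ.sweedler_coact y _ (by fun_prop) (by fun_prop),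
    hθ.sweedler_coact y _ (by fun_prop) (by fun_prop)]
  simp only [θ.invMap_map, lam_act_antipode]
  have e1 : ∀ h a, sweedler (Δ (S h)) (fun c d => inH B c * lam B a * inH B (S d)) =
      sweedler (B.coact a) fun e f => sweedler (Δ h) fun c d =>
        inH B (S d * e) * inR B f * inH B (S (S c)) := fun h a => by
    rw [sweedler_comul_antipode _ _ (by fun_prop) (by fun_prop), sweedler_comm]
    simp only [lam_eq, mul_sweedler, sweedler_mul, inH_mul, mul_assoc]
  simp only [e1]
  rw [B.sweedler_coact_coassoc y (fun u e f => sweedler (Δ u) fun c d =>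
        inH B (S d * e) * inR B f * inH B (S (S c)))
    (by fun_prop) (by fun_prop) (by fun_prop)]
  congr! 3 with h a
  rw [sweedler_comul_coassoc h (fun c d e => inH B (S d * e) * inR B a * inH B (S (S c)))
    (by fun_prop) (by fun_prop) (by fun_prop),
    sweedler_antipode_mul_right h (fun c u => inH B u * inR B a * inH B (S (S c)))
    (by fun_prop) (by fun_prop), inH_one, one_mul]

open RightSmash in
theorem coact_phiOfTheta (x : L) : B.coact (phiOfTheta A B θ x) =
    sweedler (A.coact x) fun a h => S h ⊗ₜ[k] phiOfTheta A B θ a := by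
  have := congrArg (equiv B.toRightModuleAlgebra).symm (hθ.lam_phiOfTheta x)
  rw [sweedler_inR_antipode, linearEquiv_sweedler] at this
  simp only [equiv_symm_mul] at this
  exact this

open RightSmash in
theorem phiOfTheta_mul (hB : B.IsBraidedCommutative) (x z : L) :
    phiOfTheta A B θ (x * z) = phiOfTheta A B θ z * phiOfTheta A B θ x := by
  apply lam_injective B
  rw [lam_mul hB, hθ.lam_phiOfTheta, hθ.lam_phiOfTheta z,
    A.sweedler_coact_mul x z _ (by fun_prop) (by fun_prop), sweedler_comm, mul_sweedler]
  congr! 3 with a h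
  rw [← mul_assoc, ← inR_mul_lam hB, hθ.lam_phiOfTheta x, mul_sweedler, sweedler_mul]
  simp only [antipode_mul_eq, inH_mul, θ.invMap_mul, inR_mul, mul_assoc]

theorem phiOfTheta_one : phiOfTheta A B θ 1 = 1 := by
  rw [phiOfTheta_apply, A.coact_one, tmul_sweedler _ _ _ (by fun_prop) (by fun_prop),
    θ.invMap_one, HopfAlgebra.antipode_one, B.act_one]

/-- Here `S(f₁) f₂` is inserted. The factor `S(f₁) ▸` leaves `θ⁻¹` as `◂ f₁`, the Yetter–Drinfeld
condition of `L` is applied to `f₂` and `f₃`, and the pair `f₁ S(f₂)` that results cancels. -/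
theorem phiOfTheta_act (x : L) (f : H) :
    phiOfTheta A B θ (A.act f x) = B.act (phiOfTheta A B θ x) (S f) := by
  simp only [phiOfTheta_apply, linearMap_sweedler, apply_sweedler]
  symm
  calc sweedler (A.coact x) (fun a h => B.act (B.act (θ.invMap a) (S h)) (S f))
      = sweedler (A.coact x) fun a h => sweedler (Δ f) fun b c => sweedler (Δ c) fun d e =>
          B.act (θ.invMap (A.act (S b * d) a)) (S (e * h)) := by
        congr! 3 with a h
        rw [sweedler_antipode_mul_left f (fun u e => B.act (θ.invMap (A.act u a)) (S (e * h)))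
          (by fun_prop) (by fun_prop), A.one_act, antipode_mul_eq, B.act_mul]
    _ = sweedler (Δ f) fun b c => sweedler (Δ c) fun d e => sweedler (A.coact x) fun a h =>
          B.act (B.act (θ.invMap (A.act d a)) b) (S (e * h)) := by
        rw [sweedler_comm]
        congr! 3 with b c
        rw [sweedler_comm]
        simp only [A.mul_act, hθ.invMap_act]
    _ = sweedler (Δ f) fun b c => sweedler (Δ c) fun d e => sweedler (A.coact (A.act e x))
          fun a h => B.act (B.act (θ.invMap a) (b * S d)) (S h) := by
        congr! 3 with b c
        rw [A.sweedler_yetterDrinfeld c x (fun u v => B.act (B.act (θ.invMap u) b) (S v))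
          (by fun_prop) (by fun_prop)]
        simp only [antipode_mul_eq, B.act_mul]
    _ = _ := by
        rw [sweedler_mul_antipode_left f (fun u e => sweedler (A.coact (A.act e x))
          fun a h => B.act (B.act (θ.invMap a) u) (S h)) (by fun_prop) (by fun_prop)]
        simp only [B.act_one]

theorem phiOfTheta_map (y : R) :
    phiOfTheta A B θ (θ.map y) = sweedler (B.coact y) fun h a => B.act a (S (S h)) := by
  rw [phiOfTheta_apply, hθ.sweedler_coact y _ (by fun_prop) (by fun_prop)]
  simp only [θ.invMap_map]

theorem phiOfTheta_sweedler (y : R) :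
    phiOfTheta A B θ (sweedler (B.coact y) fun h a => A.act h (θ.map a)) = y := by
  simp only [linearMap_sweedler, hθ.phiOfTheta_act, hθ.phiOfTheta_map, apply_sweedler]
  rw [B.sweedler_coact_coassoc y (fun h g b => B.act (B.act b (S (S g))) (S h))
    (by fun_prop) (by fun_prop) (by fun_prop)]
  simp only [← B.act_mul, ← antipode_mul_eq]
  have cancel : ∀ h a, sweedler (Δ h) (fun c d => B.act a (S (c * S d))) =
      ε h • B.act a (S 1) := fun h a =>
    sweedler_mul_antipode h (fun u => B.act a (S u)) (by fun_prop)
  simp only [cancel, HopfAlgebra.antipode_one, B.act_one]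
  exact B.sweedler_coact_counit y (fun z => z) (by fun_prop)

theorem sweedler_phiOfTheta (x : L) :
    sweedler (B.coact (phiOfTheta A B θ x)) (fun h a => A.act h (θ.map a)) = x := by
  rw [hθ.coact_phiOfTheta]
  simp (disch := fun_prop) only [sweedler_sweedler, tmul_sweedler]
  simp only [phiOfTheta_apply, linearMap_sweedler, hθ.act, θ.map_invMap,
    ← A.mul_act, ← antipode_mul_eq]
  rw [A.sweedler_coact_coassoc x (fun b g h => A.act (S (S g * h)) b)
    (by fun_prop) (by fun_prop) (by fun_prop)]
  have cancel : ∀ h b, sweedler (Δ h) (fun c d => A.act (S (S c * d)) b) =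
      ε h • A.act (S 1) b := fun h b =>
    sweedler_antipode_mul h (fun u => A.act (S u) b) (by fun_prop)
  simp only [cancel, HopfAlgebra.antipode_one, A.one_act]
  exact A.sweedler_coact_counit x (fun z => z) (by fun_prop)

theorem exists_phi (hB : B.IsBraidedCommutative) :
    ∃ φ : AntiIso k L R, φ.map = phiOfTheta A B θ ∧ CompatiblePhi A B φ := by
  let η : R →ₗ[k] L := Lin.toLinearMap
    (f := fun y => sweedler (B.coact y) fun h a => A.act h (θ.map a)) (by fun_prop)
  obtain ⟨φ, hφ⟩ : ∃ φ : AntiIso k L R, φ.map = phiOfTheta A B θ :=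
    ⟨AntiIso.ofLinearMaps (phiOfTheta A B θ) η hθ.phiOfTheta_sweedler hθ.sweedler_phiOfTheta
      hθ.phiOfTheta_one (hθ.phiOfTheta_mul hB), rfl⟩
  refine ⟨φ, hφ, ⟨fun f x => ?_, fun x => ?_⟩⟩
  · rw [hφ, hθ.phiOfTheta_act x f]
  · rw [hφ, hθ.coact_phiOfTheta]
    conv_rhs => rw [← sweedler_tmul (A.coact x)]
    simp only [linearMap_sweedler, linearEquiv_sweedler, TensorProduct.comm_tmul,
      TensorProduct.map_tmul]

end CompatibleTheta

/-! ### Pairs `φ`, `θ` that determine each other -/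

variable (A B) in
/-- Antiisomorphisms `φ` and `θ` via which `L` and `R` are compatible and which determine each
other. -/
structure CompatiblePair (φ : AntiIso k L R) (θ : AntiIso k R L) : Prop where
  phi : CompatiblePhi A B φ
  theta : CompatibleTheta A B θ
  theta_eq : θ.map = thetaOfPhi A B φ
  phi_eq : φ.map = phiOfTheta A B θ

/-- From the explicit inverse `θ⁻¹(x) = φ(x₀) ◂ x₁` one gets `θ⁻¹(x₀) ◂ S(x₁) = φ(x₀) ◂ x₁ S(x₂) =
φ(x)`. So the construction of part 2 recovers `φ`, and both cases of part 3 can be treated at once.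
-/
theorem CompatiblePhi.compatiblePair {φ : AntiIso k L R} {θ : AntiIso k R L}
    (hφ : CompatiblePhi A B φ) (hA : A.IsBraidedCommutative) (h : θ.map = thetaOfPhi A B φ) :
    CompatiblePair A B φ θ := by
  obtain ⟨θ', h', hθ⟩ := hφ.exists_theta hA
  obtain rfl : θ' = θ := AntiIso.map_injective (h'.trans h.symm)
  have hinv : ∀ x, θ'.invMap x = sweedler (A.coact x) fun a h => B.act (φ.map a) h := fun x => by
    conv_lhs => rw [← hφ.thetaOfPhi_sweedler x, ← h, θ'.invMap_map]
  refine ⟨hφ, hθ, h, LinearMap.ext fun x => ?_⟩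
  simp only [phiOfTheta_apply, hinv, linearMap_sweedler, apply_sweedler, ← B.act_mul]
  rw [A.sweedler_coact_coassoc x (fun a g h => B.act (φ.map a) (g * S h))
    (by fun_prop) (by fun_prop) (by fun_prop)]
  have cancel : ∀ h a, sweedler (Δ h) (fun c d => B.act (φ.map a) (c * S d)) =
      ε h • B.act (φ.map a) 1 := fun h a =>
    sweedler_mul_antipode h (fun u => B.act (φ.map a) u) (by fun_prop)
  simp only [cancel, B.act_one]
  exact (A.sweedler_coact_counit x (fun z => φ.map z) (by fun_prop)).symm

theorem CompatibleTheta.compatiblePair {φ : AntiIso k L R} {θ : AntiIso k R L}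
    (hθ : CompatibleTheta A B θ) (hB : B.IsBraidedCommutative) (h : φ.map = phiOfTheta A B θ) :
    CompatiblePair A B φ θ := by
  obtain ⟨φ', h', hφ⟩ := hθ.exists_phi hB
  obtain rfl : φ' = φ := AntiIso.map_injective (h'.trans h.symm)
  have hinv : ∀ y, φ'.invMap y = sweedler (B.coact y) fun h a => A.act h (θ.map a) := fun y => by
    conv_lhs => rw [← hθ.phiOfTheta_sweedler y, ← h, φ'.invMap_map]
  refine ⟨hφ, hθ, LinearMap.ext fun y => ?_, h⟩
  simp only [thetaOfPhi_apply, hinv, linearMap_sweedler, ← A.mul_act]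
  rw [B.sweedler_coact_coassoc y (fun h g a => A.act (S h * g) (θ.map a))
    (by fun_prop) (by fun_prop) (by fun_prop)]
  have cancel : ∀ h a, sweedler (Δ h) (fun c d => A.act (S c * d) (θ.map a)) =
      ε h • A.act 1 (θ.map a) := fun h a =>
    sweedler_antipode_mul h (fun u => A.act u (θ.map a)) (by fun_prop)
  simp only [cancel, A.one_act]
  exact (B.sweedler_coact_counit y (fun z => θ.map z) (by fun_prop)).symm

namespace CompatiblePair

variable {φ : AntiIso k L R} {θ : AntiIso k R L} (h : CompatiblePair A B φ θ)
include h

theorem theta_apply (y : R) :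
    θ.map y = sweedler (B.coact y) fun h a => A.act (S h) (φ.invMap a) := by
  rw [h.theta_eq, thetaOfPhi_apply]

theorem phi_apply (x : L) :
    φ.map x = sweedler (A.coact x) fun a h => B.act (θ.invMap a) (S h) := by
  rw [h.phi_eq, phiOfTheta_apply]

/-- This identifies the two formulas for `β_L` on `H ♯ R`; the next lemma does the same for `β_R` on
`L ♯ H`. -/
theorem theta_inv_apply (x : L) :
    θ.invMap x = sweedler (A.coact x) fun a h => B.act (φ.map a) h := by
  conv_lhs => rw [← h.phi.thetaOfPhi_sweedler x, ← h.theta_eq, θ.invMap_map]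

theorem phi_inv_apply (y : R) :
    φ.invMap y = sweedler (B.coact y) fun h a => A.act h (θ.map a) := by
  conv_lhs => rw [← h.theta.phiOfTheta_sweedler y, ← h.phi_eq, φ.invMap_map]

end CompatiblePair

end Compatible

/-! ### Bialgebroids whose comultiplication lifts to `K ⊗ K` -/

section Balancing

variable {k A B K M : Type*} [Field k] [Ring A] [Algebra k A] [Ring B] [Algebra k B]
  [Ring K] [Algebra k K] [AddCommGroup M] [Module k M]

theorem balancing_le (r l : A →ₗ[k] Module.End k K) (p : Submodule k (K ⊗[k] K))
    (h : ∀ a u v, r a u ⊗ₜ[k] v - u ⊗ₜ[k] l a v ∈ p) : balancing r l ≤ p := by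
  refine Submodule.span_le.2 ?_
  rintro t ⟨a, u, v, rfl⟩
  exact h a u v

theorem balancing_mkQ_tmul (r l : A →ₗ[k] Module.End k K) (a : A) (u v : K) :
    (balancing r l).mkQ (r a u ⊗ₜ[k] v) = (balancing r l).mkQ (u ⊗ₜ[k] l a v) :=
  (Submodule.Quotient.eq _).2 (Submodule.subset_span ⟨a, u, v, rfl⟩)

theorem mkQ_eq_iff {p : Submodule k M} {x y : M} : p.mkQ x = p.mkQ y ↔ x - y ∈ p :=
  Submodule.Quotient.eq p

/-- A linear map that respects the relations takes the same value on all representatives. -/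
theorem lift_eq_of_mkQ_eq {r l : A →ₗ[k] Module.End k K} (F : K →ₗ[k] K →ₗ[k] M)
    (hF : ∀ a u v, F (r a u) v = F u (l a v)) {t s : K ⊗[k] K}
    (h : (balancing r l).mkQ t = (balancing r l).mkQ s) :
    TensorProduct.lift F t = TensorProduct.lift F s := by
  have : balancing r l ≤ LinearMap.ker (TensorProduct.lift F) :=
    balancing_le r l _ fun a u v => by simp [hF]
  have := this (mkQ_eq_iff.1 h)
  rwa [LinearMap.mem_ker, map_sub, sub_eq_zero] at this

theorem joinLeft_mkQ (r₁ l₁ : A →ₗ[k] Module.End k K) (r₂ l₂ : B →ₗ[k] Module.End k K)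
    (t : K ⊗[k] K) (w : K) : joinLeft r₁ l₁ r₂ l₂ ((balancing r₁ l₁).mkQ t) w =
      (balancing₃ r₁ l₁ r₂ l₂).mkQ (TensorProduct.assoc k K K K (t ⊗ₜ[k] w)) := rfl

theorem joinRight_mkQ (r₁ l₁ : A →ₗ[k] Module.End k K) (r₂ l₂ : B →ₗ[k] Module.End k K)
    (t : K ⊗[k] K) (w : K) : joinRight r₁ l₁ r₂ l₂ ((balancing r₂ l₂).mkQ t) w =
      (balancing₃ r₁ l₁ r₂ l₂).mkQ (w ⊗ₜ[k] t) := rfl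

/-- When both comultiplications come from one map `D`, coassociativity over `k` implies the balanced
identity as soon as both sides are independent of representatives. This is what `h₁` and `h₂`
ensure. The lemma covers ordinary and mixed coassociativity. -/
theorem coassociative_of_lift {r₁ l₁ : A →ₗ[k] Module.End k K} {r₂ l₂ : B →ₗ[k] Module.End k K}
    (D : K →ₗ[k] K ⊗[k] K)
    (hD : ∀ x, TensorProduct.assoc k K K K (D.rTensor K (D x)) = D.lTensor K (D x))
    (h₁ : ∀ b u, (balancing r₁ l₁).mkQ (D (r₂ b u)) =
      (balancing r₁ l₁).mkQ ((r₂ b).lTensor K (D u)))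
    (h₂ : ∀ a v, (balancing r₂ l₂).mkQ (D (l₁ a v)) =
      (balancing r₂ l₂).mkQ ((l₁ a).rTensor K (D v))) :
    Coassociative ((balancing r₁ l₁).mkQ ∘ₗ D) ((balancing r₂ l₂).mkQ ∘ₗ D) := by
  intro x t s ht hs
  -- By `h₁`, comultiplying the first leg respects the relations over `B`, so the representative `t`
  -- may be replaced by `D x`.
  have e₁ : TensorProduct.lift (joinLeft r₁ l₁ r₂ l₂ ∘ₗ (balancing r₁ l₁).mkQ ∘ₗ D) t =
      TensorProduct.lift (joinLeft r₁ l₁ r₂ l₂ ∘ₗ (balancing r₁ l₁).mkQ ∘ₗ D) (D x) := by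
    refine lift_eq_of_mkQ_eq _ (fun b u v => ?_) ht
    simp only [LinearMap.comp_apply]
    rw [h₁, joinLeft_mkQ, joinLeft_mkQ]
    generalize D u = d
    induction d using TensorProduct.induction_on with
    | zero => simp
    | tmul p q =>
      refine (Submodule.Quotient.eq _).2 (Submodule.subset_span (Or.inr ⟨b, p, q, v, ?_⟩))
      simp
    | add p q hp hq => simp only [map_add, TensorProduct.add_tmul, hp, hq]
  have e₂ : TensorProduct.lift (joinRight r₁ l₁ r₂ l₂ ∘ₗ (balancing r₂ l₂).mkQ ∘ₗ D).flip s =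
      TensorProduct.lift (joinRight r₁ l₁ r₂ l₂ ∘ₗ (balancing r₂ l₂).mkQ ∘ₗ D).flip (D x) := by
    refine lift_eq_of_mkQ_eq _ (fun a u v => ?_) hs
    simp only [LinearMap.comp_apply, LinearMap.flip_apply]
    rw [h₂, joinRight_mkQ, joinRight_mkQ]
    generalize D v = d
    induction d using TensorProduct.induction_on with
    | zero => simp
    | tmul p q =>
      refine (Submodule.Quotient.eq _).2 (Submodule.subset_span (Or.inl ⟨a, u, p, q, ?_⟩))
      simp
    | add p q hp hq => simp only [map_add, TensorProduct.tmul_add, hp, hq]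
  rw [e₁, e₂]
  have key := congrArg (balancing₃ r₁ l₁ r₂ l₂).mkQ (hD x)
  generalize D x = d at key ⊢
  convert key using 1
  · clear key
    induction d using TensorProduct.induction_on with
    | zero => simp
    | tmul p q => rfl
    | add p q hp hq => simp only [map_add, hp, hq]
  · clear key
    induction d using TensorProduct.induction_on with
    | zero => simp
    | tmul p q => rfl
    | add p q hp hq => simp only [map_add, hp, hq]

theorem mulLeftAction_apply (j : A →ₗ[k] K) (a : A) (u : K) : mulLeftAction j a u = j a * u := rfl

theorem mulRightAction_apply (j : A →ₗ[k] K) (a : A) (u : K) :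
    mulRightAction j a u = u * j a := rfl

theorem mulLeftAction_lTensor (j : A →ₗ[k] K) (a : A) (t : K ⊗[k] K) :
    (mulLeftAction j a).lTensor K t = (1 ⊗ₜ[k] j a) * t := by
  induction t using TensorProduct.induction_on with
  | zero => simp
  | tmul p q => simp [mulLeftAction_apply]
  | add p q hp hq => simp only [map_add, mul_add, hp, hq]

theorem mulLeftAction_rTensor (j : A →ₗ[k] K) (a : A) (t : K ⊗[k] K) :
    (mulLeftAction j a).rTensor K t = (j a ⊗ₜ[k] 1) * t := by
  induction t using TensorProduct.induction_on with
  | zero => simp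
  | tmul p q => simp [mulLeftAction_apply]
  | add p q hp hq => simp only [map_add, mul_add, hp, hq]

theorem mulRightAction_lTensor (j : A →ₗ[k] K) (a : A) (t : K ⊗[k] K) :
    (mulRightAction j a).lTensor K t = t * (1 ⊗ₜ[k] j a) := by
  induction t using TensorProduct.induction_on with
  | zero => simp
  | tmul p q => simp [mulRightAction_apply]
  | add p q hp hq => simp only [map_add, add_mul, hp, hq]

theorem mulRightAction_rTensor (j : A →ₗ[k] K) (a : A) (t : K ⊗[k] K) :
    (mulRightAction j a).rTensor K t = t * (j a ⊗ₜ[k] 1) := by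
  induction t using TensorProduct.induction_on with
  | zero => simp
  | tmul p q => simp [mulRightAction_apply]
  | add p q hp hq => simp only [map_add, add_mul, hp, hq]

/-- The relations are the right ideal generated by all `β(a) ⊗ 1 - 1 ⊗ α(a)`. Stability under
multiplication from the left is the substantial matter. -/
theorem leftBalancing_mul_mem (α β : A →ₗ[k] K) {t : K ⊗[k] K} (ht : t ∈ leftBalancing α β)
    (s : K ⊗[k] K) : t * s ∈ leftBalancing α β := by
  suffices leftBalancing α β ≤ (leftBalancing α β).comap (LinearMap.mulRight k s) from this ht
  refine balancing_le _ _ _ fun a u v => ?_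
  rw [Submodule.mem_comap, LinearMap.mulRight_apply]
  induction s using TensorProduct.induction_on with
  | zero => simp
  | tmul p q =>
    refine Submodule.subset_span ⟨a, u * p, v * q, ?_⟩
    simp [sub_mul, mulLeftAction_apply, mul_assoc]
  | add p q hp hq => rw [mul_add]; exact add_mem hp hq

/-- The hypotheses make `p ⊗ q` commute with the generators `β(a) ⊗ 1 - 1 ⊗ α(a)` of this right
ideal. -/
theorem mul_leftBalancing_mem_of_commute (α β : A →ₗ[k] K) {p q : K}
    (hp : ∀ a, p * β a = β a * p) (hq : ∀ a, q * α a = α a * q)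
    {t : K ⊗[k] K} (ht : t ∈ leftBalancing α β) : (p ⊗ₜ[k] q) * t ∈ leftBalancing α β := by
  suffices leftBalancing α β ≤ (leftBalancing α β).comap (LinearMap.mulLeft k (p ⊗ₜ[k] q)) from
    this ht
  refine balancing_le _ _ _ fun a u v => ?_
  rw [Submodule.mem_comap, LinearMap.mulLeft_apply]
  refine Submodule.subset_span ⟨a, p * u, q * v, ?_⟩
  simp only [mul_sub, Algebra.TensorProduct.tmul_mul_tmul, mulLeftAction_apply, ← mul_assoc, hp, hq]

/-- On the right-handed side the relations are the left ideal generated by all `α(a) ⊗ 1 - 1 ⊗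
β(a)`. -/
theorem mul_rightBalancing_mem (α β : A →ₗ[k] K) {t : K ⊗[k] K} (ht : t ∈ rightBalancing α β)
    (s : K ⊗[k] K) : s * t ∈ rightBalancing α β := by
  suffices rightBalancing α β ≤ (rightBalancing α β).comap (LinearMap.mulLeft k s) from this ht
  refine balancing_le _ _ _ fun a u v => ?_
  rw [Submodule.mem_comap, LinearMap.mulLeft_apply]
  induction s using TensorProduct.induction_on with
  | zero => simp
  | tmul p q =>
    refine Submodule.subset_span ⟨a, p * u, q * v, ?_⟩
    simp [mul_sub, mulRightAction_apply, mul_assoc]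
  | add p q hp hq => rw [add_mul]; exact add_mem hp hq

theorem rightBalancing_mul_mem_of_commute (α β : A →ₗ[k] K) {p q : K}
    (hp : ∀ a, p * α a = α a * p) (hq : ∀ a, q * β a = β a * q)
    {t : K ⊗[k] K} (ht : t ∈ rightBalancing α β) : t * (p ⊗ₜ[k] q) ∈ rightBalancing α β := by
  suffices rightBalancing α β ≤ (rightBalancing α β).comap (LinearMap.mulRight k (p ⊗ₜ[k] q)) from
    this ht
  refine balancing_le _ _ _ fun a u v => ?_
  rw [Submodule.mem_comap, LinearMap.mulRight_apply]
  refine Submodule.subset_span ⟨a, u * p, v * q, ?_⟩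
  simp only [sub_mul, Algebra.TensorProduct.tmul_mul_tmul, mulRightAction_apply, mul_assoc, hp, hq]

theorem leftBalancing_mkQ_mul (α β : A →ₗ[k] K) {t t' : K ⊗[k] K}
    (h : (leftBalancing α β).mkQ t = (leftBalancing α β).mkQ t') (s : K ⊗[k] K) :
    (leftBalancing α β).mkQ (t * s) = (leftBalancing α β).mkQ (t' * s) :=
  mkQ_eq_iff.2 (by rw [← sub_mul]; exact leftBalancing_mul_mem α β (mkQ_eq_iff.1 h) s)

theorem rightBalancing_mkQ_mul (α β : A →ₗ[k] K) {t t' : K ⊗[k] K}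
    (h : (rightBalancing α β).mkQ t = (rightBalancing α β).mkQ t') (s : K ⊗[k] K) :
    (rightBalancing α β).mkQ (s * t) = (rightBalancing α β).mkQ (s * t') :=
  mkQ_eq_iff.2 (by rw [← mul_sub]; exact mul_rightBalancing_mem α β (mkQ_eq_iff.1 h) s)

/-- A left bialgebroid whose comultiplication lifts to an algebra map `D : K → K ⊗ K`. -/
theorem isLeftBialgebroid_of_lift (α β : A →ₗ[k] K) (D : K →ₗ[k] K ⊗[k] K) (e : K →ₗ[k] A)
    (α_one : α 1 = 1) (α_mul : ∀ a b, α (a * b) = α a * α b)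
    (β_one : β 1 = 1) (β_mul : ∀ a b, β (a * b) = β b * β a)
    (comm : ∀ a b, α a * β b = β b * α a)
    (D_one : D 1 = 1) (D_mul : ∀ u v, D (u * v) = D u * D v)
    (D_coassoc : ∀ x, TensorProduct.assoc k K K K (D.rTensor K (D x)) = D.lTensor K (D x))
    (D_α : ∀ a, D (α a) = α a ⊗ₜ[k] 1)
    (D_β : ∀ b, (leftBalancing α β).mkQ (D (β b)) = (leftBalancing α β).mkQ (1 ⊗ₜ[k] β b))
    (takeuchi : ∀ u t, t ∈ leftBalancing α β → D u * t ∈ leftBalancing α β)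
    (e_bimodule : ∀ a b x, e (α a * β b * x) = a * e x * b) (e_one : e 1 = 1)
    (e_mul : ∀ u v, e (u * v) = e (u * α (e v)))
    (e_left : ∀ x, sweedler (D x) (fun u v => α (e u) * v) = x)
    (e_right : ∀ x, sweedler (D x) (fun u v => β (e v) * u) = x) :
    (⟨α, β, (leftBalancing α β).mkQ ∘ₗ D, e⟩ : LeftBialgebroidData k A K).IsLeftBialgebroid := by
  -- An arbitrary representative `t` differs from `D x` by an element of the right ideal, so the
  -- Takeuchi condition passes from `D x` to `t`.
  have takeuchi' : ∀ x t u, (leftBalancing α β).mkQ t = (leftBalancing α β).mkQ (D x) →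
      u ∈ leftBalancing α β → t * u ∈ leftBalancing α β := fun x t u ht hu => by
    have h1 := leftBalancing_mul_mem α β (mkQ_eq_iff.1 ht) u
    rw [sub_mul] at h1
    simpa using add_mem h1 (takeuchi x u hu)
  -- `D(β b)` may be replaced by `1 ⊗ β b` under `α a ⊗ 1`, since `α a` commutes with the image of
  -- `β`.
  have D_αβ : ∀ a b x, (leftBalancing α β).mkQ (D (α a * β b * x)) =
      (leftBalancing α β).mkQ ((α a ⊗ₜ[k] β b) * D x) := fun a b x => by
    rw [D_mul, D_mul, D_α]
    refine leftBalancing_mkQ_mul α β ?_ _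
    have h1 := mul_leftBalancing_mem_of_commute α β (p := α a) (q := 1) (comm a)
      (by simp) (mkQ_eq_iff.1 (D_β b))
    rw [mul_sub, Algebra.TensorProduct.tmul_mul_tmul, one_mul, mul_one] at h1
    exact mkQ_eq_iff.2 h1
  have e_α_mul : ∀ a x, e (α a * x) = a * e x := fun a x => by
    simpa [β_one] using e_bimodule a 1 x
  have e_β_mul : ∀ b x, e (β b * x) = e x * b := fun b x => by
    simpa [α_one] using e_bimodule 1 b x
  have e_α : ∀ a, e (α a) = a := fun a => by simpa [e_one] using e_α_mul a 1
  exact {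
    source_one := α_one
    source_mul := α_mul
    target_one := β_one
    target_mul := β_mul
    source_target_comm := comm
    comul_bimodule := fun a b x t ht => by
      refine (D_αβ a b x).trans (Eq.symm (mkQ_eq_iff.2 ?_))
      rw [← mul_sub]
      exact mul_leftBalancing_mem_of_commute α β (comm a) (fun c => (comm c b).symm)
        (mkQ_eq_iff.1 ht)
    counit_bimodule := e_bimodule
    coassoc := by
      refine coassociative_of_lift D D_coassoc (fun b u => ?_) (fun a v => ?_)
      · rw [mulLeftAction_lTensor]
        simpa [α_one, mulLeftAction_apply] using D_αβ 1 b u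
      · rw [mulLeftAction_rTensor]
        simpa [β_one, mulLeftAction_apply] using D_αβ a 1 v
    counit_left := fun x t ht => by
      refine (lift_eq_of_mkQ_eq _ (fun a u v => ?_) ht).trans ?_
      · simp [mulLeftAction_apply, e_β_mul, α_mul, mul_assoc]
      · rw [lift_eq_sweedler]
        exact e_left x
    counit_right := fun x t ht => by
      refine (lift_eq_of_mkQ_eq _ (fun a u v => ?_) ht).trans ?_
      · simp [mulLeftAction_apply, e_α_mul, β_mul, mul_assoc]
      · rw [lift_eq_sweedler]
        exact e_right x
    comul_factor := takeuchi'
    comul_one := fun t u ht => by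
      simpa [D_one] using leftBalancing_mkQ_mul α β ht u
    comul_mul := fun x y s t p u hs ht hp => by
      have h1 : (leftBalancing α β).mkQ (p * u) = (leftBalancing α β).mkQ (D (x * y) * u) :=
        leftBalancing_mkQ_mul α β hp u
      have h2 : (leftBalancing α β).mkQ (s * (t * u)) =
          (leftBalancing α β).mkQ (D x * (t * u)) := leftBalancing_mkQ_mul α β hs _
      rw [h1, h2, D_mul, mul_assoc]
      refine mkQ_eq_iff.2 ?_
      rw [← mul_sub]
      exact takeuchi x _ (mkQ_eq_iff.1 (leftBalancing_mkQ_mul α β ht u).symm)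
    counit_source := fun a => by simp [e_α]
    counit_mul_source := fun x y a => by
      rw [mul_assoc]
      exact e_mul x _ }

/-- A right bialgebroid whose comultiplication lifts to an algebra map `D : K → K ⊗ K`. -/
theorem isRightBialgebroid_of_lift (α β : A →ₗ[k] K) (D : K →ₗ[k] K ⊗[k] K) (e : K →ₗ[k] A)
    (α_one : α 1 = 1) (α_mul : ∀ a b, α (a * b) = α a * α b)
    (β_one : β 1 = 1) (β_mul : ∀ a b, β (a * b) = β b * β a)
    (comm : ∀ a b, α a * β b = β b * α a)
    (D_one : D 1 = 1) (D_mul : ∀ u v, D (u * v) = D u * D v)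
    (D_coassoc : ∀ x, TensorProduct.assoc k K K K (D.rTensor K (D x)) = D.lTensor K (D x))
    (D_β : ∀ b, D (β b) = β b ⊗ₜ[k] 1)
    (D_α : ∀ a, (rightBalancing α β).mkQ (D (α a)) = (rightBalancing α β).mkQ (1 ⊗ₜ[k] α a))
    (takeuchi : ∀ u t, t ∈ rightBalancing α β → t * D u ∈ rightBalancing α β)
    (e_bimodule : ∀ a b x, e (x * α a * β b) = b * e x * a) (e_one : e 1 = 1)
    (e_mul : ∀ u v, e (u * v) = e (α (e u) * v))
    (e_left : ∀ x, sweedler (D x) (fun u v => v * β (e u)) = x)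
    (e_right : ∀ x, sweedler (D x) (fun u v => u * α (e v)) = x) :
    (⟨α, β, (rightBalancing α β).mkQ ∘ₗ D, e⟩ : RightBialgebroidData k A K).IsRightBialgebroid := by
  have takeuchi' : ∀ x t u, (rightBalancing α β).mkQ t = (rightBalancing α β).mkQ (D x) →
      u ∈ rightBalancing α β → u * t ∈ rightBalancing α β := fun x t u ht hu => by
    have h1 := mul_rightBalancing_mem α β (mkQ_eq_iff.1 ht) u
    rw [mul_sub] at h1
    simpa using add_mem h1 (takeuchi x u hu)
  have D_αβ : ∀ a b x, (rightBalancing α β).mkQ (D (x * α a * β b)) =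
      (rightBalancing α β).mkQ (D x * (β b ⊗ₜ[k] α a)) := fun a b x => by
    rw [D_mul, D_mul, D_β, mul_assoc]
    refine rightBalancing_mkQ_mul α β ?_ _
    have h1 := rightBalancing_mul_mem_of_commute α β (p := β b) (q := 1) (fun c => (comm c b).symm)
      (by simp) (mkQ_eq_iff.1 (D_α a))
    rw [sub_mul, Algebra.TensorProduct.tmul_mul_tmul, one_mul, mul_one] at h1
    exact mkQ_eq_iff.2 h1
  have e_mul_α : ∀ a x, e (x * α a) = e x * a := fun a x => by
    simpa [β_one] using e_bimodule a 1 x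
  have e_mul_β : ∀ b x, e (x * β b) = b * e x := fun b x => by
    simpa [α_one] using e_bimodule 1 b x
  have e_α : ∀ a, e (α a) = a := fun a => by simpa [e_one] using e_mul_α a 1
  exact {
    source_one := α_one
    source_mul := α_mul
    target_one := β_one
    target_mul := β_mul
    source_target_comm := comm
    comul_bimodule := fun a b x t ht => by
      refine (D_αβ a b x).trans (Eq.symm (mkQ_eq_iff.2 ?_))
      rw [← sub_mul]
      exact rightBalancing_mul_mem_of_commute α β (fun c => (comm c b).symm) (comm a)
        (mkQ_eq_iff.1 ht)
    counit_bimodule := e_bimodule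
    coassoc := by
      refine coassociative_of_lift D D_coassoc (fun b u => ?_) (fun a v => ?_)
      · rw [mulRightAction_lTensor]
        simpa [β_one, mulRightAction_apply] using D_αβ b 1 u
      · rw [mulRightAction_rTensor]
        simpa [α_one, mulRightAction_apply] using D_αβ 1 a v
    counit_left := fun x t ht => by
      refine (lift_eq_of_mkQ_eq _ (fun a u v => ?_) ht).trans ?_
      · simp [mulRightAction_apply, e_mul_α, β_mul, mul_assoc]
      · rw [lift_eq_sweedler]
        exact e_left x
    counit_right := fun x t ht => by
      refine (lift_eq_of_mkQ_eq _ (fun a u v => ?_) ht).trans ?_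
      · simp [mulRightAction_apply, e_mul_β, α_mul, mul_assoc]
      · rw [lift_eq_sweedler]
        exact e_right x
    comul_factor := takeuchi'
    comul_one := fun t u ht => by
      simpa [D_one] using rightBalancing_mkQ_mul α β ht u
    comul_mul := fun x y s t p u hs ht hp => by
      have h1 : (rightBalancing α β).mkQ (u * p) = (rightBalancing α β).mkQ (u * D (x * y)) :=
        rightBalancing_mkQ_mul α β hp u
      have h2 : (rightBalancing α β).mkQ (u * s * t) =
          (rightBalancing α β).mkQ (u * s * D y) := rightBalancing_mkQ_mul α β ht _
      rw [h1, h2, D_mul, ← mul_assoc]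
      refine mkQ_eq_iff.2 ?_
      rw [← sub_mul]
      exact takeuchi y _ (mkQ_eq_iff.1 (rightBalancing_mkQ_mul α β hs u).symm)
    counit_source := fun a => by simp [e_α]
    counit_source_mul := fun x y a => by
      rw [← mul_assoc]
      exact e_mul _ y }

end Balancing

/-! ### The left bialgebroid `L ♯ H` -/

section LeftSmashHopf

variable {k H L R M : Type*} [Field k] [Ring H] [HopfAlgebra k H] [Ring L] [Algebra k L]
  [Ring R] [Algebra k R] [AddCommGroup M] [Module k M]

local notation "Δ" => comul (R := k)
local notation "ε" => counit (R := k)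
local notation "S" => HopfAlgebra.antipode k

namespace LeftSmash

variable (A : LeftRightYDModuleAlgebra k H L)

theorem comulLift_inL_mul_inH (x : L) (h : H) : comulLift A (inL A x * inH A h) =
    sweedler (Δ h) fun a b => (inL A x * inH A a) ⊗ₜ[k] inH A b := by
  simp only [comulLift, LinearMap.comp_apply, LinearEquiv.coe_coe, equiv_symm_mul,
    LinearMap.lTensor_tmul]
  conv_lhs => rw [← sweedler_tmul (Δ h)]
  simp only [sweedler_tmul_right, linearMap_sweedler, linearEquiv_sweedler,
    TensorProduct.assoc_symm_tmul, TensorProduct.map_tmul, ← mk_eq]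
  rfl

theorem comulLift_inL (x : L) : comulLift A (inL A x) = inL A x ⊗ₜ[k] 1 := by
  have := comulLift_inL_mul_inH A x 1
  rw [sweedler_comul_one _ (by fun_prop) (by fun_prop)] at this
  simpa only [inH_one, mul_one] using this

theorem comulLift_inH (h : H) : comulLift A (inH A h) =
    sweedler (Δ h) fun a b => inH A a ⊗ₜ[k] inH A b := by
  simpa only [inL_one, one_mul] using comulLift_inL_mul_inH A 1 h

theorem comulLift_one : comulLift A 1 = 1 := by
  rw [← inL_one, comulLift_inL, inL_one]
  rfl

theorem mul_inH_mul_inL_mul_inH (x z : L) (h g : H) :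
    inL A x * inH A h * (inL A z * inH A g) =
      sweedler (Δ h) fun a b => inL A (x * A.act a z) * inH A (b * g) := by
  rw [mul_assoc, ← mul_assoc (inH A h), inH_mul_inL, sweedler_mul, mul_sweedler]
  simp only [inL_mul, inH_mul, mul_assoc]

/-- On generators the map is `x ↦ x ⊗ 1`, `h ↦ h₁ ⊗ h₂`. It respects the smash relation because `h₁
x ⊗ h₂ = (h₁ ▸ x) h₂ ⊗ h₃`. -/
theorem comulLift_mul (u v : LeftSmash A.toLeftModuleAlgebra) :
    comulLift A (u * v) = comulLift A u * comulLift A v := by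
  induction u using LeftSmash.induction_on' with
  | add u u' hu hu' => rw [add_mul, map_add, map_add, add_mul, hu, hu']
  | mul x h =>
    induction v using LeftSmash.induction_on' with
    | add v v' hv hv' => rw [mul_add, map_add, map_add, mul_add, hv, hv']
    | mul z g =>
      have e1 : ∀ x : L, ∀ b : H, comulLift A (inL A x * inH A (b * g)) =
          sweedler (Δ b) fun p q => sweedler (Δ g) fun c d =>
            (inL A x * inH A (p * c)) ⊗ₜ[k] inH A (q * d) := fun x b => by
        rw [comulLift_inL_mul_inH, sweedler_comul_mul _ _ _ (by fun_prop) (by fun_prop)]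
      simp only [mul_inH_mul_inL_mul_inH, linearMap_sweedler, e1]
      rw [← sweedler_comul_coassoc h (fun a p q => sweedler (Δ g) fun c d =>
            (inL A (x * A.act a z) * inH A (p * c)) ⊗ₜ[k] inH A (q * d))
            (by fun_prop) (by fun_prop) (by fun_prop)]
      have e2 : ∀ a b, (inL A x * inH A a) ⊗ₜ[k] inH A b * comulLift A (inL A z * inH A g) =
          sweedler (Δ a) fun a p => sweedler (Δ g) fun c d =>
            (inL A (x * A.act a z) * inH A (p * c)) ⊗ₜ[k] inH A (b * d) := fun a b => by
        simp only [comulLift_inL_mul_inH, mul_sweedler, Algebra.TensorProduct.tmul_mul_tmul,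
          mul_inH_mul_inL_mul_inH, sweedler_tmul_left]
        rw [sweedler_comm]
        simp only [← inH_mul]
      rw [comulLift_inL_mul_inH, sweedler_mul]
      simp only [e2]

theorem comulLift_coassoc (u : LeftSmash A.toLeftModuleAlgebra) :
    TensorProduct.assoc k _ _ _ ((comulLift A).rTensor _ (comulLift A u)) =
      (comulLift A).lTensor _ (comulLift A u) := by
  induction u using LeftSmash.induction_on' with
  | add u v hu hv => simp only [map_add, hu, hv]
  | mul x h =>
    simp only [comulLift_inL_mul_inH, linearMap_sweedler, linearEquiv_sweedler,
      LinearMap.rTensor_tmul, LinearMap.lTensor_tmul, comulLift_inH, sweedler_tmul_left,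
      sweedler_tmul_right, TensorProduct.assoc_tmul]
    rw [sweedler_comul_coassoc h
      (fun a b c => (inL A x * inH A a) ⊗ₜ[k] (inH A b ⊗ₜ[k] inH A c))
      (by fun_prop) (by fun_prop) (by fun_prop)]

theorem comulLift_rho (x : L) :
    comulLift A (rho A x) = sweedler (A.coact x) fun a h => rho A a ⊗ₜ[k] inH A h := by
  simp only [rho_eq, linearMap_sweedler, comulLift_inL_mul_inH, sweedler_tmul_left]
  rw [A.sweedler_coact_coassoc x (fun a b c => (inL A a * inH A b) ⊗ₜ[k] inH A c)
    (by fun_prop) (by fun_prop) (by fun_prop)]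

/-- The left side is the class of `ρ(x₀) ⊗ x₁`; balancing moves `ρ(x₀)` to the second leg as `x₀`,
which gives `1 ⊗ x₀ x₁`. -/
theorem mkQ_comulLift_rho (x : L) :
    (leftBalancing (inL A) (rho A)).mkQ (comulLift A (rho A x)) =
      (leftBalancing (inL A) (rho A)).mkQ (1 ⊗ₜ[k] rho A x) := by
  conv_rhs => rw [rho_eq]
  rw [comulLift_rho, sweedler_tmul_right]
  simp only [linearMap_sweedler]
  congr! 3 with a h
  simpa [mulLeftAction_apply] using
    balancing_mkQ_tmul (mulLeftAction (rho A)) (mulLeftAction (inL A)) a 1 (inH A h)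

variable {A}

/-- The Takeuchi condition. The factor `x ⊗ 1` is harmless because `x` commutes with `ρ(L)`. For
`h`, the exchange rules give `h₁ ρ(a) ⊗ h₂ = ρ(h₂ ▸ a) h₁ ⊗ h₃` and `h₁ ⊗ h₂ a = h₁ ⊗ (h₂ ▸ a) h₃`,
which agree by balancing with `h₂ ▸ a`. -/
theorem comulLift_mul_leftBalancing_mem (hA : A.IsBraidedCommutative)
    (w : LeftSmash A.toLeftModuleAlgebra)
    (t : LeftSmash A.toLeftModuleAlgebra ⊗[k] LeftSmash A.toLeftModuleAlgebra)
    (ht : t ∈ leftBalancing (inL A) (rho A)) :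
    comulLift A w * t ∈ leftBalancing (inL A) (rho A) := by
  induction w using LeftSmash.induction_on' with
  | add u v hu hv => rw [map_add, add_mul]; exact add_mem hu hv
  | mul x h =>
    rw [comulLift_mul, mul_assoc, comulLift_inL]
    refine mul_leftBalancing_mem_of_commute _ _ (fun a => (rho_mul_inL hA a x).symm) (by simp) ?_
    suffices leftBalancing (inL A) (rho A) ≤ (leftBalancing (inL A) (rho A)).comap
      (LinearMap.mulLeft k (comulLift A (inH A h))) from this ht
    refine balancing_le _ _ _ fun a u v => ?_
    rw [Submodule.mem_comap, LinearMap.mulLeft_apply, mul_sub]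
    refine mkQ_eq_iff.1 ?_
    simp only [comulLift_inH, sweedler_mul, linearMap_sweedler, mulLeftAction_apply,
      Algebra.TensorProduct.tmul_mul_tmul, ← mul_assoc, inH_mul_inL, inH_mul_rho,
      sweedler_tmul_left, sweedler_tmul_right]
    rw [sweedler_comul_coassoc h (fun p q b => (leftBalancing (inL A) (rho A)).mkQ
      ((rho A (A.act q a) * inH A p * u) ⊗ₜ[k] (inH A b * v)))
      (by fun_prop) (by fun_prop) (by fun_prop)]
    congr! 3 with b c
    congr! 3 with d e
    simpa [mulLeftAction_apply, mul_assoc] using balancing_mkQ_tmul (mulLeftAction (rho A))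
      (mulLeftAction (inL A)) (A.act d a) (inH A b * u) (inH A e * v)

theorem counit_one : LeftSmash.counit A 1 = 1 := by
  have := counit_inL_mul_inH A 1 1
  rwa [inL_one, inH_one, mul_one, Bialgebra.counit_one, one_smul] at this

variable (A) in
/-- The action `(x ♯ h) ▸ z = x (h ▸ z)` of `L ♯ H` on `L`. -/
def actL (z : L) : LeftSmash A.toLeftModuleAlgebra →ₗ[k] L :=
  Lin.toLinearMap (f := fun u => sweedler ((equiv A.toLeftModuleAlgebra).symm u)
    fun x h => x * A.act h z) (by fun_prop)

variable (A) in
theorem actL_mul_inH (z x : L) (h : H) : actL A z (inL A x * inH A h) = x * A.act h z := by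
  change sweedler ((equiv A.toLeftModuleAlgebra).symm (inL A x * inH A h))
    (fun x h => x * A.act h z) = _
  rw [equiv_symm_mul, tmul_sweedler _ _ _ (by fun_prop) (by fun_prop)]

variable (A) in
theorem actL_mul (z : L) (u v : LeftSmash A.toLeftModuleAlgebra) :
    actL A z (u * v) = actL A (actL A z v) u := by
  induction u using LeftSmash.induction_on' with
  | add u u' hu hu' => rw [add_mul, map_add, map_add, hu, hu']
  | mul x h =>
    simp only [actL_mul_inH]
    induction v using LeftSmash.induction_on' with
    | add v v' hv hv' => rw [mul_add, map_add, map_add, map_add, mul_add, hv, hv']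
    | mul y g =>
      rw [mul_inH_mul_inL_mul_inH]
      simp only [linearMap_sweedler, actL_mul_inH, A.act_mul_sweedler, mul_sweedler, A.mul_act, mul_assoc]

variable (A) in
theorem actL_inL (z x : L) : actL A z (inL A x) = x * z := by
  have := actL_mul_inH A z x 1
  rwa [inH_one, mul_one, A.one_act] at this

/-- Braided commutativity makes `ρ(x)` act as right multiplication by `x`, while `x` itself acts as
left multiplication. -/
theorem actL_rho (hA : A.IsBraidedCommutative) (z x : L) : actL A z (rho A x) = z * x := by
  simp only [rho_eq, linearMap_sweedler, actL_mul_inH]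
  exact hA.sweedler x z

-- With the counit written as `u ▸ 1`, its bimodule and multiplicativity axioms are immediate from
-- the action law `actL_mul`.
variable (A) in
theorem counit_eq_actL (u : LeftSmash A.toLeftModuleAlgebra) :
    LeftSmash.counit A u = actL A 1 u := by
  induction u using LeftSmash.induction_on' with
  | add u v hu hv => rw [map_add, map_add, hu, hv]
  | mul x h => rw [counit_inL_mul_inH, actL_mul_inH, A.act_one, mul_smul_comm, mul_one]

theorem isLeftBialgebroid (hA : A.IsBraidedCommutative) :
    (⟨inL A, rho A, (leftBalancing (inL A) (rho A)).mkQ ∘ₗ comulLift A, LeftSmash.counit A⟩ :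
      LeftBialgebroidData k L (LeftSmash A.toLeftModuleAlgebra)).IsLeftBialgebroid := by
  refine isLeftBialgebroid_of_lift (inL A) (rho A) (comulLift A) (LeftSmash.counit A)
    (inL_one A) (inL_mul A) (rho_one A) (rho_mul hA) (fun a b => (rho_mul_inL hA b a).symm)
    (comulLift_one A) (comulLift_mul A) (comulLift_coassoc A) (comulLift_inL A)
    (mkQ_comulLift_rho A) (comulLift_mul_leftBalancing_mem hA) ?_ counit_one ?_ ?_ ?_
  · intro a b x
    simp only [counit_eq_actL, actL_mul, actL_inL, actL_rho hA, mul_assoc]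
  · intro u v
    simp only [counit_eq_actL, actL_mul, actL_inL, mul_one]
  · intro u
    induction u using LeftSmash.induction_on' with
    | add u v hu hv =>
      rw [map_add, (show Lin k (fun t => sweedler t fun u v => inL A (LeftSmash.counit A u) * v)
        by fun_prop).map_add, hu, hv]
    | mul x h =>
      rw [comulLift_inL_mul_inH, sweedler_sweedler _ _ _ (by fun_prop) (by fun_prop)]
      simp (disch := fun_prop) only [tmul_sweedler, counit_inL_mul_inH, map_smul, smul_mul_assoc]
      exact sweedler_counit_left h (fun b => inL A x * inH A b) (by fun_prop)
  · intro u
    induction u using LeftSmash.induction_on' with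
    | add u v hu hv =>
      rw [map_add, (show Lin k (fun t => sweedler t fun u v => rho A (LeftSmash.counit A v) * u)
        by fun_prop).map_add, hu, hv]
    | mul x h =>
      have e1 : ∀ b, LeftSmash.counit A (inH A b) = ε b • 1 := fun b => by
        simpa [inL_one] using counit_inL_mul_inH A 1 b
      rw [comulLift_inL_mul_inH, sweedler_sweedler _ _ _ (by fun_prop) (by fun_prop)]
      simp (disch := fun_prop) only [tmul_sweedler, e1, map_smul, smul_mul_assoc, rho_one,
        one_mul]
      exact sweedler_counit_right h (fun b => inL A x * inH A b) (by fun_prop)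

end LeftSmash

end LeftSmashHopf

/-! ### The right bialgebroid and the antipode on `L ♯ H` -/

section RightBialgebroid

variable {k H L R M : Type*} [Field k] [Ring H] [HopfAlgebra k H] [Ring L] [Algebra k L]
  [Ring R] [Algebra k R] [AddCommGroup M] [Module k M]

local notation "Δ" => comul (R := k)
local notation "ε" => counit (R := k)
local notation "S" => HopfAlgebra.antipode k

variable {A : LeftRightYDModuleAlgebra k H L} {B : RightLeftYDModuleAlgebra k H R}

namespace LeftSmash

variable (A B) in
/-- The action `y ◂ (x ♯ h) = (φ(x) y) ◂ h` of `L ♯ H` on `R`. -/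
def actR (φ : AntiIso k L R) (y : R) : LeftSmash A.toLeftModuleAlgebra →ₗ[k] R :=
  Lin.toLinearMap (f := fun u => sweedler ((equiv A.toLeftModuleAlgebra).symm u)
    fun x h => B.act (φ.map x * y) h) (by fun_prop)

theorem actR_mul_inH (φ : AntiIso k L R) (y : R) (x : L) (h : H) :
    actR A B φ y (inL A x * inH A h) = B.act (φ.map x * y) h := by
  change sweedler ((equiv A.toLeftModuleAlgebra).symm (inL A x * inH A h))
    (fun x h => B.act (φ.map x * y) h) = _
  rw [equiv_symm_mul, tmul_sweedler _ _ _ (by fun_prop) (by fun_prop)]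

theorem actR_add (φ : AntiIso k L R) (y w : R) (u : LeftSmash A.toLeftModuleAlgebra) :
    actR A B φ (y + w) u = actR A B φ y u + actR A B φ w u := by
  induction u using LeftSmash.induction_on' with
  | add u v hu hv => simp only [map_add, hu, hv]; abel
  | mul x h => simp only [actR_mul_inH, mul_add, map_add, LinearMap.add_apply]

theorem actR_inL (φ : AntiIso k L R) (y : R) (x : L) : actR A B φ y (inL A x) = φ.map x * y := by
  have := actR_mul_inH (A := A) (B := B) φ y x 1
  rwa [inH_one, mul_one, B.act_one] at this

theorem actR_inH (φ : AntiIso k L R) (y : R) (h : H) : actR A B φ y (inH A h) = B.act y h := by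
  have := actR_mul_inH (A := A) (B := B) φ y 1 h
  rwa [inL_one, φ.map_one, one_mul, one_mul] at this

end LeftSmash

namespace CompatiblePhi

open LeftSmash

variable {φ : AntiIso k L R} (hφ : CompatiblePhi A B φ)
include hφ

/-- The smash relation is respected because `(φ(h₁ ▸ z) w) ◂ h₂ = (φ(z) ◂ S(h₁) h₂) (w ◂ h₃) = φ(z)
(w ◂ h)`. -/
theorem actR_mul (y : R) (u v : LeftSmash A.toLeftModuleAlgebra) :
    actR A B φ y (u * v) = actR A B φ (actR A B φ y u) v := by
  induction u using LeftSmash.induction_on' with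
  | add u u' hu hu' => rw [add_mul, map_add, map_add, hu, hu', actR_add]
  | mul x h =>
    rw [actR_mul_inH]
    induction v using LeftSmash.induction_on' with
    | add v v' hv hv' => rw [mul_add, map_add, map_add, hv, hv']
    | mul z g =>
      rw [mul_inH_mul_inL_mul_inH]
      have e1 : ∀ a b, actR A B φ y (inL A (x * A.act a z) * inH A (b * g)) =
          B.act (sweedler (Δ b) fun c d => B.act (φ.map z) (S a * c) * B.act (φ.map x * y) d)
            g := fun a b => by
        rw [actR_mul_inH, φ.map_mul, hφ.act, B.act_mul, mul_assoc, B.mul_act_sweedler]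
        simp only [← B.act_mul]
      simp only [linearMap_sweedler, e1, apply_sweedler]
      rw [sweedler_antipode_mul_left h
        (fun u c => B.act (B.act (φ.map z) u * B.act (φ.map x * y) c) g)
        (by fun_prop) (by fun_prop), B.act_one, actR_mul_inH]

end CompatiblePhi

namespace CompatiblePair

open LeftSmash

variable {φ : AntiIso k L R} {θ : AntiIso k R L} (hp : CompatiblePair A B φ θ)
include hp

theorem rho_theta (y : R) : rho A (θ.map y) =
    sweedler (B.coact y) fun h a => inH A (S h) * inL A (φ.invMap a) := by
  rw [hp.theta_eq, hp.phi.rho_thetaOfPhi]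

theorem rho_theta_mul_inH (y : R) (f : H) : rho A (θ.map y) * inH A f =
    sweedler (Δ f) fun a b => inH A a * rho A (θ.map (B.act y b)) := by
  simp only [rho_mul_inH, hp.theta.act]

/-- The right side equals `φ⁻¹(y ◂ f₁ S(f₂)) f₃`. Together with `rho_theta_mul_inH` this moves
`β_R(y)` and `α_R(y)` past `H`. -/
theorem inL_phi_inv_mul_inH (y : R) (f : H) : inL A (φ.invMap y) * inH A f =
    sweedler (Δ f) fun a b => inH A b * inL A (φ.invMap (B.act y a)) := by
  simp only [inH_mul_inL, ← hp.phi.invMap_act, ← B.act_mul]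
  rw [sweedler_mul_antipode_left f (fun u b => inL A (φ.invMap (B.act y u)) * inH A b)
    (by fun_prop) (by fun_prop), B.act_one]

theorem theta_phi_act (x : L) (f : H) :
    θ.map (φ.map (A.act f x)) = A.act (S (S f)) (θ.map (φ.map x)) := by
  rw [hp.phi.act, hp.theta.act]

/-- Since `ρ(θ(w)) = S(w₋₁) · φ⁻¹(w₀)`, it acts by `y ↦ w₀ (y ◂ S(w₋₁))`. Braided commutativity of
`R` turns this into `(y ◂ S(w₋₂) w₋₁) w₀ = y w`. -/
theorem actR_rho_theta (hB : B.IsBraidedCommutative) (y w : R) :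
    actR A B φ y (rho A (θ.map w)) = y * w := by
  have e1 : ∀ h a, actR A B φ y (inH A (S h) * inL A (φ.invMap a)) =
      sweedler (B.coact a) fun g b => B.act y (S h * g) * b := fun h a => by
    rw [hp.phi.actR_mul, actR_inH, actR_inL, φ.map_invMap, ← hB.sweedler]
    simp only [B.act_mul]
  rw [hp.rho_theta, linearMap_sweedler]
  simp only [e1]
  rw [B.sweedler_coact_coassoc w (fun h g b => B.act y (S h * g) * b)
    (by fun_prop) (by fun_prop) (by fun_prop)]
  have cancel : ∀ h b, sweedler (Δ h) (fun c d => B.act y (S c * d) * b) =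
      ε h • (B.act y 1 * b) := fun h b =>
    sweedler_antipode_mul h (fun u => B.act y u * b) (by fun_prop)
  simp only [cancel, B.act_one]
  exact B.sweedler_coact_counit w (fun b => y * b) (by fun_prop)

/-- The lifted coproduct is `ρ(θ(y₀)) ⊗ S(y₋₁)`, and balancing over `R` gives `1 ⊗ S(y₋₁) φ⁻¹(y₀)`.
-/
theorem mkQ_comulLift_rho_theta (y : R) :
    (rightBalancing (rho A ∘ₗ θ.map) (inL A ∘ₗ φ.invMap)).mkQ (comulLift A (rho A (θ.map y))) =
      (rightBalancing (rho A ∘ₗ θ.map) (inL A ∘ₗ φ.invMap)).mkQ (1 ⊗ₜ[k] rho A (θ.map y)) := by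
  conv_rhs => rw [hp.rho_theta]
  rw [comulLift_rho, hp.theta.sweedler_coact y _ (by fun_prop) (by fun_prop), sweedler_tmul_right]
  simp only [linearMap_sweedler]
  congr! 3 with h a
  simpa [mulRightAction_apply] using balancing_mkQ_tmul (mulRightAction (rho A ∘ₗ θ.map))
    (mulRightAction (inL A ∘ₗ φ.invMap)) a 1 (inH A (S h))

/-- The Takeuchi condition over `R`: pushing `α_R(y)` and `β_R(y)` past `h₁ ⊗ h₂` produces in both
cases the middle element `y ◂ h₂`, over which one then balances. -/
theorem mul_comulLift_rightBalancing_mem (hA : A.IsBraidedCommutative)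
    (w : LeftSmash A.toLeftModuleAlgebra)
    (t : LeftSmash A.toLeftModuleAlgebra ⊗[k] LeftSmash A.toLeftModuleAlgebra)
    (ht : t ∈ rightBalancing (rho A ∘ₗ θ.map) (inL A ∘ₗ φ.invMap)) :
    t * comulLift A w ∈ rightBalancing (rho A ∘ₗ θ.map) (inL A ∘ₗ φ.invMap) := by
  induction w using LeftSmash.induction_on' with
  | add u v hu hv => rw [map_add, mul_add]; exact add_mem hu hv
  | mul x h =>
    rw [comulLift_mul, ← mul_assoc, comulLift_inL]
    have ht' := rightBalancing_mul_mem_of_commute (rho A ∘ₗ θ.map) (inL A ∘ₗ φ.invMap)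
      (p := inL A x) (q := 1) (fun a => (rho_mul_inL hA (θ.map a) x).symm) (by simp) ht
    generalize t * (inL A x ⊗ₜ[k] 1) = t' at ht'
    set I := rightBalancing (rho A ∘ₗ θ.map) (inL A ∘ₗ φ.invMap) with hI
    suffices I ≤ I.comap (LinearMap.mulRight k (comulLift A (inH A h))) from this ht'
    refine balancing_le _ _ _ fun y u v => ?_
    rw [Submodule.mem_comap, LinearMap.mulRight_apply, sub_mul]
    refine mkQ_eq_iff.1 ?_
    simp only [comulLift_inH, mul_sweedler, linearMap_sweedler, mulRightAction_apply,
      LinearMap.comp_apply, Algebra.TensorProduct.tmul_mul_tmul, mul_assoc, hp.rho_theta_mul_inH,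
      hp.inL_phi_inv_mul_inH, sweedler_tmul_left, sweedler_tmul_right]
    rw [sweedler_comul_coassoc h (fun p q b => I.mkQ
      ((u * (inH A p * rho A (θ.map (B.act y q)))) ⊗ₜ[k] (v * inH A b)))
      (by fun_prop) (by fun_prop) (by fun_prop)]
    congr! 3 with b c
    congr! 3 with d e
    simpa [mulRightAction_apply, mul_assoc] using balancing_mkQ_tmul
      (mulRightAction (rho A ∘ₗ θ.map)) (mulRightAction (inL A ∘ₗ φ.invMap)) (B.act y d)
      (u * inH A b) (v * inH A e)

end CompatiblePair

namespace LeftSmash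

variable (A B) in
/-- The counit `x ♯ h ↦ φ(x) ◂ h`. -/
def counitR (φ : AntiIso k L R) : LeftSmash A.toLeftModuleAlgebra →ₗ[k] R :=
  TensorProduct.lift (B.act ∘ₗ φ.map) ∘ₗ (equiv _).symm.toLinearMap

theorem counitR_mul_inH (φ : AntiIso k L R) (x : L) (h : H) :
    counitR A B φ (inL A x * inH A h) = B.act (φ.map x) h := by
  simp [counitR, equiv_symm_mul]

theorem counitR_eq_actR (φ : AntiIso k L R) (u : LeftSmash A.toLeftModuleAlgebra) :
    counitR A B φ u = actR A B φ 1 u := by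
  induction u using LeftSmash.induction_on' with
  | add u v hu hv => rw [map_add, map_add, hu, hv]
  | mul x h => rw [counitR_mul_inH, actR_mul_inH, mul_one]

theorem counitR_inL (φ : AntiIso k L R) (x : L) : counitR A B φ (inL A x) = φ.map x := by
  rw [counitR_eq_actR, actR_inL, mul_one]

theorem counitR_inH (φ : AntiIso k L R) (h : H) : counitR A B φ (inH A h) = ε h • 1 := by
  rw [counitR_eq_actR, actR_inH, B.one_act]

end LeftSmash

namespace CompatiblePair

open LeftSmash

variable {φ : AntiIso k L R} {θ : AntiIso k R L} (hp : CompatiblePair A B φ θ)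
include hp

theorem counitR_rho_theta (hB : B.IsBraidedCommutative) (y : R) :
    counitR A B φ (rho A (θ.map y)) = y := by
  rw [counitR_eq_actR, hp.actR_rho_theta hB, one_mul]

theorem isRightBialgebroid (hA : A.IsBraidedCommutative) (hB : B.IsBraidedCommutative) :
    (⟨rho A ∘ₗ θ.map, inL A ∘ₗ φ.invMap,
      (rightBalancing (rho A ∘ₗ θ.map) (inL A ∘ₗ φ.invMap)).mkQ ∘ₗ comulLift A, counitR A B φ⟩ :
      RightBialgebroidData k R (LeftSmash A.toLeftModuleAlgebra)).IsRightBialgebroid := by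
  refine isRightBialgebroid_of_lift (rho A ∘ₗ θ.map) (inL A ∘ₗ φ.invMap) (comulLift A)
    (counitR A B φ) ?_ ?_ ?_ ?_ (fun a b => rho_mul_inL hA _ _)
    (comulLift_one A) (comulLift_mul A) (comulLift_coassoc A) (fun b => comulLift_inL A _)
    hp.mkQ_comulLift_rho_theta (hp.mul_comulLift_rightBalancing_mem hA) ?_ ?_ ?_ ?_ ?_
  · simp [θ.map_one, rho_one]
  · intro a b
    simp [θ.map_mul, rho_mul hA]
  · simp [φ.invMap_one, inL_one]
  · intro a b
    simp [φ.invMap_mul, inL_mul]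
  · intro a b x
    simp only [LinearMap.comp_apply, counitR_eq_actR, hp.phi.actR_mul, actR_inL,
      hp.actR_rho_theta hB, φ.map_invMap, mul_assoc]
  · rw [← inL_one, counitR_inL, φ.map_one]
  · intro u v
    simp only [LinearMap.comp_apply, counitR_eq_actR, hp.phi.actR_mul, hp.actR_rho_theta hB,
      one_mul]
  · intro u
    induction u using LeftSmash.induction_on' with
    | add u v hu hv =>
      rw [map_add, (show Lin k (fun t => sweedler t fun u v => v *
        (inL A ∘ₗ φ.invMap) (counitR A B φ u)) by fun_prop).map_add, hu, hv]
    | mul x h =>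
      rw [comulLift_inL_mul_inH, sweedler_sweedler _ _ _ (by fun_prop) (by fun_prop)]
      simp (disch := fun_prop) only [tmul_sweedler, counitR_mul_inH, LinearMap.comp_apply]
      rw [← hp.inL_phi_inv_mul_inH, φ.invMap_map]
  · intro u
    induction u using LeftSmash.induction_on' with
    | add u v hu hv =>
      rw [map_add, (show Lin k (fun t => sweedler t fun u v => u *
        (rho A ∘ₗ θ.map) (counitR A B φ v)) by fun_prop).map_add, hu, hv]
    | mul x h =>
      rw [comulLift_inL_mul_inH, sweedler_sweedler _ _ _ (by fun_prop) (by fun_prop)]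
      simp (disch := fun_prop) only [tmul_sweedler, counitR_inH, LinearMap.comp_apply, map_smul,
        θ.map_one, rho_one, mul_smul_comm, mul_one]
      exact sweedler_counit_right h (fun b => inL A x * inH A b) (by fun_prop)

/-- The factor `S²(x₁) · x₀` is `ρ(θ(y))` at `y = φ(x)`. In this form `τ` inherits its properties
from those of `ρ`, `θ` and `φ`. -/
theorem antipode_mul_inH (x : L) (h : H) : LeftSmash.antipode A (inL A x * inH A h) =
    inH A (S h) * rho A (θ.map (φ.map x)) := by
  have e1 : antipodeL A x = rho A (θ.map (φ.map x)) := by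
    rw [hp.rho_theta, hp.phi.sweedler_coact x _ (by fun_prop) (by fun_prop), antipodeL,
      LinearMap.comp_apply, lift_eq_sweedler]
    simp
  simp [LeftSmash.antipode, equiv_symm_mul, e1]

theorem antipode_inL (x : L) :
    LeftSmash.antipode A (inL A x) = rho A (θ.map (φ.map x)) := by
  have := hp.antipode_mul_inH x 1
  rwa [HopfAlgebra.antipode_one, inH_one, mul_one, one_mul] at this

theorem antipode_inH (h : H) : LeftSmash.antipode A (inH A h) = inH A (S h) := by
  have := hp.antipode_mul_inH 1 h
  rwa [inL_one, φ.map_one, θ.map_one, rho_one, mul_one, one_mul] at this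

/-- `ρ ∘ θ ∘ φ` and `S` are antimultiplicative, so the point is the image of the smash relation.
This is `e1`, where the `S²(h₁)` from the exchange rule is absorbed by `theta_phi_act`. -/
theorem antipode_mul (hA : A.IsBraidedCommutative) (u v : LeftSmash A.toLeftModuleAlgebra) :
    LeftSmash.antipode A (u * v) = LeftSmash.antipode A v * LeftSmash.antipode A u := by
  induction u using LeftSmash.induction_on' with
  | add u u' hu hu' => rw [add_mul, map_add, map_add, mul_add, hu, hu']
  | mul x h =>
    induction v using LeftSmash.induction_on' with
    | add v v' hv hv' => rw [mul_add, map_add, map_add, add_mul, hv, hv']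
    | mul z g =>
      have e1 : rho A (θ.map (φ.map z)) * inH A (S h) = sweedler (Δ h) fun a b =>
          inH A (S b) * rho A (θ.map (φ.map (A.act a z))) := by
        simp only [hp.theta_phi_act]
        rw [rho_mul_inH, sweedler_comul_antipode _ _ (by fun_prop) (by fun_prop)]
      rw [mul_inH_mul_inL_mul_inH]
      simp only [linearMap_sweedler, hp.antipode_mul_inH]
      simp only [φ.map_mul, θ.map_mul, rho_mul hA, antipode_mul_eq, inH_mul]
      rw [mul_assoc, ← mul_assoc (rho A _), e1, sweedler_mul, mul_sweedler]
      simp only [mul_assoc]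

/-- One finds `S(x₂) S²(x₁) x₀ = S(S(x₁) x₂) x₀`, which collapses to `x`. -/
theorem antipode_rho (x : L) : LeftSmash.antipode A (rho A x) = inL A x := by
  have e1 : ∀ a h, inH A (S h) * rho A (θ.map (φ.map a)) =
      sweedler (A.coact a) fun b g => inH A (S (S g * h)) * inL A b := fun a h => by
    rw [hp.rho_theta, hp.phi.sweedler_coact a _ (by fun_prop) (by fun_prop), mul_sweedler]
    simp only [φ.invMap_map, antipode_mul_eq, inH_mul, mul_assoc]
  rw [rho_eq, linearMap_sweedler]
  simp only [hp.antipode_mul_inH, e1]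
  rw [A.sweedler_coact_coassoc x (fun b g h => inH A (S (S g * h)) * inL A b)
    (by fun_prop) (by fun_prop) (by fun_prop)]
  have cancel : ∀ h b, sweedler (Δ h) (fun c d => inH A (S (S c * d)) * inL A b) =
      ε h • (inH A (S 1) * inL A b) := fun h b =>
    sweedler_antipode_mul h (fun u => inH A (S u) * inL A b) (by fun_prop)
  simp only [cancel, HopfAlgebra.antipode_one, inH_one, one_mul]
  exact A.sweedler_coact_counit x (fun b => inL A b) (by fun_prop)

/-- With `y = φ(x)` one has `S(h₁) ρ(θ(y)) h₂ = S(h₁) h₂ ρ(θ(y ◂ h₃)) = ρ(θ(y ◂ h))`. -/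
theorem sweedler_comulLift_antipode_mul (u : LeftSmash A.toLeftModuleAlgebra) :
    sweedler (comulLift A u) (fun p q => LeftSmash.antipode A p * q) =
      rho A (θ.map (counitR A B φ u)) := by
  induction u using LeftSmash.induction_on' with
  | add u v hu hv =>
    simp only [map_add]
    rw [(show Lin k (fun t => sweedler t fun p q => LeftSmash.antipode A p * q)
      by fun_prop).map_add, hu, hv]
  | mul x h =>
    rw [comulLift_inL_mul_inH, sweedler_sweedler _ _ _ (by fun_prop) (by fun_prop)]
    simp (disch := fun_prop) only [tmul_sweedler, hp.antipode_mul_inH]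
    simp only [mul_assoc, hp.rho_theta_mul_inH, mul_sweedler]
    simp only [← mul_assoc, ← inH_mul]
    rw [sweedler_antipode_mul_left h (fun u d => inH A u * rho A (θ.map (B.act (φ.map x) d)))
      (by fun_prop) (by fun_prop), inH_one, one_mul, counitR_mul_inH]

theorem sweedler_comulLift_mul_antipode (u : LeftSmash A.toLeftModuleAlgebra) :
    sweedler (comulLift A u) (fun p q => p * LeftSmash.antipode A q) =
      inL A (LeftSmash.counit A u) := by
  induction u using LeftSmash.induction_on' with
  | add u v hu hv =>
    simp only [map_add]
    rw [(show Lin k (fun t => sweedler t fun p q => p * LeftSmash.antipode A q)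
      by fun_prop).map_add, hu, hv]
  | mul x h =>
    rw [comulLift_inL_mul_inH, sweedler_sweedler _ _ _ (by fun_prop) (by fun_prop)]
    simp (disch := fun_prop) only [tmul_sweedler, hp.antipode_inH, mul_assoc, ← inH_mul]
    rw [sweedler_mul_antipode h (fun u => inL A x * inH A u) (by fun_prop), inH_one, mul_one,
      counit_inL_mul_inH, map_smul]

theorem isSymmetricHopfAlgebroid (hA : A.IsBraidedCommutative) (hB : B.IsBraidedCommutative) :
    (leftSmashData A (rho A ∘ₗ θ.map) (inL A ∘ₗ φ.invMap)
      (counitR A B φ)).IsSymmetricHopfAlgebroid where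
  isLeftBialgebroid := LeftSmash.isLeftBialgebroid hA
  isRightBialgebroid := hp.isRightBialgebroid hA hB
  antipode_one := by
    rw [← inL_one]
    exact (hp.antipode_inL 1).trans (by rw [φ.map_one, θ.map_one, rho_one, inL_one])
  antipode_mul := hp.antipode_mul hA
  sourceL_counitL_targetR y := by
    simp [leftSmashData, counit_eq_actL, actL_inL]
  targetL_counitL_sourceR y := by
    simp [leftSmashData, counit_rho]
  sourceR_counitR_targetL x := by
    obtain ⟨y, rfl⟩ : ∃ y, x = θ.map y := ⟨θ.invMap x, (θ.map_invMap x).symm⟩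
    simp [leftSmashData, hp.counitR_rho_theta hB]
  targetR_counitR_sourceL x := by
    simp [leftSmashData, counitR_inL]
  coassoc_RL := by
    -- The relations over `L` must be respected modulo those over `R`. As `θ` is onto, `β_L` and
    -- `α_R` have the same image, so the coproduct of `ρ(b)` is `1 ⊗ ρ(b)` modulo the relations over
    -- `R` too; the Takeuchi condition permits multiplication by the coproduct of `u`.
    refine coassociative_of_lift (comulLift A) (comulLift_coassoc A) (fun b u => ?_) (fun a v => ?_)
    · obtain ⟨y, rfl⟩ : ∃ y, b = θ.map y := ⟨θ.invMap b, (θ.map_invMap b).symm⟩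
      rw [mulLeftAction_lTensor, mulLeftAction_apply, comulLift_mul]
      refine mkQ_eq_iff.2 ?_
      rw [← sub_mul]
      exact hp.mul_comulLift_rightBalancing_mem hA u _
        (mkQ_eq_iff.1 (hp.mkQ_comulLift_rho_theta y))
    · rw [mulRightAction_rTensor, mulRightAction_apply, comulLift_mul]
      congr 2
      exact comulLift_inL A _
  coassoc_LR := by
    refine coassociative_of_lift (comulLift A) (comulLift_coassoc A) (fun b u => ?_) (fun a v => ?_)
    · rw [mulRightAction_lTensor, mulRightAction_apply, comulLift_mul]
      refine mkQ_eq_iff.2 ?_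
      rw [← mul_sub]
      exact comulLift_mul_leftBalancing_mem hA u _ (mkQ_eq_iff.1 (mkQ_comulLift_rho A (θ.map b)))
    · rw [mulLeftAction_rTensor, mulLeftAction_apply, comulLift_mul]
      congr 2
      exact comulLift_inL A _
  antipode_targetL := hp.antipode_rho
  antipode_targetR y := by
    simp [leftSmashData, hp.antipode_inL]
  antipode_left x t ht := by
    have e1 : ∀ t, LinearMap.mul' k _ ((LeftSmash.antipode A).rTensor _ t) =
        TensorProduct.lift (LinearMap.mul k _ ∘ₗ LeftSmash.antipode A) t := fun t => by
      induction t using TensorProduct.induction_on with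
      | zero => simp
      | tmul p q => simp
      | add p q hp hq => simp only [map_add, hp, hq]
    -- Independence of the representative follows from `τ(ρ(a) u) = τ(u) a`.
    refine (e1 t).trans ((lift_eq_of_mkQ_eq _ (fun a u v => ?_) ht).trans ?_)
    · simp [leftSmashData, mulLeftAction_apply, hp.antipode_mul hA, hp.antipode_rho, mul_assoc]
    · rw [lift_eq_sweedler]
      exact hp.sweedler_comulLift_antipode_mul x
  antipode_right x t ht := by
    have e1 : ∀ t, LinearMap.mul' k _ ((LeftSmash.antipode A).lTensor _ t) =
        TensorProduct.lift ((LinearMap.mul k _).compl₂ (LeftSmash.antipode A)) t := fun t => by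
      induction t using TensorProduct.induction_on with
      | zero => simp
      | tmul p q => simp
      | add p q hp hq => simp only [map_add, hp, hq]
    refine (e1 t).trans ((lift_eq_of_mkQ_eq _ (fun a u v => ?_) ht).trans ?_)
    · simp [leftSmashData, mulRightAction_apply, hp.antipode_mul hA, hp.antipode_inL, mul_assoc]
    · rw [lift_eq_sweedler]
      exact hp.sweedler_comulLift_mul_antipode x

/-- The formulas for `α_R` agree by the key identity. Both sets of structure maps are brought to the
mixed form `α_R = ρ ∘ θ`, `β_R = φ⁻¹`, in which the axioms were checked. -/
theorem phiLeftData_eq : phiLeftData A B φ =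
    leftSmashData A (rho A ∘ₗ θ.map) (inL A ∘ₗ φ.invMap) (counitR A B φ) := by
  unfold phiLeftData
  congr 1
  refine LinearMap.ext fun y => ?_
  rw [LinearMap.comp_apply, lift_eq_sweedler, LinearMap.comp_apply, hp.rho_theta]
  rfl

theorem thetaLeftData_eq : thetaLeftData A B θ =
    leftSmashData A (rho A ∘ₗ θ.map) (inL A ∘ₗ φ.invMap) (counitR A B φ) := by
  unfold thetaLeftData
  congr 1
  · refine LinearMap.ext fun y => ?_
    rw [LinearMap.comp_apply, LinearMap.comp_apply, lift_eq_sweedler, LinearMap.comp_apply,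
      hp.phi_inv_apply]
    rfl
  · refine LinearMap.ext fun u => ?_
    induction u using LeftSmash.induction_on' with
    | add u v hu hv => simp only [map_add, hu, hv]
    | mul x h =>
      rw [counitR_mul_inH, hp.phi_apply, linearMap_sweedler, apply_sweedler]
      simp only [LinearMap.comp_apply, LinearEquiv.coe_coe, equiv_symm_mul,
        LinearMap.rTensor_tmul]
      conv_lhs => rw [← sweedler_tmul (A.coact x)]
      simp only [sweedler_tmul_left, linearMap_sweedler, linearEquiv_sweedler,
        TensorProduct.assoc_tmul, TensorProduct.map_tmul, LinearMap.comp_apply,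
        LinearMap.rTensor_tmul, LinearMap.mul'_apply, TensorProduct.lift.tmul, B.act_mul]

end CompatiblePair

end RightBialgebroid

/-! ### Transport of structure along an isomorphism -/

section Transport

variable {k A B K K' : Type*} [Field k] [Ring A] [Algebra k A] [Ring B] [Algebra k B]
  [Ring K] [Algebra k K] [Ring K'] [Algebra k K']

/-- The isomorphism `Ψ ⊗ Ψ`. -/
def tensorEquiv (Ψ : K ≃ₐ[k] K') : K ⊗[k] K ≃ₐ[k] K' ⊗[k] K' :=
  Algebra.TensorProduct.congr Ψ Ψ

@[simp]
theorem tensorEquiv_tmul (Ψ : K ≃ₐ[k] K') (u v : K) :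
    tensorEquiv Ψ (u ⊗ₜ[k] v) = Ψ u ⊗ₜ[k] Ψ v := rfl

section Balancing

variable {r l : A →ₗ[k] Module.End k K} {r' l' : A →ₗ[k] Module.End k K'} {Ψ : K ≃ₐ[k] K'}

theorem tensorEquiv_mem_balancing (hr : ∀ a u, Ψ (r a u) = r' a (Ψ u))
    (hl : ∀ a u, Ψ (l a u) = l' a (Ψ u)) {t : K ⊗[k] K} (ht : t ∈ balancing r l) :
    tensorEquiv Ψ t ∈ balancing r' l' := by
  suffices balancing r l ≤ (balancing r' l').comap (tensorEquiv Ψ).toLinearMap from this ht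
  refine balancing_le _ _ _ fun a u v => Submodule.subset_span ⟨a, Ψ u, Ψ v, ?_⟩
  simp [hr, hl]

theorem tensorEquiv_mem_balancing_iff (hr : ∀ a u, Ψ (r a u) = r' a (Ψ u))
    (hl : ∀ a u, Ψ (l a u) = l' a (Ψ u)) {t : K ⊗[k] K} :
    tensorEquiv Ψ t ∈ balancing r' l' ↔ t ∈ balancing r l := by
  refine ⟨fun h => ?_, tensorEquiv_mem_balancing hr hl⟩
  have := tensorEquiv_mem_balancing (Ψ := Ψ.symm) (r := r') (l := l') (r' := r) (l' := l)
    (fun a u => by rw [← Ψ.apply_symm_apply u, ← hr]; simp)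
    (fun a u => by rw [← Ψ.apply_symm_apply u, ← hl]; simp) h
  rwa [show tensorEquiv Ψ.symm (tensorEquiv Ψ t) = t from (tensorEquiv Ψ).symm_apply_apply t]
    at this

theorem tensorEquiv_mkQ_eq_iff (hr : ∀ a u, Ψ (r a u) = r' a (Ψ u))
    (hl : ∀ a u, Ψ (l a u) = l' a (Ψ u)) {t s : K ⊗[k] K} :
    (balancing r' l').mkQ (tensorEquiv Ψ t) = (balancing r' l').mkQ (tensorEquiv Ψ s) ↔
      (balancing r l).mkQ t = (balancing r l).mkQ s := by
  rw [mkQ_eq_iff, mkQ_eq_iff, ← map_sub, tensorEquiv_mem_balancing_iff hr hl]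

/-- As `Ψ ⊗ Ψ` is onto and matches the relations exactly, every representative of `c' (Ψ x)` comes
from one of `c x`. This is how axioms quantified over all representatives are transported. -/
theorem tensorEquiv_mkQ_eq_comul_iff (hr : ∀ a u, Ψ (r a u) = r' a (Ψ u))
    (hl : ∀ a u, Ψ (l a u) = l' a (Ψ u)) {c : K →ₗ[k] BalancedTensor r l}
    {c' : K' →ₗ[k] BalancedTensor r' l'}
    (hc : ∀ z t, (balancing r l).mkQ t = c z → c' (Ψ z) = (balancing r' l').mkQ (tensorEquiv Ψ t))
    {x : K} {t : K ⊗[k] K} :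
    (balancing r' l').mkQ (tensorEquiv Ψ t) = c' (Ψ x) ↔ (balancing r l).mkQ t = c x := by
  obtain ⟨s, hs⟩ := Submodule.mkQ_surjective _ (c x)
  rw [hc x s hs, ← hs, tensorEquiv_mkQ_eq_iff hr hl]

end Balancing

/-- The map `Ψ ⊗ Ψ ⊗ Ψ` descends to the triple balanced tensor products and commutes with `joinLeft`
and `joinRight`. -/
theorem Coassociative.transport {r₁ l₁ : A →ₗ[k] Module.End k K} {r₂ l₂ : B →ₗ[k] Module.End k K}
    {r₁' l₁' : A →ₗ[k] Module.End k K'} {r₂' l₂' : B →ₗ[k] Module.End k K'}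
    {c₁ : K →ₗ[k] BalancedTensor r₁ l₁} {c₂ : K →ₗ[k] BalancedTensor r₂ l₂}
    {c₁' : K' →ₗ[k] BalancedTensor r₁' l₁'} {c₂' : K' →ₗ[k] BalancedTensor r₂' l₂'}
    (h : Coassociative c₁ c₂) {Ψ : K ≃ₐ[k] K'}
    (hr₁ : ∀ a u, Ψ (r₁ a u) = r₁' a (Ψ u)) (hl₁ : ∀ a u, Ψ (l₁ a u) = l₁' a (Ψ u))
    (hr₂ : ∀ a u, Ψ (r₂ a u) = r₂' a (Ψ u)) (hl₂ : ∀ a u, Ψ (l₂ a u) = l₂' a (Ψ u))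
    (hc₁ : ∀ z t, (balancing r₁ l₁).mkQ t = c₁ z →
      c₁' (Ψ z) = (balancing r₁' l₁').mkQ (tensorEquiv Ψ t))
    (hc₂ : ∀ z t, (balancing r₂ l₂).mkQ t = c₂ z →
      c₂' (Ψ z) = (balancing r₂' l₂').mkQ (tensorEquiv Ψ t)) :
    Coassociative c₁' c₂' := by
  let P : K ⊗[k] (K ⊗[k] K) →ₗ[k] K' ⊗[k] (K' ⊗[k] K') :=
    TensorProduct.map Ψ.toLinearMap (tensorEquiv Ψ).toLinearMap
  have hP : balancing₃ r₁ l₁ r₂ l₂ ≤ (balancing₃ r₁' l₁' r₂' l₂').comap P := by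
    refine Submodule.span_le.2 ?_
    rintro t (⟨a, u, v, w, rfl⟩ | ⟨b, u, v, w, rfl⟩)
    · exact Submodule.subset_span (Or.inl ⟨a, Ψ u, Ψ v, Ψ w, by simp [P, hr₁, hl₁]⟩)
    · exact Submodule.subset_span (Or.inr ⟨b, Ψ u, Ψ v, Ψ w, by simp [P, hr₂, hl₂]⟩)
  let Q := Submodule.mapQ _ _ P hP
  have hQL : ∀ t u, joinLeft r₁' l₁' r₂' l₂' (c₁' (Ψ t)) (Ψ u) =
      Q (joinLeft r₁ l₁ r₂ l₂ (c₁ t) u) := by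
    intro t u
    obtain ⟨s, hs⟩ := Submodule.mkQ_surjective _ (c₁ t)
    rw [hc₁ t s hs, ← hs, joinLeft_mkQ, joinLeft_mkQ]
    change _ = (balancing₃ r₁' l₁' r₂' l₂').mkQ (P _)
    congr 1
    clear hs
    induction s using TensorProduct.induction_on with
    | zero => simp
    | tmul p q => simp [P]
    | add p q hp hq => simp only [map_add, TensorProduct.add_tmul, hp, hq]
  have hQR : ∀ t u, joinRight r₁' l₁' r₂' l₂' (c₂' (Ψ t)) (Ψ u) =
      Q (joinRight r₁ l₁ r₂ l₂ (c₂ t) u) := by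
    intro t u
    obtain ⟨s, hs⟩ := Submodule.mkQ_surjective _ (c₂ t)
    rw [hc₂ t s hs, ← hs, joinRight_mkQ, joinRight_mkQ]
    rfl
  intro x' t' s' ht' hs'
  obtain ⟨x, rfl⟩ := Ψ.surjective x'
  obtain ⟨t, rfl⟩ := (tensorEquiv Ψ).surjective t'
  obtain ⟨s, rfl⟩ := (tensorEquiv Ψ).surjective s'
  rw [tensorEquiv_mkQ_eq_comul_iff hr₂ hl₂ hc₂] at ht'
  rw [tensorEquiv_mkQ_eq_comul_iff hr₁ hl₁ hc₁] at hs'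
  have key := congrArg Q (h x t s ht' hs')
  have e₁ : ∀ t, TensorProduct.lift (joinLeft r₁' l₁' r₂' l₂' ∘ₗ c₁') (tensorEquiv Ψ t) =
      Q (TensorProduct.lift (joinLeft r₁ l₁ r₂ l₂ ∘ₗ c₁) t) := fun t => by
    induction t using TensorProduct.induction_on with
    | zero => simp
    | tmul p q => simpa using hQL p q
    | add p q hp hq => simp only [map_add, hp, hq]
  have e₂ : ∀ t, TensorProduct.lift (joinRight r₁' l₁' r₂' l₂' ∘ₗ c₂').flip (tensorEquiv Ψ t) =
      Q (TensorProduct.lift (joinRight r₁ l₁ r₂ l₂ ∘ₗ c₂).flip t) := fun t => by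
    induction t using TensorProduct.induction_on with
    | zero => simp
    | tmul p q => simpa using hQR q p
    | add p q hp hq => simp only [map_add, hp, hq]
  rw [e₁, e₂, key]

theorem LeftBialgebroidData.IsLeftBialgebroid.transport {D : LeftBialgebroidData k A K}
    {D' : LeftBialgebroidData k A K'} (h : D.IsLeftBialgebroid) {Ψ : K ≃ₐ[k] K'}
    (hs : ∀ x, Ψ (D.source x) = D'.source x) (ht : ∀ x, Ψ (D.target x) = D'.target x)
    (he : ∀ z, D'.counit (Ψ z) = D.counit z)
    (hc : ∀ z t, (leftBalancing D.source D.target).mkQ t = D.comul z →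
      D'.comul (Ψ z) = (leftBalancing D'.source D'.target).mkQ (tensorEquiv Ψ t)) :
    D'.IsLeftBialgebroid := by
  have hr : ∀ a u, Ψ (mulLeftAction D.target a u) = mulLeftAction D'.target a (Ψ u) := fun a u => by
    simp [mulLeftAction_apply, ht]
  have hl : ∀ a u, Ψ (mulLeftAction D.source a u) = mulLeftAction D'.source a (Ψ u) := fun a u => by
    simp [mulLeftAction_apply, hs]
  have rep : ∀ {x t}, (leftBalancing D'.source D'.target).mkQ (tensorEquiv Ψ t) = D'.comul (Ψ x) →
      (leftBalancing D.source D.target).mkQ t = D.comul x :=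
    (tensorEquiv_mkQ_eq_comul_iff hr hl hc).1
  constructor
  · rw [← hs, h.source_one, map_one]
  · intro a b
    rw [← hs, h.source_mul, map_mul, hs, hs]
  · rw [← ht, h.target_one, map_one]
  · intro a b
    rw [← ht, h.target_mul, map_mul, ht, ht]
  · intro a b
    rw [← hs, ← ht, ← map_mul, h.source_target_comm, map_mul]
  · intro a b x' t' h'
    obtain ⟨x, rfl⟩ := Ψ.surjective x'
    obtain ⟨t, rfl⟩ := (tensorEquiv Ψ).surjective t'
    rw [← hs, ← ht, ← map_mul, ← map_mul, hc _ _ (h.comul_bimodule a b x t (rep h')).symm,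
      map_mul, tensorEquiv_tmul]
  · intro a b x'
    obtain ⟨x, rfl⟩ := Ψ.surjective x'
    rw [← hs, ← ht, ← map_mul, ← map_mul, he, he, h.counit_bimodule]
  · exact h.coassoc.transport hr hl hr hl hc hc
  · intro x' t' h'
    obtain ⟨x, rfl⟩ := Ψ.surjective x'
    obtain ⟨t, rfl⟩ := (tensorEquiv Ψ).surjective t'
    conv_rhs => rw [← h.counit_left x t (rep h')]
    clear h'
    induction t using TensorProduct.induction_on with
    | zero => simp
    | tmul p q => simp [he, hs]
    | add p q hp hq => simp only [map_add, hp, hq]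
  · intro x' t' h'
    obtain ⟨x, rfl⟩ := Ψ.surjective x'
    obtain ⟨t, rfl⟩ := (tensorEquiv Ψ).surjective t'
    conv_rhs => rw [← h.counit_right x t (rep h')]
    clear h'
    induction t using TensorProduct.induction_on with
    | zero => simp
    | tmul p q => simp [he, ht]
    | add p q hp hq => simp only [map_add, hp, hq]
  · intro x' t' u' h' hu
    obtain ⟨x, rfl⟩ := Ψ.surjective x'
    obtain ⟨t, rfl⟩ := (tensorEquiv Ψ).surjective t'
    obtain ⟨u, rfl⟩ := (tensorEquiv Ψ).surjective u'
    rw [← map_mul]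
    exact (tensorEquiv_mem_balancing_iff hr hl).2
      (h.comul_factor x t u (rep h') ((tensorEquiv_mem_balancing_iff hr hl).1 hu))
  · intro t' u' h'
    obtain ⟨t, rfl⟩ := (tensorEquiv Ψ).surjective t'
    obtain ⟨u, rfl⟩ := (tensorEquiv Ψ).surjective u'
    rw [← map_one Ψ] at h'
    rw [← map_mul]
    exact (tensorEquiv_mkQ_eq_iff hr hl).2 (h.comul_one t u (rep h'))
  · intro x' y' s' t' p' u' hs' ht' hp'
    obtain ⟨x, rfl⟩ := Ψ.surjective x'
    obtain ⟨y, rfl⟩ := Ψ.surjective y'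
    obtain ⟨s, rfl⟩ := (tensorEquiv Ψ).surjective s'
    obtain ⟨t, rfl⟩ := (tensorEquiv Ψ).surjective t'
    obtain ⟨p, rfl⟩ := (tensorEquiv Ψ).surjective p'
    obtain ⟨u, rfl⟩ := (tensorEquiv Ψ).surjective u'
    rw [← map_mul Ψ] at hp'
    rw [← map_mul, ← map_mul, ← map_mul]
    exact (tensorEquiv_mkQ_eq_iff hr hl).2 (h.comul_mul x y s t p u (rep hs') (rep ht') (rep hp'))
  · intro a
    rw [← hs, ← map_one Ψ, ← map_mul, he, h.counit_source]
  · intro x' y' a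
    obtain ⟨x, rfl⟩ := Ψ.surjective x'
    obtain ⟨y, rfl⟩ := Ψ.surjective y'
    simp only [← hs, ← map_mul, he]
    exact h.counit_mul_source x y a

theorem RightBialgebroidData.IsRightBialgebroid.transport {D : RightBialgebroidData k A K}
    {D' : RightBialgebroidData k A K'} (h : D.IsRightBialgebroid) {Ψ : K ≃ₐ[k] K'}
    (hs : ∀ x, Ψ (D.source x) = D'.source x) (ht : ∀ x, Ψ (D.target x) = D'.target x)
    (he : ∀ z, D'.counit (Ψ z) = D.counit z)
    (hc : ∀ z t, (rightBalancing D.source D.target).mkQ t = D.comul z →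
      D'.comul (Ψ z) = (rightBalancing D'.source D'.target).mkQ (tensorEquiv Ψ t)) :
    D'.IsRightBialgebroid := by
  have hr : ∀ a u, Ψ (mulRightAction D.source a u) = mulRightAction D'.source a (Ψ u) :=
    fun a u => by simp [mulRightAction_apply, hs]
  have hl : ∀ a u, Ψ (mulRightAction D.target a u) = mulRightAction D'.target a (Ψ u) :=
    fun a u => by simp [mulRightAction_apply, ht]
  have rep : ∀ {x t}, (rightBalancing D'.source D'.target).mkQ (tensorEquiv Ψ t) =
      D'.comul (Ψ x) → (rightBalancing D.source D.target).mkQ t = D.comul x :=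
    (tensorEquiv_mkQ_eq_comul_iff hr hl hc).1
  constructor
  · rw [← hs, h.source_one, map_one]
  · intro a b
    rw [← hs, h.source_mul, map_mul, hs, hs]
  · rw [← ht, h.target_one, map_one]
  · intro a b
    rw [← ht, h.target_mul, map_mul, ht, ht]
  · intro a b
    rw [← hs, ← ht, ← map_mul, h.source_target_comm, map_mul]
  · intro a b x' t' h'
    obtain ⟨x, rfl⟩ := Ψ.surjective x'
    obtain ⟨t, rfl⟩ := (tensorEquiv Ψ).surjective t'
    rw [← hs, ← ht, ← map_mul, ← map_mul, hc _ _ (h.comul_bimodule a b x t (rep h')).symm,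
      map_mul, tensorEquiv_tmul]
  · intro a b x'
    obtain ⟨x, rfl⟩ := Ψ.surjective x'
    rw [← hs, ← ht, ← map_mul, ← map_mul, he, he, h.counit_bimodule]
  · exact h.coassoc.transport hr hl hr hl hc hc
  · intro x' t' h'
    obtain ⟨x, rfl⟩ := Ψ.surjective x'
    obtain ⟨t, rfl⟩ := (tensorEquiv Ψ).surjective t'
    conv_rhs => rw [← h.counit_left x t (rep h')]
    clear h'
    induction t using TensorProduct.induction_on with
    | zero => simp
    | tmul p q => simp [he, ht]
    | add p q hp hq => simp only [map_add, hp, hq]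
  · intro x' t' h'
    obtain ⟨x, rfl⟩ := Ψ.surjective x'
    obtain ⟨t, rfl⟩ := (tensorEquiv Ψ).surjective t'
    conv_rhs => rw [← h.counit_right x t (rep h')]
    clear h'
    induction t using TensorProduct.induction_on with
    | zero => simp
    | tmul p q => simp [he, hs]
    | add p q hp hq => simp only [map_add, hp, hq]
  · intro x' t' u' h' hu
    obtain ⟨x, rfl⟩ := Ψ.surjective x'
    obtain ⟨t, rfl⟩ := (tensorEquiv Ψ).surjective t'
    obtain ⟨u, rfl⟩ := (tensorEquiv Ψ).surjective u'
    rw [← map_mul]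
    exact (tensorEquiv_mem_balancing_iff hr hl).2
      (h.comul_factor x t u (rep h') ((tensorEquiv_mem_balancing_iff hr hl).1 hu))
  · intro t' u' h'
    obtain ⟨t, rfl⟩ := (tensorEquiv Ψ).surjective t'
    obtain ⟨u, rfl⟩ := (tensorEquiv Ψ).surjective u'
    rw [← map_one Ψ] at h'
    rw [← map_mul]
    exact (tensorEquiv_mkQ_eq_iff hr hl).2 (h.comul_one t u (rep h'))
  · intro x' y' s' t' p' u' hs' ht' hp'
    obtain ⟨x, rfl⟩ := Ψ.surjective x'
    obtain ⟨y, rfl⟩ := Ψ.surjective y'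
    obtain ⟨s, rfl⟩ := (tensorEquiv Ψ).surjective s'
    obtain ⟨t, rfl⟩ := (tensorEquiv Ψ).surjective t'
    obtain ⟨p, rfl⟩ := (tensorEquiv Ψ).surjective p'
    obtain ⟨u, rfl⟩ := (tensorEquiv Ψ).surjective u'
    rw [← map_mul Ψ] at hp'
    rw [← map_mul, ← map_mul, ← map_mul]
    exact (tensorEquiv_mkQ_eq_iff hr hl).2 (h.comul_mul x y s t p u (rep hs') (rep ht') (rep hp'))
  · intro a
    rw [← hs, ← map_one Ψ, ← map_mul, he, h.counit_source]
  · intro x' y' a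
    obtain ⟨x, rfl⟩ := Ψ.surjective x'
    obtain ⟨y, rfl⟩ := Ψ.surjective y'
    simp only [← hs, ← map_mul, he]
    exact h.counit_source_mul x y a

theorem SymmetricHopfAlgebroidData.IsSymmetricHopfAlgebroid.transport
    {D : SymmetricHopfAlgebroidData k A B K} {D' : SymmetricHopfAlgebroidData k A B K'}
    (h : D.IsSymmetricHopfAlgebroid) {Ψ : K ≃ₐ[k] K'} (hΨ : D.Intertwines D' Ψ) :
    D'.IsSymmetricHopfAlgebroid := by
  have hrL : ∀ a u, Ψ (mulLeftAction D.left.target a u) =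
      mulLeftAction D'.left.target a (Ψ u) := fun a u => by
    simp [mulLeftAction_apply, hΨ.targetL]
  have hlL : ∀ a u, Ψ (mulLeftAction D.left.source a u) =
      mulLeftAction D'.left.source a (Ψ u) := fun a u => by
    simp [mulLeftAction_apply, hΨ.sourceL]
  have hrR : ∀ a u, Ψ (mulRightAction D.right.source a u) =
      mulRightAction D'.right.source a (Ψ u) := fun a u => by
    simp [mulRightAction_apply, hΨ.sourceR]
  have hlR : ∀ a u, Ψ (mulRightAction D.right.target a u) =
      mulRightAction D'.right.target a (Ψ u) := fun a u => by
    simp [mulRightAction_apply, hΨ.targetR]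
  constructor
  · exact h.isLeftBialgebroid.transport hΨ.sourceL hΨ.targetL hΨ.counitL hΨ.comulL
  · exact h.isRightBialgebroid.transport hΨ.sourceR hΨ.targetR hΨ.counitR hΨ.comulR
  · rw [← map_one Ψ, ← hΨ.antipode, h.antipode_one]
  · intro x' y'
    obtain ⟨x, rfl⟩ := Ψ.surjective x'
    obtain ⟨y, rfl⟩ := Ψ.surjective y'
    rw [← map_mul, ← hΨ.antipode, ← hΨ.antipode, ← hΨ.antipode, ← map_mul, h.antipode_mul]
  · intro y
    rw [← hΨ.targetR, hΨ.counitL, ← hΨ.sourceL, h.sourceL_counitL_targetR]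
  · intro y
    rw [← hΨ.sourceR, hΨ.counitL, ← hΨ.targetL, h.targetL_counitL_sourceR]
  · intro x
    rw [← hΨ.targetL, hΨ.counitR, ← hΨ.sourceR, h.sourceR_counitR_targetL]
  · intro x
    rw [← hΨ.sourceL, hΨ.counitR, ← hΨ.targetR, h.targetR_counitR_sourceL]
  · exact h.coassoc_RL.transport hrR hlR hrL hlL hΨ.comulR hΨ.comulL
  · exact h.coassoc_LR.transport hrL hlL hrR hlR hΨ.comulL hΨ.comulR
  · intro x
    rw [← hΨ.targetL, ← hΨ.antipode, h.antipode_targetL, hΨ.sourceL]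
  · intro y
    rw [← hΨ.targetR, ← hΨ.antipode, h.antipode_targetR, hΨ.sourceR]
  · intro x' t' h'
    obtain ⟨x, rfl⟩ := Ψ.surjective x'
    obtain ⟨t, rfl⟩ := (tensorEquiv Ψ).surjective t'
    rw [hΨ.counitR, ← hΨ.sourceR, ← h.antipode_left x t
      ((tensorEquiv_mkQ_eq_comul_iff hrL hlL hΨ.comulL).1 h')]
    clear h'
    induction t using TensorProduct.induction_on with
    | zero => simp
    | tmul p q => simp [hΨ.antipode]
    | add p q hp hq => simp only [map_add, hp, hq]
  · intro x' t' h'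
    obtain ⟨x, rfl⟩ := Ψ.surjective x'
    obtain ⟨t, rfl⟩ := (tensorEquiv Ψ).surjective t'
    rw [hΨ.counitL, ← hΨ.sourceL, ← h.antipode_right x t
      ((tensorEquiv_mkQ_eq_comul_iff hrR hlR hΨ.comulR).1 h')]
    clear h'
    induction t using TensorProduct.induction_on with
    | zero => simp
    | tmul p q => simp [hΨ.antipode]
    | add p q hp hq => simp only [map_add, hp, hq]

end Transport

/-! ### The isomorphism `Ψ` and the structure on `H ♯ R` -/

section Psi

variable {k H L R M : Type*} [Field k] [Ring H] [HopfAlgebra k H] [Ring L] [Algebra k L]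
  [Ring R] [Algebra k R] [AddCommGroup M] [Module k M]

local notation "Δ" => comul (R := k)
local notation "ε" => counit (R := k)
local notation "S" => HopfAlgebra.antipode k

variable {A : LeftRightYDModuleAlgebra k H L} {B : RightLeftYDModuleAlgebra k H R}

namespace RightSmash

variable (B)

theorem mul_inH_mul_inR_mul_inH (h g : H) (y w : R) :
    inH B h * inR B y * (inH B g * inR B w) =
      sweedler (Δ g) fun a b => inH B (h * a) * inR B (B.act y b * w) := by
  rw [mul_assoc, ← mul_assoc (inR B y), inR_mul_inH, sweedler_mul, mul_sweedler]
  simp only [inR_mul, inH_mul, mul_assoc]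

theorem comulLift_inH_mul_inR (h : H) (y : R) : comulLift B (inH B h * inR B y) =
    sweedler (Δ h) fun a b => inH B a ⊗ₜ[k] (inH B b * inR B y) := by
  simp only [comulLift, LinearMap.comp_apply, LinearEquiv.coe_coe, equiv_symm_mul,
    LinearMap.rTensor_tmul]
  conv_lhs => rw [← sweedler_tmul (Δ h)]
  simp only [sweedler_tmul_left, linearMap_sweedler, linearEquiv_sweedler,
    TensorProduct.assoc_tmul, TensorProduct.map_tmul, ← mk_eq]
  rfl

theorem antipodeR_eq (y : R) : antipodeR B y =
    sweedler (B.coact y) fun h a => inR B a * inH B (S (S h)) := by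
  rw [antipodeR, LinearMap.comp_apply, lift_eq_sweedler]
  simp

theorem antipode_inH_mul_inR (h : H) (y : R) :
    RightSmash.antipode B (inH B h * inR B y) = antipodeR B y * inH B (S h) := by
  simp [RightSmash.antipode, equiv_symm_mul]

variable (A) in
/-- The counit `h ♯ y ↦ h ▸ θ(y)`. -/
def counitL (θ : AntiIso k R L) : RightSmash B.toRightModuleAlgebra →ₗ[k] L :=
  TensorProduct.lift (A.act.compl₂ θ.map) ∘ₗ (equiv _).symm.toLinearMap

theorem counitL_inH_mul_inR (θ : AntiIso k R L) (h : H) (y : R) :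
    counitL A B θ (inH B h * inR B y) = A.act h (θ.map y) := by
  simp [counitL, equiv_symm_mul]

end RightSmash

theorem psi_mul_inH (φ : AntiIso k L R) (x : L) (h : H) :
    psi A B φ (LeftSmash.inL A x * LeftSmash.inH A h) =
      RightSmash.lam B (φ.map x) * RightSmash.inH B h := by
  simp [psi, LeftSmash.equiv_symm_mul]

theorem psi_inL (φ : AntiIso k L R) (x : L) :
    psi A B φ (LeftSmash.inL A x) = RightSmash.lam B (φ.map x) := by
  have := psi_mul_inH (A := A) (B := B) φ x 1
  rwa [LeftSmash.inH_one, RightSmash.inH_one, mul_one, mul_one] at this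

theorem psi_inH (φ : AntiIso k L R) (h : H) :
    psi A B φ (LeftSmash.inH A h) = RightSmash.inH B h := by
  have := psi_mul_inH (A := A) (B := B) φ 1 h
  rwa [LeftSmash.inL_one, φ.map_one, RightSmash.lam_one, one_mul, one_mul] at this

theorem psiBar_mul_inR (θ : AntiIso k R L) (h : H) (y : R) :
    psiBar A B θ (RightSmash.inH B h * RightSmash.inR B y) =
      LeftSmash.inH A h * LeftSmash.rho A (θ.map y) := by
  simp [psiBar, RightSmash.equiv_symm_mul]

theorem psiBar_inH (θ : AntiIso k R L) (h : H) :
    psiBar A B θ (RightSmash.inH B h) = LeftSmash.inH A h := by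
  have := psiBar_mul_inR (A := A) (B := B) θ h 1
  rwa [RightSmash.inR_one, θ.map_one, LeftSmash.rho_one, mul_one, mul_one] at this

/-- On `L` the map is `lam ∘ φ`, a composite of two antimultiplicative maps. The smash relation goes
to `inH_mul_lam`, since `φ(h₁ ▸ z) = φ(z) ◂ S(h₁)`. -/
theorem CompatiblePhi.psi_mul {φ : AntiIso k L R} (hφ : CompatiblePhi A B φ)
    (hB : B.IsBraidedCommutative) (u v : LeftSmash A.toLeftModuleAlgebra) :
    psi A B φ (u * v) = psi A B φ u * psi A B φ v := by
  induction u using LeftSmash.induction_on' with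
  | add u u' hu hu' => rw [add_mul, map_add, map_add, add_mul, hu, hu']
  | mul x h =>
    induction v using LeftSmash.induction_on' with
    | add v v' hv hv' => rw [mul_add, map_add, map_add, mul_add, hv, hv']
    | mul z g =>
      rw [LeftSmash.mul_inH_mul_inL_mul_inH]
      simp only [linearMap_sweedler, psi_mul_inH]
      rw [mul_assoc, ← mul_assoc (RightSmash.inH B h), RightSmash.inH_mul_lam, sweedler_mul,
        mul_sweedler]
      simp only [φ.map_mul, hφ.act, RightSmash.lam_mul hB, RightSmash.inH_mul, mul_assoc]

-- On elements `h ρ(x)` the coproduct takes the shape it has on `H ♯ R`. The congruence for `ρ(x)`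
-- may be multiplied by the coproduct of `h` thanks to the Takeuchi condition.
open LeftSmash in
theorem LeftSmash.mkQ_comulLift_inH_mul_rho (hA : A.IsBraidedCommutative) (h : H) (x : L) :
    (leftBalancing (inL A) (rho A)).mkQ (comulLift A (inH A h * rho A x)) =
      (leftBalancing (inL A) (rho A)).mkQ
        (sweedler (Δ h) fun a b => inH A a ⊗ₜ[k] (inH A b * rho A x)) := by
  have e1 : sweedler (Δ h) (fun a b => inH A a ⊗ₜ[k] (inH A b * rho A x)) =
      comulLift A (inH A h) * (1 ⊗ₜ[k] rho A x) := by
    simp only [comulLift_inH, sweedler_mul, Algebra.TensorProduct.tmul_mul_tmul, mul_one]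
  rw [comulLift_mul, e1]
  refine mkQ_eq_iff.2 ?_
  rw [← mul_sub]
  exact comulLift_mul_leftBalancing_mem hA _ _ (mkQ_eq_iff.1 (mkQ_comulLift_rho A _))

namespace CompatiblePair

open LeftSmash

variable {φ : AntiIso k L R} {θ : AntiIso k R L} (hp : CompatiblePair A B φ θ)
include hp

/-- `ρ ∘ θ` is multiplicative, and `rho_theta_mul_inH` is the smash relation of `H ♯ R`. -/
theorem psiBar_mul (hA : A.IsBraidedCommutative) (u v : RightSmash B.toRightModuleAlgebra) :
    psiBar A B θ (u * v) = psiBar A B θ u * psiBar A B θ v := by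
  induction u using RightSmash.induction_on' with
  | add u u' hu hu' => rw [add_mul, map_add, map_add, add_mul, hu, hu']
  | mul h y =>
    induction v using RightSmash.induction_on' with
    | add v v' hv hv' => rw [mul_add, map_add, map_add, mul_add, hv, hv']
    | mul g w =>
      rw [RightSmash.mul_inH_mul_inR_mul_inH]
      simp only [linearMap_sweedler, psiBar_mul_inR]
      rw [mul_assoc, ← mul_assoc (rho A _), hp.rho_theta_mul_inH, sweedler_mul,
        mul_sweedler]
      simp only [θ.map_mul, rho_mul hA, inH_mul, mul_assoc]

/-- The image of `S(y₋₁) · φ⁻¹(y₀)` is `S(y₋₁) lam(y₀) = S(y₋₂) y₋₁ y₀`, which collapses to `y`. -/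
theorem psi_rho_theta (hB : B.IsBraidedCommutative) (y : R) :
    psi A B φ (rho A (θ.map y)) = RightSmash.inR B y := by
  have e1 : ∀ h a, psi A B φ (inH A (S h) * inL A (φ.invMap a)) =
      sweedler (B.coact a) fun g b => RightSmash.inH B (S h * g) * RightSmash.inR B b :=
    fun h a => by
      rw [hp.phi.psi_mul hB, psi_inH, psi_inL, φ.map_invMap, RightSmash.lam_eq, mul_sweedler]
      simp only [RightSmash.inH_mul, mul_assoc]
  rw [hp.rho_theta, linearMap_sweedler]
  simp only [e1]
  rw [B.sweedler_coact_coassoc y (fun h g b => RightSmash.inH B (S h * g) * RightSmash.inR B b)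
    (by fun_prop) (by fun_prop) (by fun_prop)]
  have cancel : ∀ h b, sweedler (Δ h) (fun c d =>
      RightSmash.inH B (S c * d) * RightSmash.inR B b) =
      ε h • (RightSmash.inH B 1 * RightSmash.inR B b) := fun h b =>
    sweedler_antipode_mul h (fun u => RightSmash.inH B u * RightSmash.inR B b) (by fun_prop)
  simp only [cancel, RightSmash.inH_one, one_mul]
  exact B.sweedler_coact_counit y (fun b => RightSmash.inR B b) (by fun_prop)

theorem psi_psiBar (hB : B.IsBraidedCommutative) (u : RightSmash B.toRightModuleAlgebra) :
    psi A B φ (psiBar A B θ u) = u := by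
  induction u using RightSmash.induction_on' with
  | add u v hu hv => rw [map_add, map_add, hu, hv]
  | mul h y => rw [psiBar_mul_inR, hp.phi.psi_mul hB, psi_inH, hp.psi_rho_theta hB]

/-- As `lam(φ(x)) = S(x₁) φ(x₀)`, its image is `S(x₁) ρ(θ(φ(x₀))) = τ(ρ(x))`, and `τ ∘ β_L = α_L`.
-/
theorem psiBar_lam_phi (x : L) :
    psiBar A B θ (RightSmash.lam B (φ.map x)) = inL A x := by
  rw [RightSmash.lam_eq, hp.phi.sweedler_coact x _ (by fun_prop) (by fun_prop),
    linearMap_sweedler, ← hp.antipode_rho, rho_eq, linearMap_sweedler]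
  simp only [psiBar_mul_inR, hp.antipode_mul_inH]

theorem psiBar_psi (hA : A.IsBraidedCommutative) (u : LeftSmash A.toLeftModuleAlgebra) :
    psiBar A B θ (psi A B φ u) = u := by
  induction u using LeftSmash.induction_on' with
  | add u v hu hv => rw [map_add, map_add, hu, hv]
  | mul x h => rw [psi_mul_inH, hp.psiBar_mul hA, hp.psiBar_lam_phi, psiBar_inH]

/-- The isomorphism `L ♯ H ≃ H ♯ R`. -/
def psiEquiv (hA : A.IsBraidedCommutative) (hB : B.IsBraidedCommutative) :
    LeftSmash A.toLeftModuleAlgebra ≃ₐ[k] RightSmash B.toRightModuleAlgebra :=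
  AlgEquiv.ofLinearEquiv (LinearEquiv.ofLinearMap (psi A B φ) (psiBar A B θ)
    (LinearMap.ext (hp.psi_psiBar hB)) (LinearMap.ext (hp.psiBar_psi hA)) :
      LeftSmash A.toLeftModuleAlgebra ≃ₗ[k] RightSmash B.toRightModuleAlgebra)
    (by
      change psi A B φ 1 = 1
      rw [← inL_one, psi_inL, φ.map_one, RightSmash.lam_one])
    (hp.phi.psi_mul hB)

theorem psiEquiv_apply (hA : A.IsBraidedCommutative) (hB : B.IsBraidedCommutative)
    (u : LeftSmash A.toLeftModuleAlgebra) : hp.psiEquiv hA hB u = psi A B φ u := rfl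

theorem lam_phi (x : L) :
    RightSmash.lam B (φ.map x) = sweedler (A.coact x) fun a h =>
      RightSmash.inR B (θ.invMap a) * RightSmash.inH B (S h) := by
  rw [hp.phi_eq, hp.theta.lam_phiOfTheta]

theorem phiRightData_eq : phiRightData A B φ =
    rightSmashData B (RightSmash.lam B ∘ₗ φ.map) (RightSmash.inR B ∘ₗ θ.invMap)
      (RightSmash.counitL A B θ) := by
  unfold phiRightData
  congr 1
  · refine LinearMap.ext fun x => ?_
    rw [LinearMap.comp_apply, LinearMap.comp_apply, lift_eq_sweedler, LinearMap.comp_apply,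
      hp.theta_inv_apply]
    rfl
  · refine LinearMap.ext fun u => ?_
    induction u using RightSmash.induction_on' with
    | add u v hu hv => simp only [map_add, hu, hv]
    | mul h y =>
      rw [RightSmash.counitL_inH_mul_inR, hp.theta_apply, linearMap_sweedler]
      simp only [LinearMap.comp_apply, LinearEquiv.coe_coe, RightSmash.equiv_symm_mul,
        LinearMap.lTensor_tmul]
      conv_lhs => rw [← sweedler_tmul (B.coact y)]
      simp only [sweedler_tmul_right, linearMap_sweedler, linearEquiv_sweedler,
        TensorProduct.assoc_symm_tmul, TensorProduct.map_tmul, LinearMap.comp_apply,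
        LinearMap.lTensor_tmul, LinearMap.mul'_apply, TensorProduct.lift.tmul, A.mul_act]

theorem thetaRightData_eq : thetaRightData A B θ =
    rightSmashData B (RightSmash.lam B ∘ₗ φ.map) (RightSmash.inR B ∘ₗ θ.invMap)
      (RightSmash.counitL A B θ) := by
  unfold thetaRightData
  congr 1
  refine LinearMap.ext fun x => ?_
  rw [LinearMap.comp_apply, lift_eq_sweedler, LinearMap.comp_apply, hp.lam_phi]
  rfl

/-- An induction principle: surjectivity of `psiBar` means that the elements `h ρ(θ(y))` span `L ♯
H`. They correspond to `h ♯ y`, so comparisons of structure maps become short on them. -/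
theorem exists_eq_inH_mul_rho (hA : A.IsBraidedCommutative)
    {p : LeftSmash A.toLeftModuleAlgebra → Prop} (z : LeftSmash A.toLeftModuleAlgebra)
    (mul : ∀ h y, p (inH A h * rho A (θ.map y))) (add : ∀ u v, p u → p v → p (u + v)) : p z := by
  rw [← hp.psiBar_psi hA z]
  induction psi A B φ z using RightSmash.induction_on' with
  | add u v hu hv => rw [map_add]; exact add _ _ hu hv
  | mul h y => rw [psiBar_mul_inR]; exact mul h y

/-- Applying `τ` to `S(y₋₁) · φ⁻¹(y₀)` gives `ρ(θ(y₀)) S²(y₋₁)`, whose image under `Ψ` is the `y₀ ·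
S²(y₋₁)` in the definition of `τ'`. -/
theorem psi_antipode (hA : A.IsBraidedCommutative) (hB : B.IsBraidedCommutative)
    (z : LeftSmash A.toLeftModuleAlgebra) :
    psi A B φ (LeftSmash.antipode A z) = RightSmash.antipode B (psi A B φ z) := by
  induction z using hp.exists_eq_inH_mul_rho hA with
  | add u v hu hv => simp only [map_add, hu, hv]
  | mul h y =>
    have e1 : LeftSmash.antipode A (rho A (θ.map y)) =
        sweedler (B.coact y) fun h a => rho A (θ.map a) * inH A (S (S h)) := by
      rw [hp.rho_theta, linearMap_sweedler]
      simp only [hp.antipode_mul hA, hp.antipode_inL, hp.antipode_inH, φ.map_invMap]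
    rw [hp.phi.psi_mul hB, psi_inH, hp.psi_rho_theta hB, RightSmash.antipode_inH_mul_inR,
      hp.antipode_mul hA, hp.phi.psi_mul hB, hp.antipode_inH, psi_inH, e1, linearMap_sweedler,
      RightSmash.antipodeR_eq]
    simp only [hp.phi.psi_mul hB, psi_inH, hp.psi_rho_theta hB]

theorem mkQ_comulLift_inH_mul_rho_theta (h : H) (y : R) :
    (rightBalancing (rho A ∘ₗ θ.map) (inL A ∘ₗ φ.invMap)).mkQ
        (comulLift A (inH A h * rho A (θ.map y))) =
      (rightBalancing (rho A ∘ₗ θ.map) (inL A ∘ₗ φ.invMap)).mkQ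
        (sweedler (Δ h) fun a b => inH A a ⊗ₜ[k] (inH A b * rho A (θ.map y))) := by
  have e1 : sweedler (Δ h) (fun a b => inH A a ⊗ₜ[k] (inH A b * rho A (θ.map y))) =
      comulLift A (inH A h) * (1 ⊗ₜ[k] rho A (θ.map y)) := by
    simp only [comulLift_inH, sweedler_mul, Algebra.TensorProduct.tmul_mul_tmul, mul_one]
  rw [comulLift_mul, e1]
  exact rightBalancing_mkQ_mul _ _ (hp.mkQ_comulLift_rho_theta y) _

theorem tensorEquiv_psiEquiv (hA : A.IsBraidedCommutative) (hB : B.IsBraidedCommutative)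
    (h : H) (y : R) : tensorEquiv (hp.psiEquiv hA hB)
      (sweedler (Δ h) fun a b => inH A a ⊗ₜ[k] (inH A b * rho A (θ.map y))) =
      RightSmash.comulLift B (psi A B φ (inH A h * rho A (θ.map y))) := by
  rw [hp.phi.psi_mul hB, psi_inH, hp.psi_rho_theta hB, RightSmash.comulLift_inH_mul_inR]
  refine (linearMap_sweedler (tensorEquiv (hp.psiEquiv hA hB)).toLinearMap _ _).trans ?_
  simp only [AlgEquiv.toLinearMap_apply, tensorEquiv_tmul, psiEquiv_apply, hp.phi.psi_mul hB,
    psi_inH, hp.psi_rho_theta hB]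

theorem intertwines (hA : A.IsBraidedCommutative) (hB : B.IsBraidedCommutative) :
    (leftSmashData A (rho A ∘ₗ θ.map) (inL A ∘ₗ φ.invMap) (counitR A B φ)).Intertwines
      (rightSmashData B (RightSmash.lam B ∘ₗ φ.map) (RightSmash.inR B ∘ₗ θ.invMap)
        (RightSmash.counitL A B θ)) (hp.psiEquiv hA hB) := by
  have hsL : ∀ x, hp.psiEquiv hA hB (inL A x) = (RightSmash.lam B ∘ₗ φ.map) x :=
    fun x => psi_inL (A := A) φ x
  have htL : ∀ x, hp.psiEquiv hA hB (rho A x) = (RightSmash.inR B ∘ₗ θ.invMap) x := fun x => by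
    conv_lhs => rw [← θ.map_invMap x]
    exact hp.psi_rho_theta hB _
  have hsR : ∀ y, hp.psiEquiv hA hB ((rho A ∘ₗ θ.map) y) = RightSmash.inR B y :=
    fun y => hp.psi_rho_theta hB y
  have htR : ∀ y, hp.psiEquiv hA hB ((inL A ∘ₗ φ.invMap) y) = RightSmash.lam B y := fun y => by
    rw [LinearMap.comp_apply, hsL, LinearMap.comp_apply, φ.map_invMap]
  refine ⟨hsL, htL, fun z => ?_, fun z t ht => ?_, hsR, htR, fun z => ?_, fun z t ht => ?_,
    hp.psi_antipode hA hB⟩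
  · change RightSmash.counitL A B θ (psi A B φ z) = LeftSmash.counit A z
    induction z using hp.exists_eq_inH_mul_rho hA with
    | add u v hu hv => simp only [map_add, hu, hv]
    | mul h y =>
      rw [hp.phi.psi_mul hB, psi_inH, hp.psi_rho_theta hB, RightSmash.counitL_inH_mul_inR,
        counit_eq_actL, actL_mul, ← counit_eq_actL, counit_rho]
      have := actL_mul_inH A (θ.map y) 1 h
      rw [inL_one, one_mul, one_mul] at this
      exact this.symm
  · have hr : ∀ a u, hp.psiEquiv hA hB (mulLeftAction (rho A) a u) =
        mulLeftAction (RightSmash.inR B ∘ₗ θ.invMap) a (hp.psiEquiv hA hB u) := fun a u => by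
      rw [mulLeftAction_apply, map_mul, htL]; rfl
    have hl : ∀ a u, hp.psiEquiv hA hB (mulLeftAction (inL A) a u) =
        mulLeftAction (RightSmash.lam B ∘ₗ φ.map) a (hp.psiEquiv hA hB u) := fun a u => by
      rw [mulLeftAction_apply, map_mul, hsL]; rfl
    -- `Ψ ⊗ Ψ` respects the relations, so only the representative given by `comulLift` has to be
    -- considered.
    refine Eq.trans ?_ ((tensorEquiv_mkQ_eq_iff hr hl).2 ht).symm
    change (leftBalancing (RightSmash.lam B ∘ₗ φ.map) (RightSmash.inR B ∘ₗ θ.invMap)).mkQ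
      (RightSmash.comulLift B (psi A B φ z)) = _
    clear ht
    induction z using hp.exists_eq_inH_mul_rho hA with
    | add u v hu hv => simp only [map_add, hu, hv]
    | mul h y =>
      rw [← hp.tensorEquiv_psiEquiv hA hB]
      exact (tensorEquiv_mkQ_eq_iff hr hl).2 (mkQ_comulLift_inH_mul_rho hA h _).symm
  · change RightSmash.counit B (psi A B φ z) = counitR A B φ z
    induction z using hp.exists_eq_inH_mul_rho hA with
    | add u v hu hv => simp only [map_add, hu, hv]
    | mul h y =>
      rw [hp.phi.psi_mul hB, psi_inH, hp.psi_rho_theta hB, RightSmash.counit_inH_mul_inR,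
        counitR_eq_actR, hp.phi.actR_mul, actR_inH, B.one_act, hp.actR_rho_theta hB,
        smul_mul_assoc, one_mul]
  · have hr : ∀ a u, hp.psiEquiv hA hB (mulRightAction (rho A ∘ₗ θ.map) a u) =
        mulRightAction (RightSmash.inR B) a (hp.psiEquiv hA hB u) := fun a u => by
      rw [mulRightAction_apply, map_mul, hsR]; rfl
    have hl : ∀ a u, hp.psiEquiv hA hB (mulRightAction (inL A ∘ₗ φ.invMap) a u) =
        mulRightAction (RightSmash.lam B) a (hp.psiEquiv hA hB u) := fun a u => by
      rw [mulRightAction_apply, map_mul, htR]; rfl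
    refine Eq.trans ?_ ((tensorEquiv_mkQ_eq_iff hr hl).2 ht).symm
    change (rightBalancing (RightSmash.inR B) (RightSmash.lam B)).mkQ
      (RightSmash.comulLift B (psi A B φ z)) = _
    clear ht
    induction z using hp.exists_eq_inH_mul_rho hA with
    | add u v hu hv => simp only [map_add, hu, hv]
    | mul h y =>
      rw [← hp.tensorEquiv_psiEquiv hA hB]
      exact (tensorEquiv_mkQ_eq_iff hr hl).2 (hp.mkQ_comulLift_inH_mul_rho_theta h y).symm

end CompatiblePair

end Psi

end ScalarExt
end

open ScalarExt

theorem theorem4p8 {k H L R : Type*} [Field k] [Ring H] [HopfAlgebra k H]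
    [Ring L] [Algebra k L] [Ring R] [Algebra k R]
    (A : LeftRightYDModuleAlgebra k H L) (hA : A.IsBraidedCommutative)
    (B : RightLeftYDModuleAlgebra k H R) (hB : B.IsBraidedCommutative) :
    (∀ φ : AntiIso k L R, CompatiblePhi A B φ →
      ∃ θ : AntiIso k R L, θ.map = thetaOfPhi A B φ ∧ CompatibleTheta A B θ) ∧
    (∀ θ : AntiIso k R L, CompatibleTheta A B θ →
      ∃ φ : AntiIso k L R, φ.map = phiOfTheta A B θ ∧ CompatiblePhi A B φ) ∧
    (∀ (φ : AntiIso k L R) (θ : AntiIso k R L),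
      (CompatiblePhi A B φ ∧ θ.map = thetaOfPhi A B φ) ∨
        (CompatibleTheta A B θ ∧ φ.map = phiOfTheta A B θ) →
      (phiLeftData A B φ).IsSymmetricHopfAlgebroid ∧
      (thetaLeftData A B θ).IsSymmetricHopfAlgebroid ∧
      phiLeftData A B φ = thetaLeftData A B θ ∧
      (phiRightData A B φ).IsSymmetricHopfAlgebroid ∧
      (thetaRightData A B θ).IsSymmetricHopfAlgebroid ∧
      phiRightData A B φ = thetaRightData A B θ ∧
      (∃ Ψ : LeftSmash A.toLeftModuleAlgebra ≃ₐ[k] RightSmash B.toRightModuleAlgebra,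
        Ψ.toLinearMap = psi A B φ ∧ Ψ.symm.toLinearMap = psiBar A B θ ∧
        (phiLeftData A B φ).Intertwines (phiRightData A B φ) Ψ) ∧
      (∀ y, θ.map y = (phiLeftData A B φ).left.counit ((phiLeftData A B φ).right.source y)) ∧
      (∀ x, φ.map x = (phiLeftData A B φ).right.counit ((phiLeftData A B φ).left.source x))) := by
  refine ⟨fun φ hφ => hφ.exists_theta hA, fun θ hθ => hθ.exists_phi hB, fun φ θ h => ?_⟩
  have hp : CompatiblePair A B φ θ := by
    rcases h with ⟨hφ, hθ⟩ | ⟨hθ, hφ⟩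
    · exact hφ.compatiblePair hA hθ
    · exact hθ.compatiblePair hB hφ
  have hl := hp.isSymmetricHopfAlgebroid hA hB
  -- The axioms on `H ♯ R` are not verified separately; they come from `L ♯ H` along `Ψ`.
  have hr := hl.transport (hp.intertwines hA hB)
  rw [hp.phiLeftData_eq, hp.thetaLeftData_eq, hp.phiRightData_eq, hp.thetaRightData_eq]
  exact ⟨hl, hl, rfl, hr, hr, rfl, ⟨hp.psiEquiv hA hB, rfl, rfl, hp.intertwines hA hB⟩,
    fun y => (LeftSmash.counit_rho A _).symm, fun x => (LeftSmash.counitR_inL φ x).symm⟩
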